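/- Let $\mathrm{SOL}$ be the Lie group $\mathbb R^3$ with the product $(x,z,t)(x',z',t')=(x+e^{t}x',\,z+e^{-t}z',\,t+t')$. Its Lie algebra $\mathfrak{sol}$ has a basis $X,Z,T$ with $[T,X]=X$, $[T,Z]=-Z$, $[X,Z]=0$, and derived algebra $\mathbb RX\oplus\mathbb RZ$. Let $g$ be the left-invariant metric on $\mathrm{SOL}$ such that, at the identity, $X$ and $T$ are isotropic, $Z$ is orthogonal to $X$ and $T$, and $g(X,T)=g(Z,Z)=1$. Lorentz metrics are smooth and of signature $(2,1)$. Let $\mathrm{Isom}_0(g)$ be the identity component of the isometry group of $g$ (with the compact-open topology on isometries and their inverses). Then: 1. $g$ is a left-invariant Lorentz metric on $\mathrm{SOL}$ for which the derived algebra is degenerate and one of the two eigendirections of $\mathrm{ad}(T)$ in the derived algebra is isotropic. Every left-invariant Lorentz metric on $\mathrm{SOL}$ with these two properties is of the form $\varphi^*g$ for some Lie group automorphism $\varphi$ of $\mathrm{SOL}$. 2. $\mathrm{Isom}_0(g)$ is a Lie group of dimension $4$ acting smoothly on $\mathrm{SOL}$. There is an extension of topological groups $1\to \mathrm{Heis}\to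 \mathrm{Isom}_0(g)\to\mathbb R\to 1$, where $\mathrm{Heis}$ is the $3$-dimensional Heisenberg group; it is nontrivial (indeed $\mathrm{Isom}_0(g)$ is not isomorphic to $\mathrm{Heis}\times\mathbb R$ as a group), and $\mathrm{Heis}$ does not act transitively on $\mathrm{SOL}$. 3. The stabilizer in $\mathrm{Isom}_0(g)$ of every point $p$ is non-compact, isomorphic to $\mathbb R$ as a topological group, and acts on the tangent space at $p$ by unipotent transformations. Likewise, the linear parts at $p$ of the local Killing fields of $g$ that vanish at $p$ form a line spanned by a nonzero nilpotent endomorphism. 4. $g$ is not flat, i.e. the curvature tensor of its Levi-Civita connection is not identically zero. 5. The action of $\mathrm{Isom}_0(g)$ on the simply connected space $\mathrm{SOL}$ is transitive and preserves a Lorentz metric (so it defines a Lorentz geometry). This geometry is non-Riemannian: the action preserves no Riemannian metric. It is maximal: the action does not extend to a smooth faithful action on $\mathrm{SOL}$, preserving some Lorentz metric, of a Lie group of dimension greater than $4$. -/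

import Mathlib

open Set Topology
open scoped Manifold ContDiff

noncomputable section

/-! ### The group `SOL` -/

/-- The model vector space `ℝ³`, with coordinates `(x, z, t)`. -/
abbrev E3 : Type := ℝ × ℝ × ℝ

/-- The group `SOL = ℝ ⋉ ℝ²`: the manifold `ℝ³` with coordinates `(x, z, t)` and the product
`(x, z, t) (x', z', t') = (x + e^t x', z + e^{-t} z', t + t')`. -/
def SOL : Type := E3

namespace SOL

instance : TopologicalSpace SOL := inferInstanceAs (TopologicalSpace E3)

instance : LocallyCompactSpace SOL := inferInstanceAs (LocallyCompactSpace E3)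

/-- The smooth structure of `SOL` is the standard one of `ℝ³`. -/
instance : ChartedSpace E3 SOL := inferInstanceAs (ChartedSpace E3 E3)

instance : Mul SOL :=
  ⟨fun a b => (a.1 + Real.exp a.2.2 * b.1, a.2.1 + Real.exp (-a.2.2) * b.2.1, a.2.2 + b.2.2)⟩

instance : One SOL := ⟨((0 : ℝ), (0 : ℝ), (0 : ℝ))⟩

instance : Inv SOL :=
  ⟨fun a => (-(Real.exp (-a.2.2) * a.1), -(Real.exp a.2.2 * a.2.1), -a.2.2)⟩

instance : Group SOL :=
  Group.ofLeftAxioms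
    (fun a b c => by
      refine Prod.ext ?_ (Prod.ext ?_ ?_)
      · change a.1 + Real.exp a.2.2 * b.1 + Real.exp (a.2.2 + b.2.2) * c.1 =
          a.1 + Real.exp a.2.2 * (b.1 + Real.exp b.2.2 * c.1)
        rw [Real.exp_add]; ring
      · change a.2.1 + Real.exp (-a.2.2) * b.2.1 + Real.exp (-(a.2.2 + b.2.2)) * c.2.1 =
          a.2.1 + Real.exp (-a.2.2) * (b.2.1 + Real.exp (-b.2.2) * c.2.1)
        rw [neg_add, Real.exp_add]; ring
      · exact add_assoc _ _ _)
    (fun a => by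
      refine Prod.ext ?_ (Prod.ext ?_ ?_)
      · change (0 : ℝ) + Real.exp 0 * a.1 = a.1
        simp
      · change (0 : ℝ) + Real.exp (-0) * a.2.1 = a.2.1
        simp
      · exact zero_add _)
    (fun a => by
      refine Prod.ext ?_ (Prod.ext ?_ ?_)
      · change -(Real.exp (-a.2.2) * a.1) + Real.exp (-a.2.2) * a.1 = 0
        ring
      · change -(Real.exp a.2.2 * a.2.1) + Real.exp (-(-a.2.2)) * a.2.1 = 0
        rw [neg_neg]; ring
      · exact neg_add_cancel _)

instance : LieGroup 𝓘(ℝ, E3) ω SOL where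
  __ : IsManifold 𝓘(ℝ, E3) ω SOL := inferInstanceAs (IsManifold 𝓘(ℝ, E3) ω E3)
  contMDiff_mul := by
    have h : ContDiff ℝ ω (fun q : E3 × E3 =>
        ((q.1.1 + Real.exp q.1.2.2 * q.2.1, q.1.2.1 + Real.exp (-q.1.2.2) * q.2.2.1,
          q.1.2.2 + q.2.2.2) : E3)) := by fun_prop
    have h' := h.contMDiff
    rw [modelWithCornersSelf_prod, ← chartedSpaceSelf_prod] at h'
    exact h'
  contMDiff_inv := by
    have h : ContDiff ℝ ω (fun a : E3 =>
        ((-(Real.exp (-a.2.2) * a.1), -(Real.exp a.2.2 * a.2.1), -a.2.2) : E3)) := by fun_prop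
    exact h.contMDiff

end SOL

/-- The Lie algebra `sol` of `SOL`: its tangent space at the identity, with the bracket of
left-invariant vector fields. -/
abbrev LieSOL : Type := GroupLieAlgebra 𝓘(ℝ, E3) SOL

/-- The vectors `X`, `Z`, `T` of `sol` (the coordinate vectors at the identity); they satisfy
`[T, X] = X`, `[T, Z] = -Z`, `[X, Z] = 0`. -/
def solX : LieSOL := ((1, 0, 0) : E3)

/-- See `solX`. -/
def solZ : LieSOL := ((0, 1, 0) : E3)

/-- See `solX`. -/
def solT : LieSOL := ((0, 0, 1) : E3)

/-- The derived algebra `[sol, sol]`. -/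
def solDerived : LieIdeal ℝ LieSOL := LieAlgebra.derivedSeries ℝ LieSOL 1

/-! ### Tensors on `SOL`

All tangent spaces of `SOL` are `E3`, by the global chart. -/

/-- The differential at `p` of a map from `SOL` to a vector space. -/
def coordDeriv {F : Type*} [NormedAddCommGroup F] [NormedSpace ℝ F] (f : SOL → F) (p : SOL) :
    E3 →L[ℝ] F :=
  mfderiv 𝓘(ℝ, E3) 𝓘(ℝ, F) f p

/-- The differential at `p` of a map from `SOL` to itself. -/
def tangentMapAt (φ : SOL → SOL) (p : SOL) : E3 →L[ℝ] E3 :=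
  mfderiv 𝓘(ℝ, E3) 𝓘(ℝ, E3) φ p

/-- A field of bilinear forms on the tangent spaces of `SOL`. -/
abbrev BilinField : Type := SOL → E3 →L[ℝ] E3 →L[ℝ] ℝ

/-- The pullback `φ^* g`. -/
def pullback (φ : SOL → SOL) (g : BilinField) : BilinField := fun p =>
  (g (φ p)).bilinearComp (tangentMapAt φ p) (tangentMapAt φ p)

/-- Lorentz metrics on `SOL`: smooth fields of symmetric bilinear forms of signature `(2, 1)`. -/
structure IsLorentzMetric (g : BilinField) : Prop where
  smooth : ContMDiff 𝓘(ℝ, E3) 𝓘(ℝ, E3 →L[ℝ] E3 →L[ℝ] ℝ) ∞ g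
  symm : ∀ p v w, g p v w = g p w v
  signature : ∀ p, ∃ b : Module.Basis (Fin 3) ℝ E3, ∀ i j,
    g p (b i) (b j) = if i = j then (if i = 2 then -1 else 1) else 0

/-- Riemannian metrics on `SOL`. -/
structure IsRiemannianMetric (g : BilinField) : Prop where
  smooth : ContMDiff 𝓘(ℝ, E3) 𝓘(ℝ, E3 →L[ℝ] E3 →L[ℝ] ℝ) ∞ g
  symm : ∀ p v w, g p v w = g p w v
  pos : ∀ p v, v ≠ 0 → 0 < g p v v

/-- Invariance under all left translations. -/
def IsLeftInvariant (g : BilinField) : Prop :=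
  ∀ a : SOL, pullback (fun p => a * p) g = g

/-- The derived algebra is degenerate for `g` (at the identity). -/
def DerivedDegenerate (g : BilinField) : Prop :=
  ∃ v ∈ solDerived, v ≠ 0 ∧ ∀ w ∈ solDerived, g 1 v w = 0

/-- One of the eigendirections of `ad(T)` in the derived algebra is isotropic for `g`. -/
def EigendirectionIsotropic (g : BilinField) : Prop :=
  ∃ v ∈ solDerived, v ≠ 0 ∧ (∃ μ : ℝ, ⁅solT, v⁆ = μ • v) ∧ g 1 v v = 0

/-- The left-invariant field of bilinear forms with value `B` at the identity. -/
def leftInvariantExtension (B : E3 →L[ℝ] E3 →L[ℝ] ℝ) : BilinField := fun p =>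
  B.bilinearComp (tangentMapAt (fun q => p⁻¹ * q) p) (tangentMapAt (fun q => p⁻¹ * q) p)

/-- The bilinear form `(v, w) ↦ v_x w_t + v_t w_x + v_z w_z`, i.e. `X` and `T` are isotropic, `Z` is
orthogonal to `X` and `T`, and `g(X, T) = g(Z, Z) = 1`. -/
def lorentzSOLForm : E3 →L[ℝ] E3 →L[ℝ] ℝ :=
  let x : E3 →L[ℝ] ℝ := ContinuousLinearMap.fst ℝ ℝ (ℝ × ℝ)
  let z : E3 →L[ℝ] ℝ :=
    (ContinuousLinearMap.fst ℝ ℝ ℝ).comp (ContinuousLinearMap.snd ℝ ℝ (ℝ × ℝ))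
  let t : E3 →L[ℝ] ℝ :=
    (ContinuousLinearMap.snd ℝ ℝ ℝ).comp (ContinuousLinearMap.snd ℝ ℝ (ℝ × ℝ))
  x.smulRight t + t.smulRight x + z.smulRight z

/-- The Lorentz-SOL metric. -/
def lorentzSOL : BilinField := leftInvariantExtension lorentzSOLForm

/-! ### Curvature and Killing fields -/

/-- `Γ` gives the Levi-Civita connection of `g`: `∇_u V = DV(u) + Γ(u, V)` is torsion-free and
compatible with `g`. -/
structure IsLeviCivita (g : BilinField) (Γ : SOL → E3 →L[ℝ] E3 →L[ℝ] E3) : Prop where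
  smooth : ContMDiff 𝓘(ℝ, E3) 𝓘(ℝ, E3 →L[ℝ] E3 →L[ℝ] E3) ∞ Γ
  torsion_free : ∀ p u v, Γ p u v = Γ p v u
  compatible : ∀ p u v w, coordDeriv g p u v w = g p (Γ p u v) w + g p v (Γ p u w)

/-- The curvature `R(u, v) w` of the connection with Christoffel symbols `Γ`. -/
def curvatureTensor (Γ : SOL → E3 →L[ℝ] E3 →L[ℝ] E3) (p : SOL) (u v w : E3) : E3 :=
  coordDeriv Γ p u v w - coordDeriv Γ p v u w + Γ p u (Γ p v w) - Γ p v (Γ p u w)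

/-- The curvature of the Levi-Civita connection vanishes. -/
def IsFlat (g : BilinField) : Prop :=
  ∀ Γ, IsLeviCivita g Γ → ∀ p u v w, curvatureTensor Γ p u v w = 0

/-- `V` is a Killing field of `g` on the set `U`: it is smooth and `L_V g = 0` on `U`. -/
structure IsKillingOn (g : BilinField) (U : Set SOL) (V : SOL → E3) : Prop where
  smooth : ContMDiffOn 𝓘(ℝ, E3) 𝓘(ℝ, E3) ∞ V U
  lie_zero : ∀ p ∈ U, ∀ v w, coordDeriv g p (V p) v w +
    g p (coordDeriv V p v) w + g p v (coordDeriv V p w) = 0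

/-- The local isotropy algebra of `g` at `p`: the linear parts at `p` of the local Killing fields
which vanish at `p`. -/
def localIsotropyAlgebra (g : BilinField) (p : SOL) : Set (E3 →L[ℝ] E3) :=
  {A | ∃ (U : Set SOL) (V : SOL → E3), IsOpen U ∧ p ∈ U ∧ IsKillingOn g U V ∧ V p = 0 ∧
    A = coordDeriv V p}

/-! ### The isometry group -/

theorem pullback_comp (φ ψ : SOL → SOL) (hφ : ContMDiff 𝓘(ℝ, E3) 𝓘(ℝ, E3) ∞ φ)
    (hψ : ContMDiff 𝓘(ℝ, E3) 𝓘(ℝ, E3) ∞ ψ) (g : BilinField) :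
    pullback (φ ∘ ψ) g = pullback ψ (pullback φ g) := by
  funext p
  have h : tangentMapAt (φ ∘ ψ) p = (tangentMapAt φ (ψ p)).comp (tangentMapAt ψ p) :=
    mfderiv_comp (I' := 𝓘(ℝ, E3)) p (hφ.mdifferentiable (by simp) _)
      (hψ.mdifferentiable (by simp) _)
  refine ContinuousLinearMap.ext fun v => ContinuousLinearMap.ext fun w => ?_
  simp [pullback, h, ContinuousLinearMap.bilinearComp]

theorem pullback_id (g : BilinField) : pullback id g = g := by
  funext p
  have h : tangentMapAt id p = ContinuousLinearMap.id ℝ E3 := mfderiv_id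
  refine ContinuousLinearMap.ext fun v => ContinuousLinearMap.ext fun w => ?_
  simp [pullback, h, ContinuousLinearMap.bilinearComp]

/-- The isometries of `g`: diffeomorphisms `φ` with `φ^* g = g`. -/
def isomSubgroup (g : BilinField) : Subgroup (Equiv.Perm SOL) where
  carrier := {φ | ContMDiff 𝓘(ℝ, E3) 𝓘(ℝ, E3) ∞ φ ∧ ContMDiff 𝓘(ℝ, E3) 𝓘(ℝ, E3) ∞ φ.symm ∧
    pullback φ g = g}
  one_mem' := ⟨contMDiff_id, contMDiff_id, pullback_id g⟩
  mul_mem' := by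
    rintro φ ψ ⟨h1, h2, h3⟩ ⟨k1, k2, k3⟩
    refine ⟨h1.comp k1, k2.comp h2, ?_⟩
    change pullback (φ ∘ ψ) g = g
    rw [pullback_comp _ _ h1 k1, h3, k3]
  inv_mem' := by
    rintro φ ⟨h1, h2, h3⟩
    refine ⟨h2, h1, ?_⟩
    change pullback φ.symm g = g
    conv_lhs => rw [← h3]
    rw [← pullback_comp _ _ h1 h2]
    have : (φ ∘ φ.symm : SOL → SOL) = id := by funext p; simp
    rw [this, pullback_id]

/-- The isometry group of `g`. -/
def Isom (g : BilinField) : Type := isomSubgroup g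

namespace Isom

variable (g : BilinField)

instance : Group (Isom g) := inferInstanceAs (Group (isomSubgroup g))

instance : MulAction (Isom g) SOL := inferInstanceAs (MulAction (isomSubgroup g) SOL)

/-- An isometry as a continuous map. -/
def toContinuousMap (φ : Isom g) : C(SOL, SOL) := ⟨fun p => φ • p, φ.2.1.continuous⟩

/-- The topology of the isometry group: the compact-open topology, on isometries and on their
inverses. -/
instance : TopologicalSpace (Isom g) :=
  TopologicalSpace.induced (fun φ => (toContinuousMap g φ, toContinuousMap g φ⁻¹)) inferInstance

instance : IsTopologicalGroup (Isom g) := by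
  have hind : IsInducing (fun φ : Isom g => (toContinuousMap g φ, toContinuousMap g φ⁻¹)) := ⟨rfl⟩
  have h1 : Continuous (fun φ : Isom g => toContinuousMap g φ) :=
    continuous_fst.comp hind.continuous
  have h2 : Continuous (fun φ : Isom g => toContinuousMap g φ⁻¹) :=
    continuous_snd.comp hind.continuous
  have hmul : ∀ φ ψ : Isom g, toContinuousMap g (φ * ψ) =
      (toContinuousMap g φ).comp (toContinuousMap g ψ) := fun _ _ => rfl
  refine { continuous_mul := ?_, continuous_inv := ?_ }
  · rw [hind.continuous_iff]
    refine Continuous.prodMk ?_ ?_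
    · exact (h1.comp continuous_fst).compCM (h1.comp continuous_snd)
    · have e : (fun q : Isom g × Isom g => toContinuousMap g (q.1 * q.2)⁻¹) =
          fun q => (toContinuousMap g q.2⁻¹).comp (toContinuousMap g q.1⁻¹) := by
        funext q
        rw [mul_inv_rev, hmul]
      exact e ▸ (h2.comp continuous_snd).compCM (h2.comp continuous_fst)
  · rw [hind.continuous_iff]
    refine Continuous.prodMk h2 ?_
    simpa using h1

end Isom

/-- The identity component of the isometry group of `g`. -/
abbrev IsomZero (g : BilinField) : Type := Subgroup.connectedComponentOfOne (Isom g)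

/-! ### The Heisenberg group -/

/-- The Heisenberg group: `ℝ³` with `(x, y, z) (x', y', z') = (x + x' + y z', y + y', z + z')`. -/
def Heis : Type := ℝ × ℝ × ℝ

namespace Heis

instance : TopologicalSpace Heis := inferInstanceAs (TopologicalSpace (ℝ × ℝ × ℝ))

instance : Mul Heis := ⟨fun a b => (a.1 + b.1 + a.2.1 * b.2.2, a.2.1 + b.2.1, a.2.2 + b.2.2)⟩

instance : One Heis := ⟨((0 : ℝ), (0 : ℝ), (0 : ℝ))⟩

instance : Inv Heis := ⟨fun a => (-a.1 + a.2.1 * a.2.2, -a.2.1, -a.2.2)⟩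

instance : Group Heis :=
  Group.ofLeftAxioms
    (fun a b c => by
      refine Prod.ext ?_ (Prod.ext (add_assoc _ _ _) (add_assoc _ _ _))
      change a.1 + b.1 + a.2.1 * b.2.2 + c.1 + (a.2.1 + b.2.1) * c.2.2 =
        a.1 + (b.1 + c.1 + b.2.1 * c.2.2) + a.2.1 * (b.2.2 + c.2.2)
      ring)
    (fun a => by
      refine Prod.ext ?_ (Prod.ext (zero_add _) (zero_add _))
      change (0 : ℝ) + a.1 + 0 * a.2.2 = a.1
      ring)
    (fun a => by
      refine Prod.ext ?_ (Prod.ext (neg_add_cancel _) (neg_add_cancel _))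
      change -a.1 + a.2.1 * a.2.2 + a.1 + -a.2.1 * a.2.2 = 0
      ring)

end Heis

/-! ### Geometries on `SOL` -/

section Geometry

variable (G : Type*) [Group G] [MulAction G SOL]

/-- `G` carries the structure of a Lie group of dimension `d`, inducing its topology, for which its
action on `SOL` is smooth. -/
def IsLieTransformationGroupOfDim [TopologicalSpace G] (d : ℕ) : Prop :=
  ∃ _ : ChartedSpace (EuclideanSpace ℝ (Fin d)) G, LieGroup (𝓡 d) ∞ G ∧
    ContMDiff ((𝓡 d).prod 𝓘(ℝ, E3)) 𝓘(ℝ, E3) ∞ (fun q : G × SOL => q.1 • q.2)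

/-- The bilinear field `g` is invariant under `G`. -/
def IsInvariantUnder (g : BilinField) : Prop :=
  ∀ h : G, pullback (fun p => h • p) g = g

/-- The action of `G` makes `SOL` a (simply connected) homogeneous space with an invariant Lorentz
metric. -/
structure IsLorentzGeometry : Prop where
  transitive : MulAction.IsPretransitive G SOL
  simplyConnected : SimplyConnectedSpace SOL
  lorentz : ∃ g, IsLorentzMetric g ∧ IsInvariantUnder G g

/-- The action of `G` preserves no Riemannian metric. -/
def IsNonRiemannian : Prop :=
  ¬ ∃ r, IsRiemannianMetric r ∧ IsInvariantUnder G r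

/-- Maximality of the geometry given by a `d`-dimensional Lie group `G` acting on `SOL`: the action
does not extend to a faithful smooth action of a Lie group `G'` of dimension greater than `d` which
preserves a Lorentz metric. -/
def IsMaximalGeometry.{u} (d : ℕ) : Prop :=
  ∀ (n : ℕ) (G' : Type u) [Group G'] [TopologicalSpace G']
    [ChartedSpace (EuclideanSpace ℝ (Fin n)) G'] [LieGroup (𝓡 n) ∞ G']
    [MulAction G' SOL] [FaithfulSMul G' SOL],
    ContMDiff ((𝓡 n).prod 𝓘(ℝ, E3)) 𝓘(ℝ, E3) ∞ (fun q : G' × SOL => q.1 • q.2) →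
    (∃ g, IsLorentzMetric g ∧ IsInvariantUnder G' g) →
    (∃ ι : G →* G', ∀ (h : G) (p : SOL), ι h • p = h • p) →
    n ≤ d

end Geometry

end

/-! ### Calculus in the global chart of `SOL` -/

/-! In the global chart the metric is `2 e⁻ᵗ dx dt + e²ᵗ dz²` (`lorentzSOL_eq`), and everything is
deduced from its Killing equations for a field `A ∂x + B ∂z + C ∂t`. Equality of mixed second
derivatives (`killing_equations_solve`) makes `C` constant and shows that `B_tt = -3 B_t` and that
all other first derivatives are determined by `C` and `B_t`. So a Killing field depends on four
numbers. A basis of the solutions is `∂x`, `∂z`, `z ∂x + (e⁻³ᵗ/3) ∂z` and `x ∂x - z ∂z + ∂t`. The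
first three span a Heisenberg algebra and the fourth acts on it by a derivation. Those vanishing at
a point form a line, whose linear part sends `T` to `Z`, `Z` to a multiple of `X`, and `X` to `0`.

The global isometries need more than the Lie algebra. An isometry `φ` carries Killing fields to
Killing fields, and these have constant last component. Applied to the four basis fields this shows
that the last component of `φ` is `k t + s`. The equation `φ^* g = g` then forces `k = 1` and
integrates explicitly (`exists_eq_waveIso`): `φ` is one of the maps `waveIso a c b s`, up to `z ↦
-z`. The sign of the `z`-direction is a continuous invariant that is never zero, so the identity
component is exactly the family `waveIso` (`coe_connectedComponentOfOne`), a copy of `ℝ⁴` with an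
explicit group law. The Lie group structure, the Heisenberg extension and the stabilizers are read
off from that law.

Uniqueness up to automorphism is linear algebra. In a degenerate plane of a Lorentz form the only
isotropic line is the kernel, so the kernel is `ℝX` or `ℝZ`. The automorphism `swapAut` exchanges
these, and `linAut` has enough parameters to match the remaining coefficients.

For maximality, a Lorentz metric preserved by a larger group is preserved by the isotropy found
above, hence has the form `α (2 e⁻ᵗ dx dt + e²ᵗ dz²) + β dt²` with `α ≠ 0`
(`IsInvariantUnder.exists_eq_waveMetric`). The Killing equations are solved for all of these at
once. A Killing field is still determined by four linear conditions (`IsKillingOn.eq_zero`), and a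
faithful action of a Lie group gives an injection of its tangent space at `1` into Killing fields,
so the dimension is at most `4`. -/

theorem SOL.contMDiff_iff {F : Type*} [NormedAddCommGroup F] [NormedSpace ℝ F] {n : ℕ∞ω}
    (f : SOL → F) :
    ContMDiff 𝓘(ℝ, E3) 𝓘(ℝ, F) n f ↔ ContDiff ℝ n (E := E3) f :=
  contMDiff_iff_contDiff (E := E3)

theorem SOL.contMDiffOn_iff {F : Type*} [NormedAddCommGroup F] [NormedSpace ℝ F] {n : ℕ∞ω}
    (f : SOL → F) (U : Set SOL) :
    ContMDiffOn 𝓘(ℝ, E3) 𝓘(ℝ, F) n f U ↔ ContDiffOn ℝ n (E := E3) f U :=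
  contMDiffOn_iff_contDiffOn (E := E3)

theorem SOL.contMDiff_self_iff {n : ℕ∞ω} (f : SOL → SOL) :
    ContMDiff 𝓘(ℝ, E3) 𝓘(ℝ, E3) n f ↔ ContDiff ℝ n (E := E3) (F := E3) f :=
  contMDiff_iff_contDiff (E := E3) (E' := E3)

theorem tangentMapAt_eq_fderiv (φ : SOL → SOL) (p : SOL) :
    tangentMapAt φ p = fderiv ℝ (E := E3) (F := E3) φ p :=
  mfderiv_eq_fderiv (E := E3) (E' := E3)

theorem coordDeriv_eq_fderiv {F : Type*} [NormedAddCommGroup F] [NormedSpace ℝ F]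
    (f : SOL → F) (p : SOL) : coordDeriv f p = fderiv ℝ (E := E3) f p :=
  mfderiv_eq_fderiv (E := E3)

theorem pullback_apply (φ : SOL → SOL) (g : BilinField) (p : SOL) (v w : E3) :
    pullback φ g p v w = g (φ p) (fderiv ℝ (E := E3) (F := E3) φ p v)
      (fderiv ℝ (E := E3) (F := E3) φ p w) := by
  simp only [pullback, tangentMapAt_eq_fderiv]
  rfl

theorem BilinField.ext {g h : BilinField} (H : ∀ p v w, g p v w = h p v w) : g = h :=
  funext fun p => ContinuousLinearMap.ext fun v => ContinuousLinearMap.ext fun w => H p v w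

namespace E3

/-- The first coordinate. -/
noncomputable def x : E3 →L[ℝ] ℝ := ContinuousLinearMap.fst ℝ ℝ (ℝ × ℝ)

/-- The second coordinate. -/
noncomputable def z : E3 →L[ℝ] ℝ :=
  (ContinuousLinearMap.fst ℝ ℝ ℝ).comp (ContinuousLinearMap.snd ℝ ℝ (ℝ × ℝ))

/-- The third coordinate. -/
noncomputable def t : E3 →L[ℝ] ℝ :=
  (ContinuousLinearMap.snd ℝ ℝ ℝ).comp (ContinuousLinearMap.snd ℝ ℝ (ℝ × ℝ))

@[simp] theorem x_apply (p : E3) : x p = p.1 := rfl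
@[simp] theorem z_apply (p : E3) : z p = p.2.1 := rfl
@[simp] theorem t_apply (p : E3) : t p = p.2.2 := rfl

/-- The coordinate vector `∂/∂x`. -/
def ex : E3 := (1, 0, 0)
/-- The coordinate vector `∂/∂z`. -/
def ez : E3 := (0, 1, 0)
/-- The coordinate vector `∂/∂t`. -/
def et : E3 := (0, 0, 1)

theorem eq_comb (v : E3) : v = v.1 • ex + v.2.1 • ez + v.2.2 • et := by
  refine Prod.ext ?_ (Prod.ext ?_ ?_) <;> simp [ex, ez, et]

theorem map_eq_comb {F : Type*} [NormedAddCommGroup F] [NormedSpace ℝ F] (L : E3 →L[ℝ] F) (v : E3) :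
    L v = v.1 • L ex + v.2.1 • L ez + v.2.2 • L et := by
  conv_lhs => rw [eq_comb v]
  simp

theorem clm_ext {F : Type*} [NormedAddCommGroup F] [NormedSpace ℝ F] {L M : E3 →L[ℝ] F}
    (hx : L ex = M ex) (hz : L ez = M ez) (ht : L et = M et) : L = M := by
  refine ContinuousLinearMap.ext fun v => ?_
  rw [map_eq_comb L, map_eq_comb M, hx, hz, ht]

end E3

/-- The differential of a map to `ℝ³` given by three component functions. -/
theorem hasFDerivAt_triple {f₁ f₂ f₃ : E3 → ℝ} {L₁ L₂ L₃ : E3 →L[ℝ] ℝ} {p : E3}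
    (h₁ : HasFDerivAt f₁ L₁ p) (h₂ : HasFDerivAt f₂ L₂ p) (h₃ : HasFDerivAt f₃ L₃ p) :
    HasFDerivAt (fun q => ((f₁ q, f₂ q, f₃ q) : E3)) (L₁.prod (L₂.prod L₃)) p :=
  h₁.prodMk (h₂.prodMk h₃)

theorem E3.hasFDerivAt_x (p : E3) : HasFDerivAt (fun q : E3 => q.1) E3.x p := E3.x.hasFDerivAt
theorem E3.hasFDerivAt_z (p : E3) : HasFDerivAt (fun q : E3 => q.2.1) E3.z p := E3.z.hasFDerivAt
theorem E3.hasFDerivAt_t (p : E3) : HasFDerivAt (fun q : E3 => q.2.2) E3.t p := E3.t.hasFDerivAt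

theorem E3.hasFDerivAt_exp (k : ℝ) (p : E3) :
    HasFDerivAt (fun q : E3 => Real.exp (k * q.2.2)) ((k * Real.exp (k * p.2.2)) • E3.t) p := by
  have := ((E3.hasFDerivAt_t p).const_mul k).exp
  rwa [smul_smul, mul_comm] at this

/-! ### Left-invariant fields -/

theorem SOL.one_def : (1 : SOL) = ((0, 0, 0) : E3) := rfl

/-- The differential of the left translation by an element with last coordinate `s`. -/
noncomputable def leftDiff (s : ℝ) : E3 →L[ℝ] E3 :=
  (Real.exp s • E3.x).prod ((Real.exp (-s) • E3.z).prod E3.t)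

@[simp] theorem leftDiff_apply (s : ℝ) (v : E3) :
    leftDiff s v = (Real.exp s * v.1, Real.exp (-s) * v.2.1, v.2.2) := rfl

theorem hasFDerivAt_leftMul (a p : SOL) :
    HasFDerivAt (E := E3) (F := E3) (fun q : SOL => a * q) (leftDiff a.2.2) p :=
  hasFDerivAt_triple (p := p) (((E3.hasFDerivAt_x p).const_mul _).const_add _)
    (((E3.hasFDerivAt_z p).const_mul _).const_add _) ((E3.hasFDerivAt_t p).const_add _)

theorem leftInvariantExtension_apply (B : E3 →L[ℝ] E3 →L[ℝ] ℝ) (p : SOL) (v w : E3) :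
    leftInvariantExtension B p v w = B (leftDiff (-p.2.2) v) (leftDiff (-p.2.2) w) := by
  simp only [leftInvariantExtension, tangentMapAt_eq_fderiv, (hasFDerivAt_leftMul p⁻¹ p).fderiv]
  rfl

theorem IsLeftInvariant.apply {g : BilinField} (hg : IsLeftInvariant g) (p : SOL) (v w : E3) :
    g p v w = g 1 (leftDiff (-p.2.2) v) (leftDiff (-p.2.2) w) := by
  have h := congrArg (fun k : BilinField => k p v w) (hg p⁻¹)
  simp only [pullback_apply, (hasFDerivAt_leftMul p⁻¹ p).fderiv, inv_mul_cancel] at h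
  exact h.symm

theorem leftDiff_comp (s r : ℝ) (v : E3) : leftDiff s (leftDiff r v) = leftDiff (s + r) v := by
  simp only [leftDiff_apply, neg_add, Real.exp_add, mul_assoc]

theorem isLeftInvariant_leftInvariantExtension (B : E3 →L[ℝ] E3 →L[ℝ] ℝ) :
    IsLeftInvariant (leftInvariantExtension B) := fun a => BilinField.ext fun p v w => by
  have h : (a * p).2.2 = a.2.2 + p.2.2 := rfl
  rw [pullback_apply, (hasFDerivAt_leftMul a p).fderiv, leftInvariantExtension_apply,
    leftInvariantExtension_apply, leftDiff_comp, leftDiff_comp, h]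
  simp

/-! ### The metrics `α (2 e⁻ᵗ dx dt + e²ᵗ dz²) + β dt²` -/

/-- The field of bilinear forms `α (2 e⁻ᵗ dx dt + e²ᵗ dz²) + β dt²`. -/
noncomputable def waveMetric (α β : ℝ) : BilinField := fun p =>
  (α * Real.exp (-1 * p.2.2)) • (E3.x.smulRight E3.t + E3.t.smulRight E3.x) +
    (α * Real.exp (2 * p.2.2)) • E3.z.smulRight E3.z + β • E3.t.smulRight E3.t

theorem waveMetric_apply (α β : ℝ) (p : SOL) (v w : E3) : waveMetric α β p v w =
    α * Real.exp (-1 * p.2.2) * (v.1 * w.2.2 + v.2.2 * w.1) +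
      α * Real.exp (2 * p.2.2) * (v.2.1 * w.2.1) + β * (v.2.2 * w.2.2) := rfl

section

variable {F : Type*} [NormedAddCommGroup F] [NormedSpace ℝ F] (a b : ℝ) (B C D : F)

theorem contDiff_exp_smul_add :
    ContDiff ℝ ∞ (fun p : E3 => (a * Real.exp (-1 * p.2.2)) • B +
      (a * Real.exp (2 * p.2.2)) • C + b • D) := by
  fun_prop

theorem hasFDerivAt_exp_smul_add (p : E3) :
    HasFDerivAt (fun p : E3 => (a * Real.exp (-1 * p.2.2)) • B +
      (a * Real.exp (2 * p.2.2)) • C + b • D)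
      (E3.t.smulRight ((-(a * Real.exp (-1 * p.2.2))) • B + (2 * a * Real.exp (2 * p.2.2)) • C))
      p := by
  refine (((((E3.hasFDerivAt_exp (-1) p).const_mul a).smul_const B).add
      (((E3.hasFDerivAt_exp 2 p).const_mul a).smul_const C)).add_const (b • D)).congr_fderiv ?_
  refine ContinuousLinearMap.ext fun v => ?_
  simp only [add_apply, smul_apply, ContinuousLinearMap.smulRight_apply, smul_eq_mul, smul_add,
    smul_smul]
  congr 2 <;> ring

end

theorem contMDiff_waveMetric (α β : ℝ) :
    ContMDiff 𝓘(ℝ, E3) 𝓘(ℝ, E3 →L[ℝ] E3 →L[ℝ] ℝ) ∞ (waveMetric α β) :=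
  (SOL.contMDiff_iff _).2 (contDiff_exp_smul_add α β _ _ _)

theorem coordDeriv_waveMetric_apply (α β : ℝ) (p : SOL) (u v w : E3) :
    coordDeriv (waveMetric α β) p u v w =
    u.2.2 * (-(α * Real.exp (-1 * p.2.2) * (v.1 * w.2.2 + v.2.2 * w.1)) +
      2 * α * Real.exp (2 * p.2.2) * (v.2.1 * w.2.1)) := by
  have h := (hasFDerivAt_exp_smul_add α β (E3.x.smulRight E3.t + E3.t.smulRight E3.x)
    (E3.z.smulRight E3.z) (E3.t.smulRight E3.t) p).fderiv
  have h' : coordDeriv (waveMetric α β) p = _ := (coordDeriv_eq_fderiv _ _).trans h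
  rw [h']
  change u.2.2 * (-(α * Real.exp (-1 * p.2.2)) * (v.1 * w.2.2 + v.2.2 * w.1) +
      2 * α * Real.exp (2 * p.2.2) * (v.2.1 * w.2.1)) = _
  ring

theorem lorentzSOLForm_apply (v w : E3) :
    lorentzSOLForm v w = v.1 * w.2.2 + v.2.2 * w.1 + v.2.1 * w.2.1 := rfl

theorem exp_two_mul' (s : ℝ) : Real.exp (2 * s) = Real.exp s * Real.exp s := by
  rw [two_mul, Real.exp_add]

/-- All later computations use this coordinate form. The second parameter of `waveMetric` plays a
role only in the proof of maximality, where `β dt²` is the extra term allowed by the isotropy. -/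
theorem lorentzSOL_eq : lorentzSOL = waveMetric 1 0 := BilinField.ext fun p v w => by
  rw [waveMetric_apply, lorentzSOL, leftInvariantExtension_apply, lorentzSOLForm_apply,
    exp_two_mul']
  simp only [leftDiff_apply, neg_neg, neg_one_mul]
  ring

theorem isLorentzMetric_lorentzSOL : IsLorentzMetric lorentzSOL where
  smooth := by
    rw [lorentzSOL_eq]
    exact contMDiff_waveMetric 1 0
  symm p v w := by rw [lorentzSOL_eq, waveMetric_apply, waveMetric_apply]; ring
  signature p := by
    -- `X` and `T` span a hyperbolic plane, diagonalised by `X + T/2` and `X - T/2`, of squares `1`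
    -- and `-1`. Left translation carries the frame to `p`.
    let f : Fin 3 → E3 := ![leftDiff p.2.2 (1, 0, 1 / 2), leftDiff p.2.2 (0, 1, 0),
      leftDiff p.2.2 (1, 0, -1 / 2)]
    have hf : ∀ i j, lorentzSOL p (f i) (f j) = if i = j then (if i = 2 then -1 else 1) else 0 := by
      have key : ∀ v w : E3, lorentzSOL p (leftDiff p.2.2 v) (leftDiff p.2.2 w) =
          lorentzSOLForm v w := fun v w => by
        rw [lorentzSOL, leftInvariantExtension_apply, leftDiff_comp, leftDiff_comp]
        simp
      intro i j
      fin_cases i <;> fin_cases j <;> simp [f, -leftDiff_apply, key, lorentzSOLForm_apply] <;> norm_num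
    -- Pairing a vanishing combination with `f i` leaves `± c i`.
    have hli : LinearIndependent ℝ f := by
      rw [Fintype.linearIndependent_iff]
      intro c hc i
      have h := congrArg (fun u => lorentzSOL p u (f i)) hc
      simp only [map_sum, map_smul, sum_apply, smul_apply,
        hf, map_zero, zero_apply] at h
      simp only [smul_eq_mul, mul_ite, mul_zero, Finset.sum_ite_eq', Finset.mem_univ, if_true] at h
      split_ifs at h <;> simpa using h
    have hc : Fintype.card (Fin 3) = Module.finrank ℝ E3 := by simp
    refine ⟨basisOfLinearIndependentOfCardEqFinrank hli hc, fun i j => ?_⟩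
    simpa using hf i j

/-! ### The Lie algebra of `SOL` -/

theorem mulInvariantVectorField_eq (v : LieSOL) :
    mulInvariantVectorField v = fun p : SOL => leftDiff p.2.2 v := by
  funext p
  have h := (hasFDerivAt_leftMul p 1).fderiv
  have h' : tangentMapAt (fun q => p * q) 1 = leftDiff p.2.2 := (tangentMapAt_eq_fderiv _ _).trans h
  exact congrArg (fun L : E3 →L[ℝ] E3 => L v) h'

theorem hasFDerivAt_leftDiff_apply (v : E3) :
    HasFDerivAt (fun p : E3 => leftDiff p.2.2 v)
      ((v.1 • E3.t).prod ((-(v.2.1 • E3.t)).prod 0)) 0 := by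
  have h1 := (E3.hasFDerivAt_exp 1 0).mul_const v.1
  have h2 := (E3.hasFDerivAt_exp (-1) 0).mul_const v.2.1
  simp only [one_mul, neg_one_mul] at h1 h2
  refine (hasFDerivAt_triple h1 h2 (hasFDerivAt_const v.2.2 0)).congr_fderiv ?_
  refine ContinuousLinearMap.ext fun u => ?_
  simp

theorem mlieBracket_eq_lieBracket {E : Type*} [NormedAddCommGroup E] [NormedSpace ℝ E]
    (V W : (p : E) → TangentSpace 𝓘(ℝ, E) p) (p : E) :
    VectorField.mlieBracket 𝓘(ℝ, E) V W p = VectorField.lieBracket ℝ V W p := by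
  rw [← VectorField.mlieBracketWithin_univ, VectorField.mlieBracketWithin_eq_lieBracketWithin]
  exact congrFun (VectorField.lieBracketWithin_univ (E := E)) p

theorem lieBracket_leftDiff (v w : E3) :
    VectorField.mlieBracket 𝓘(ℝ, E3) (fun p : E3 => leftDiff p.2.2 v)
      (fun p : E3 => leftDiff p.2.2 w) (0 : E3) =
      (v.2.2 * w.1 - w.2.2 * v.1, -(v.2.2 * w.2.1 - w.2.2 * v.2.1), 0) := by
  refine (mlieBracket_eq_lieBracket _ _ _).trans ?_
  rw [VectorField.lieBracket, (hasFDerivAt_leftDiff_apply v).fderiv, (hasFDerivAt_leftDiff_apply w).fderiv]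
  refine Prod.ext ?_ (Prod.ext ?_ ?_) <;> simp <;> ring

theorem LieSOL.bracket_eq (v w : LieSOL) : ⁅v, w⁆ =
    (((v : E3).2.2 * (w : E3).1 - (w : E3).2.2 * (v : E3).1,
      -((v : E3).2.2 * (w : E3).2.1 - (w : E3).2.2 * (v : E3).2.1), 0) : E3) := by
  rw [GroupLieAlgebra.bracket_def, mulInvariantVectorField_eq, mulInvariantVectorField_eq]
  exact lieBracket_leftDiff v w

theorem mem_solDerived_iff (v : LieSOL) : v ∈ solDerived ↔ (v : E3).2.2 = 0 := by
  have hb : solDerived = ⁅(⊤ : LieIdeal ℝ LieSOL), (⊤ : LieIdeal ℝ LieSOL)⁆ := by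
    rw [solDerived, LieAlgebra.derivedSeries_def, LieAlgebra.derivedSeriesOfIdeal_succ,
      LieAlgebra.derivedSeriesOfIdeal_zero]
  rw [hb]
  constructor
  · intro hv
    rw [← LieSubmodule.mem_toSubmodule, LieSubmodule.lieIdeal_oper_eq_linear_span'] at hv
    induction hv using Submodule.span_induction with
    | mem u hu =>
      obtain ⟨a, -, b, -, rfl⟩ := hu
      rw [LieSOL.bracket_eq]
    | zero => rfl
    | add u w _ _ hu hw => exact (congrArg₂ (· + ·) hu hw).trans (add_zero 0)
    | smul c u _ hu => exact (congrArg (c * ·) hu).trans (mul_zero c)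
  · intro hv
    -- `ad T` is invertible on the plane spanned by `X` and `Z`, with eigenvalues `1` and `-1`. This
    -- is the preimage of `v`.
    let w : LieSOL := (((v : E3).1, -(v : E3).2.1, 0) : E3)
    have : v = ⁅solT, w⁆ := by
      rw [LieSOL.bracket_eq]
      refine Prod.ext ?_ (Prod.ext ?_ ?_) <;> simp [solT, hv, w]
    rw [this]
    exact LieSubmodule.lie_mem_lie (LieSubmodule.mem_top _) (LieSubmodule.mem_top _)

theorem derivedDegenerate_lorentzSOL : DerivedDegenerate lorentzSOL := by
  refine ⟨solX, (mem_solDerived_iff _).2 rfl, fun h => one_ne_zero (congrArg (fun u : E3 => u.1) h),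
    fun w hw => ?_⟩
  rw [mem_solDerived_iff] at hw
  rw [lorentzSOL_eq]
  refine (waveMetric_apply _ _ _ _ _).trans ?_
  simp [solX, hw]

theorem eigendirectionIsotropic_lorentzSOL : EigendirectionIsotropic lorentzSOL := by
  refine ⟨solX, (mem_solDerived_iff _).2 rfl, fun h => one_ne_zero (congrArg (fun u : E3 => u.1) h),
    ⟨1, ?_⟩, ?_⟩
  · rw [LieSOL.bracket_eq, one_smul]
    refine Prod.ext ?_ (Prod.ext ?_ ?_) <;> simp [solX, solT]
  · rw [lorentzSOL_eq]
    refine (waveMetric_apply _ _ _ _ _).trans ?_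
    simp [solX]

/-! ### Left-invariant metrics up to automorphism -/

/-- A bilinear form with the properties of the Lorentz metric at a point. -/
structure IsLorentzForm (B : E3 →L[ℝ] E3 →L[ℝ] ℝ) : Prop where
  symm : ∀ v w, B v w = B w v
  signature : ∃ b : Module.Basis (Fin 3) ℝ E3, ∀ i j,
    B (b i) (b j) = if i = j then (if i = 2 then -1 else 1) else 0

theorem IsLorentzMetric.form {g : BilinField} (hg : IsLorentzMetric g) (p : SOL) :
    IsLorentzForm (g p) :=
  ⟨hg.symm p, hg.signature p⟩

theorem bilin_apply_sum_basis {B : E3 →L[ℝ] E3 →L[ℝ] ℝ} {b : Module.Basis (Fin 3) ℝ E3}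
    (hb : ∀ i j, B (b i) (b j) = if i = j then (if i = 2 then -1 else 1) else 0) (v w : E3) :
    B v w = b.repr v 0 * b.repr w 0 + b.repr v 1 * b.repr w 1 - b.repr v 2 * b.repr w 2 := by
  conv_lhs => rw [← b.sum_repr v, ← b.sum_repr w]
  simp only [Fin.sum_univ_three, map_add, map_smul, add_apply, smul_apply, hb, smul_eq_mul]
  simp
  ring

theorem IsLorentzForm.eq_zero {B : E3 →L[ℝ] E3 →L[ℝ] ℝ} (hB : IsLorentzForm B) {v : E3}
    (hv : ∀ w, B v w = 0) : v = 0 := by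
  obtain ⟨b, hb⟩ := hB.signature
  have h0 := hv (b 0)
  have h1 := hv (b 1)
  have h2 := hv (b 2)
  rw [bilin_apply_sum_basis hb] at h0 h1 h2
  simp at h0 h1 h2
  apply b.repr.injective
  ext i
  fin_cases i <;> simp [h0, h1, h2]

/-- A vector orthogonal to an isotropic vector and not proportional to it is spacelike. -/
theorem IsLorentzForm.pos_of_orthogonal_isotropic {B : E3 →L[ℝ] E3 →L[ℝ] ℝ} (hB : IsLorentzForm B)
    {v w : E3} (hv : v ≠ 0) (hvv : B v v = 0) (hvw : B v w = 0) (hw : ∀ c : ℝ, w ≠ c • v) :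
    0 < B w w := by
  obtain ⟨b, hb⟩ := hB.signature
  rw [bilin_apply_sum_basis hb] at hvv hvw ⊢
  set v0 := b.repr v 0
  set v1 := b.repr v 1
  set v2 := b.repr v 2
  set w0 := b.repr w 0
  set w1 := b.repr w 1
  set w2 := b.repr w 2
  have hv2 : v2 ≠ 0 := by
    intro h2
    apply hv
    apply b.repr.injective
    have h0 : v0 = 0 := by nlinarith
    have h1 : v1 = 0 := by nlinarith
    ext i
    fin_cases i <;> simp <;> assumption
  have hpos : 0 < v2 ^ 2 := by positivity
  -- The vector `v2 w - w2 v` has no timelike coordinate, so its square is a sum of two squares.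
  -- Since `v` is isotropic and orthogonal to `w`, that square is also `v2² B(w, w)`.
  have key : v2 ^ 2 * (w0 * w0 + w1 * w1 - w2 * w2) = (v2 * w0 - w2 * v0) ^ 2 +
      (v2 * w1 - w2 * v1) ^ 2 := by
    linear_combination 2 * v2 * w2 * hvw - w2 ^ 2 * hvv
  by_contra hneg
  have hle : v2 ^ 2 * (w0 * w0 + w1 * w1 - w2 * w2) ≤ 0 :=
    mul_nonpos_of_nonneg_of_nonpos hpos.le (not_lt.1 hneg)
  have e0 : v2 * w0 - w2 * v0 = 0 := by nlinarith [sq_nonneg (v2 * w0 - w2 * v0), sq_nonneg (v2 * w1 - w2 * v1)]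
  have e1 : v2 * w1 - w2 * v1 = 0 := by nlinarith [sq_nonneg (v2 * w0 - w2 * v0), sq_nonneg (v2 * w1 - w2 * v1)]
  apply hw (w2 / v2)
  apply b.repr.injective
  ext i
  fin_cases i
  · change w0 = (b.repr ((w2 / v2) • v)) 0
    rw [map_smul, Finsupp.smul_apply, smul_eq_mul]
    change w0 = w2 / v2 * v0
    field_simp
    linarith
  · change w1 = (b.repr ((w2 / v2) • v)) 1
    rw [map_smul, Finsupp.smul_apply, smul_eq_mul]
    change w1 = w2 / v2 * v1
    field_simp
    linarith
  · change w2 = (b.repr ((w2 / v2) • v)) 2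
    rw [map_smul, Finsupp.smul_apply, smul_eq_mul]
    change w2 = w2 / v2 * v2
    field_simp

/-- The automorphism `(x, z, t) ↦ (a x + p (eᵗ - 1), b z + q (1 - e⁻ᵗ), t)` of `SOL`. -/
noncomputable def SOL.linAut (a b p q : ℝ) (ha : a ≠ 0) (hb : b ≠ 0) : SOL ≃* SOL where
  toFun u := ((a * u.1 + p * (Real.exp u.2.2 - 1), b * u.2.1 + q * (1 - Real.exp (-u.2.2)), u.2.2) : E3)
  invFun u := ((a⁻¹ * (u.1 - p * (Real.exp u.2.2 - 1)),
    b⁻¹ * (u.2.1 - q * (1 - Real.exp (-u.2.2))), u.2.2) : E3)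
  left_inv u := by
    refine Prod.ext ?_ (Prod.ext ?_ rfl)
    · simp [ha]
    · simp [hb]
  right_inv u := by
    refine Prod.ext ?_ (Prod.ext ?_ rfl)
    · simp [ha]
    · simp [hb]
  map_mul' u v := by
    refine Prod.ext ?_ (Prod.ext ?_ rfl)
    · change a * (u.1 + Real.exp u.2.2 * v.1) + p * (Real.exp (u.2.2 + v.2.2) - 1) =
        a * u.1 + p * (Real.exp u.2.2 - 1) +
          Real.exp u.2.2 * (a * v.1 + p * (Real.exp v.2.2 - 1))
      rw [Real.exp_add]; ring
    · change b * (u.2.1 + Real.exp (-u.2.2) * v.2.1) + q * (1 - Real.exp (-(u.2.2 + v.2.2))) =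
        b * u.2.1 + q * (1 - Real.exp (-u.2.2)) +
          Real.exp (-u.2.2) * (b * v.2.1 + q * (1 - Real.exp (-v.2.2)))
      rw [neg_add, Real.exp_add]; ring

/-- The automorphism `(x, z, t) ↦ (z, x, -t)` of `SOL`. -/
def SOL.swapAut : SOL ≃* SOL where
  toFun u := ((u.2.1, u.1, -u.2.2) : E3)
  invFun u := ((u.2.1, u.1, -u.2.2) : E3)
  left_inv u := by
    refine Prod.ext rfl (Prod.ext rfl ?_)
    exact neg_neg _
  right_inv u := by
    refine Prod.ext rfl (Prod.ext rfl ?_)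
    exact neg_neg _
  map_mul' u v := by
    refine Prod.ext rfl (Prod.ext ?_ (neg_add _ _))
    change u.1 + Real.exp u.2.2 * v.1 = u.1 + Real.exp (- -u.2.2) * v.1
    rw [neg_neg]

theorem contDiff_linAut (a b p q : ℝ) (ha : a ≠ 0) (hb : b ≠ 0) :
    ContMDiff 𝓘(ℝ, E3) 𝓘(ℝ, E3) ∞ (SOL.linAut a b p q ha hb) := by
  rw [SOL.contMDiff_self_iff]
  change ContDiff ℝ ∞ (fun u : E3 =>
    ((a * u.1 + p * (Real.exp u.2.2 - 1), b * u.2.1 + q * (1 - Real.exp (-u.2.2)), u.2.2) : E3))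
  fun_prop

theorem contDiff_linAut_symm (a b p q : ℝ) (ha : a ≠ 0) (hb : b ≠ 0) :
    ContMDiff 𝓘(ℝ, E3) 𝓘(ℝ, E3) ∞ (SOL.linAut a b p q ha hb).symm := by
  rw [SOL.contMDiff_self_iff]
  change ContDiff ℝ ∞ (fun u : E3 => ((a⁻¹ * (u.1 - p * (Real.exp u.2.2 - 1)),
    b⁻¹ * (u.2.1 - q * (1 - Real.exp (-u.2.2))), u.2.2) : E3))
  fun_prop

theorem contDiff_swapAut : ContMDiff 𝓘(ℝ, E3) 𝓘(ℝ, E3) ∞ SOL.swapAut := by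
  rw [SOL.contMDiff_self_iff]
  change ContDiff ℝ ∞ (fun u : E3 => ((u.2.1, u.1, -u.2.2) : E3))
  fun_prop

/-- An automorphism intertwines the left translation by `a` with the left translation by `φ a`. -/
theorem isLeftInvariant_pullback {g : BilinField} (hg : IsLeftInvariant g) (φ : SOL ≃* SOL)
    (hφ : ContMDiff 𝓘(ℝ, E3) 𝓘(ℝ, E3) ∞ φ) : IsLeftInvariant (pullback φ g) := fun a => by
  have hl : ∀ b : SOL, ContMDiff 𝓘(ℝ, E3) 𝓘(ℝ, E3) ∞ (fun p : SOL => b * p) := fun b =>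
    contMDiff_mul_left.of_le (by exact le_top (a := (∞ : ℕ∞ω)))
  rw [← pullback_comp _ _ hφ (hl a)]
  have : (φ ∘ fun p => a * p) = (fun p => φ a * p) ∘ φ := by funext p; simp
  rw [this, pullback_comp _ _ (hl _) hφ, hg]

theorem IsLeftInvariant.eq_of_apply_one {g h : BilinField} (hg : IsLeftInvariant g)
    (hh : IsLeftInvariant h) (H : ∀ v w, g 1 v w = h 1 v w) : g = h :=
  BilinField.ext fun p v w => by rw [hg.apply, hh.apply, H]

theorem isLeftInvariant_lorentzSOL : IsLeftInvariant lorentzSOL :=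
  isLeftInvariant_leftInvariantExtension _

theorem fderiv_linAut (a b p q : ℝ) (ha : a ≠ 0) (hb : b ≠ 0) (v : E3) :
    fderiv ℝ (E := E3) (F := E3) (SOL.linAut a b p q ha hb) (0 : E3) v =
      (a * v.1 + p * v.2.2, b * v.2.1 + q * v.2.2, v.2.2) := by
  have h1 := (E3.hasFDerivAt_exp 1 0)
  have h2 := (E3.hasFDerivAt_exp (-1) 0)
  simp only [one_mul, neg_one_mul] at h1 h2
  have h : HasFDerivAt (E := E3) (F := E3) (SOL.linAut a b p q ha hb) _ (0 : E3) :=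
    hasFDerivAt_triple (((E3.hasFDerivAt_x 0).const_mul a).add ((h1.sub_const 1).const_mul p))
    (((E3.hasFDerivAt_z 0).const_mul b).add ((h2.const_sub 1).const_mul q)) (E3.hasFDerivAt_t 0)
  rw [h.fderiv]
  refine Prod.ext ?_ (Prod.ext ?_ ?_) <;> simp

theorem fderiv_swapAut (p : SOL) (v : E3) :
    fderiv ℝ (E := E3) (F := E3) SOL.swapAut p v = (v.2.1, v.1, -v.2.2) := by
  have h : HasFDerivAt (E := E3) (F := E3) SOL.swapAut _ p :=
    hasFDerivAt_triple (p := p) (E3.hasFDerivAt_z p) (E3.hasFDerivAt_x p) (E3.hasFDerivAt_t p).neg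
  rw [h.fderiv]
  rfl

/-- A left-invariant Lorentz metric for which `X` is isotropic and orthogonal to `Z` is the pullback
of the Lorentz-SOL metric by an automorphism. -/
theorem exists_aut_of_isotropic_X {g : BilinField} (hB : IsLorentzForm (g 1))
    (hg : IsLeftInvariant g) (hXX : g 1 E3.ex E3.ex = 0) (hXZ : g 1 E3.ex E3.ez = 0) :
    ∃ φ : SOL ≃* SOL, ContMDiff 𝓘(ℝ, E3) 𝓘(ℝ, E3) ∞ φ ∧
      ContMDiff 𝓘(ℝ, E3) 𝓘(ℝ, E3) ∞ φ.symm ∧ pullback φ lorentzSOL = g := by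
  have hex : E3.ex ≠ 0 := fun h => one_ne_zero (congrArg (fun u : E3 => u.1) h)
  have hZZ : 0 < g 1 E3.ez E3.ez := hB.pos_of_orthogonal_isotropic hex hXX hXZ fun c h => by
    simpa [E3.ez, E3.ex] using congrArg (fun u : E3 => u.2.1) h
  -- Otherwise `X` would lie in the kernel of a nondegenerate form.
  have hXT : g 1 E3.ex E3.et ≠ 0 := fun h => hex (hB.eq_zero fun w => by
    rw [E3.map_eq_comb (g 1 E3.ex) w]; simp [h, hXX, hXZ])
  -- The differential of `linAut ξ b r q` at the identity sends `X` to `ξ X`, `Z` to `b Z` and `T`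
  -- to `T + r X + q Z`. Matching coefficients requires `g(X,T) = ξ`, `g(Z,Z) = b²`, `g(Z,T) = b q`
  -- and `g(T,T) = 2 r + q²`, which are solved in this order.
  set ξ := g 1 E3.ex E3.et with hξ
  set ζ := g 1 E3.ez E3.ez with hζ
  have hb : Real.sqrt ζ ≠ 0 := (Real.sqrt_pos.2 hZZ).ne'
  set b := Real.sqrt ζ with hbdef
  have hbb : b * b = ζ := Real.mul_self_sqrt hZZ.le
  set q := g 1 E3.ez E3.et / b with hq
  have hbq : b * q = g 1 E3.ez E3.et := by rw [hq]; field_simp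
  set r := (g 1 E3.et E3.et - q * q) / 2 with hr
  refine ⟨SOL.linAut ξ b r q hXT hb, contDiff_linAut _ _ _ _ _ _, contDiff_linAut_symm _ _ _ _ _ _,
    (isLeftInvariant_pullback isLeftInvariant_lorentzSOL _
      (contDiff_linAut _ _ _ _ _ _)).eq_of_apply_one hg fun v w => ?_⟩
  rw [pullback_apply, map_one]
  have e : ∀ v, fderiv ℝ (E := E3) (F := E3) (SOL.linAut ξ b r q hXT hb) (1 : SOL) v = _ :=
    fderiv_linAut ξ b r q hXT hb
  rw [e, e, lorentzSOL_eq, waveMetric_apply, E3.map_eq_comb (g 1 v) w, E3.map_eq_comb (g 1) v]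
  have s1 := hB.symm E3.ez E3.ex
  have s2 := hB.symm E3.et E3.ex
  have s3 := hB.symm E3.et E3.ez
  have e1 : Real.exp (-1 * (1 : SOL).2.2) = 1 := by simp [SOL.one_def]
  have e2 : Real.exp (2 * (1 : SOL).2.2) = 1 := by simp [SOL.one_def]
  simp only [add_apply, smul_apply, smul_eq_mul, s1, s2, s3, hXX, hXZ, e1, e2, ← hξ, ← hζ, ← hbq,
    ← hbb]
  have htt : g 1 E3.et E3.et = 2 * r + q * q := by rw [hr]; ring
  rw [htt]
  ring

theorem DerivedDegenerate.exists_vector {g : BilinField} (h : DerivedDegenerate g) :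
    ∃ n : E3, n ≠ 0 ∧ n.2.2 = 0 ∧ ∀ w : E3, w.2.2 = 0 → g 1 n w = 0 := by
  obtain ⟨n, hn, hn0, hnB⟩ := h
  exact ⟨n, hn0, (mem_solDerived_iff n).1 hn, fun w hw => hnB w ((mem_solDerived_iff w).2 hw)⟩

theorem EigendirectionIsotropic.exists_vector {g : BilinField} (h : EigendirectionIsotropic g) :
    ∃ v : E3, v ≠ 0 ∧ v.2.2 = 0 ∧ (v.1 = 0 ∨ v.2.1 = 0) ∧ g 1 v v = 0 := by
  obtain ⟨v, hv, hv0, ⟨μ, hμ⟩, hvv⟩ := h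
  refine ⟨v, hv0, (mem_solDerived_iff v).1 hv, ?_, hvv⟩
  rw [LieSOL.bracket_eq] at hμ
  have h1 : (1 : ℝ) * (v : E3).1 - (v : E3).2.2 * 0 = μ * (v : E3).1 :=
    congrArg (fun u : E3 => u.1) hμ
  have h2 : -((1 : ℝ) * (v : E3).2.1 - (v : E3).2.2 * 0) = μ * (v : E3).2.1 :=
    congrArg (fun u : E3 => u.2.1) hμ
  -- If both coordinates were nonzero, the eigenvalue would be `1` and `-1` at once.
  by_contra hne
  rw [not_or] at hne
  have e1 : μ = 1 := mul_right_cancel₀ hne.1 (by linarith)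
  have e2 : μ = -1 := mul_right_cancel₀ hne.2 (by linarith)
  linarith

/-- The kernel of the form on the derived algebra is an isotropic line, and every vector of the
plane outside it is spacelike. The isotropic eigenvector therefore spans the kernel. If it is along
`X`, the normalisation above applies, and if it is along `Z`, `swapAut` reduces to that case. -/
theorem exists_aut_pullback_eq {g : BilinField} (hL : IsLorentzMetric g) (hg : IsLeftInvariant g)
    (hd : DerivedDegenerate g) (hi : EigendirectionIsotropic g) :
    ∃ φ : SOL ≃* SOL, ContMDiff 𝓘(ℝ, E3) 𝓘(ℝ, E3) ∞ φ ∧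
      ContMDiff 𝓘(ℝ, E3) 𝓘(ℝ, E3) ∞ φ.symm ∧ pullback φ lorentzSOL = g := by
  have hB := hL.form 1
  obtain ⟨n, hn0, hn, hnB⟩ := hd.exists_vector
  obtain ⟨v, hv0, hv, hxz, hvv⟩ := hi.exists_vector
  have hvD : ∀ w : E3, w.2.2 = 0 → g 1 v w = 0 := by
    have hnn := hnB n hn
    by_cases hc : ∃ c : ℝ, v = c • n
    · obtain ⟨c, rfl⟩ := hc
      intro w hw
      rw [map_smul, smul_apply, hnB w hw, smul_zero]
    · have := hB.pos_of_orthogonal_isotropic hn0 hnn (hnB v hv) fun c h => hc ⟨c, h⟩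
      exact absurd hvv this.ne'
  by_cases hx : v.1 = 0
  · have hz : v.2.1 ≠ 0 := fun hz => hv0 (Prod.ext hx (Prod.ext hz hv))
    have hvz : v = v.2.1 • E3.ez := by
      conv_lhs => rw [E3.eq_comb v]
      simp [hx, hv]
    have key : ∀ w : E3, w.2.2 = 0 → g 1 E3.ez w = 0 := fun w hw => by
      have := hvD w hw
      rw [hvz, map_smul, smul_apply, smul_eq_mul] at this
      exact (mul_eq_zero.1 this).resolve_left hz
    have hsw := contDiff_swapAut
    have e : ∀ v w, pullback SOL.swapAut g 1 v w = g 1 (v.2.1, v.1, -v.2.2) (w.2.1, w.1, -w.2.2) :=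
      fun v w => by rw [pullback_apply, fderiv_swapAut, fderiv_swapAut, map_one]
    have hF : IsLorentzForm (pullback SOL.swapAut g 1) := by
      refine ⟨fun v w => by rw [e, e, hB.symm], ?_⟩
      obtain ⟨b, hb⟩ := hB.signature
      let L : E3 ≃ₗ[ℝ] E3 :=
        { toFun := fun v => (v.2.1, v.1, -v.2.2)
          invFun := fun v => (v.2.1, v.1, -v.2.2)
          map_add' := fun v w => by simp [add_comm]
          map_smul' := fun c v => by simp
          left_inv := fun v => by simp
          right_inv := fun v => by simp }
      refine ⟨b.map L, fun i j => ?_⟩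
      rw [e, ← hb i j]
      simp [L]
    obtain ⟨φ, h1, h2, h3⟩ := exists_aut_of_isotropic_X hF (isLeftInvariant_pullback hg _ hsw)
      ((e _ _).trans (by simpa [E3.ex, E3.ez] using key E3.ez rfl))
      ((e _ _).trans (by simpa [E3.ex, E3.ez] using key E3.ex rfl))
    have h2' : ContMDiff 𝓘(ℝ, E3) 𝓘(ℝ, E3) ∞ (SOL.swapAut ∘ φ.symm) := hsw.comp h2
    refine ⟨SOL.swapAut.trans φ, h1.comp hsw, h2', ?_⟩
    change pullback (φ ∘ SOL.swapAut) lorentzSOL = g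
    rw [pullback_comp _ _ h1 hsw, h3, ← pullback_comp _ _ hsw hsw]
    have : (SOL.swapAut ∘ SOL.swapAut : SOL → SOL) = id :=
      funext fun p => SOL.swapAut.symm_apply_apply p
    rw [this, pullback_id]
  · have hz : v.2.1 = 0 := hxz.resolve_left hx
    have hvx : v = v.1 • E3.ex := by
      conv_lhs => rw [E3.eq_comb v]
      simp [hz, hv]
    have key : ∀ w : E3, w.2.2 = 0 → g 1 E3.ex w = 0 := fun w hw => by
      have := hvD w hw
      rw [hvx, map_smul, smul_apply, smul_eq_mul] at this
      exact (mul_eq_zero.1 this).resolve_left hx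
    exact exists_aut_of_isotropic_X hB hg (key _ rfl) (key _ rfl)

/-! ### Curvature -/

/-- The Christoffel symbols of the Lorentz-SOL metric. -/
noncomputable def christoffelSOL (p : SOL) : E3 →L[ℝ] E3 →L[ℝ] E3 :=
  (-Real.exp (3 * p.2.2)) • E3.z.smulRight (E3.z.smulRight E3.ex) +
    (E3.z.smulRight (E3.t.smulRight E3.ez) + E3.t.smulRight (E3.z.smulRight E3.ez) -
      E3.t.smulRight (E3.t.smulRight E3.et))

theorem christoffelSOL_apply (p : SOL) (u v : E3) : christoffelSOL p u v =
    (-(Real.exp (3 * p.2.2) * (u.2.1 * v.2.1)), u.2.1 * v.2.2 + u.2.2 * v.2.1, -(u.2.2 * v.2.2)) := by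
  change (-Real.exp (3 * p.2.2)) • (u.2.1 • v.2.1 • E3.ex) +
    (u.2.1 • v.2.2 • E3.ez + u.2.2 • v.2.1 • E3.ez - u.2.2 • v.2.2 • E3.et) = _
  refine Prod.ext ?_ (Prod.ext ?_ ?_) <;> simp [E3.ex, E3.ez, E3.et]

section

variable {F : Type*} [NormedAddCommGroup F] [NormedSpace ℝ F] (B C : F)

theorem contDiff_exp_three_smul_add :
    ContDiff ℝ ∞ (fun p : E3 => (-Real.exp (3 * p.2.2)) • B + C) := by
  fun_prop

theorem hasFDerivAt_exp_three_smul_add (p : E3) :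
    HasFDerivAt (fun p : E3 => (-Real.exp (3 * p.2.2)) • B + C)
      (E3.t.smulRight (-(3 * Real.exp (3 * p.2.2)) • B)) p := by
  refine (((E3.hasFDerivAt_exp 3 p).neg.smul_const B).add_const C).congr_fderiv ?_
  refine ContinuousLinearMap.ext fun v => ?_
  simp [smul_smul]
  ring_nf

end

theorem coordDeriv_christoffelSOL (p : SOL) (u v w : E3) :
    coordDeriv christoffelSOL p u v w = (u.2.2 * (-(3 * Real.exp (3 * p.2.2)) * (v.2.1 * w.2.1)), 0, 0) := by
  have h := (hasFDerivAt_exp_three_smul_add (E3.z.smulRight (E3.z.smulRight E3.ex))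
    (E3.z.smulRight (E3.t.smulRight E3.ez) + E3.t.smulRight (E3.z.smulRight E3.ez) -
      E3.t.smulRight (E3.t.smulRight E3.et)) p).fderiv
  have h' : coordDeriv christoffelSOL p = _ := (coordDeriv_eq_fderiv _ _).trans h
  rw [h']
  change u.2.2 • (-(3 * Real.exp (3 * p.2.2))) • (v.2.1 • w.2.1 • E3.ex) = _
  refine Prod.ext ?_ (Prod.ext ?_ ?_) <;> simp [E3.ex]

theorem isLeviCivita_christoffelSOL : IsLeviCivita lorentzSOL christoffelSOL where
  smooth := (SOL.contMDiff_iff _).2 (contDiff_exp_three_smul_add _ _)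
  torsion_free p u v := by
    rw [christoffelSOL_apply, christoffelSOL_apply]
    refine Prod.ext ?_ (Prod.ext ?_ ?_) <;> simp <;> ring
  compatible p u v w := by
    rw [lorentzSOL_eq, coordDeriv_waveMetric_apply, waveMetric_apply, waveMetric_apply,
      christoffelSOL_apply, christoffelSOL_apply]
    have : Real.exp (2 * p.2.2) = Real.exp (-1 * p.2.2) * Real.exp (3 * p.2.2) := by
      rw [← Real.exp_add]; congr 1; ring
    simp only [this]
    ring

/-- At the identity `R(T, Z) Z = -2 X`: the derivative of the Christoffel symbol contributes `-3`
and the quadratic terms contribute `1`. -/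
theorem not_isFlat_lorentzSOL : ¬ IsFlat lorentzSOL := by
  intro h
  have h := h _ isLeviCivita_christoffelSOL 1 E3.et E3.ez E3.ez
  rw [curvatureTensor] at h
  simp only [christoffelSOL_apply, coordDeriv_christoffelSOL] at h
  have h1 := congrArg (fun u : E3 => u.1) h
  simp [E3.et, E3.ez, SOL.one_def] at h1
  norm_num at h1

/-! ### Directional derivatives of functions on open subsets of `ℝ³` -/

/-- The derivative of `f` in the constant direction `e`. -/
noncomputable def pd (e : E3) (f : E3 → ℝ) : E3 → ℝ := fun p => fderiv ℝ f p e

section pd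

variable {U : Set E3} {f g : E3 → ℝ}

theorem ContDiffOn.differentiableAt_of_isOpen (hU : IsOpen U) (hf : ContDiffOn ℝ ∞ f U) {p : E3}
    (hp : p ∈ U) : DifferentiableAt ℝ f p :=
  (hf.contDiffAt (hU.mem_nhds hp)).differentiableAt (by simp)

theorem contDiffOn_pd (hU : IsOpen U) (hf : ContDiffOn ℝ ∞ f U) (e : E3) :
    ContDiffOn ℝ ∞ (pd e f) U :=
  (hf.fderiv_of_isOpen hU (m := ∞) (by simp)).clm_apply contDiffOn_const

theorem pd_comm (hU : IsOpen U) (hf : ContDiffOn ℝ ∞ f U) (a b : E3) {p : E3} (hp : p ∈ U) :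
    pd a (pd b f) p = pd b (pd a f) p := by
  have hfp := hf.contDiffAt (hU.mem_nhds hp)
  have hd : DifferentiableAt ℝ (fderiv ℝ f) p :=
    (hfp.fderiv_right (m := ∞) (by simp)).differentiableAt (by simp)
  have key : ∀ c d : E3, pd c (pd d f) p = fderiv ℝ (fderiv ℝ f) p c d := fun c d => by
    have h : HasFDerivAt (pd d f) _ p := hd.hasFDerivAt.clm_apply (hasFDerivAt_const d p)
    rw [pd, h.fderiv]
    simp
  rw [key, key]
  have h2 : minSmoothness ℝ 2 ≤ (∞ : ℕ∞ω) := by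
    rw [minSmoothness_of_isRCLikeNormedField]; exact WithTop.coe_le_coe.2 (le_top : (2 : ℕ∞) ≤ ⊤)
  exact (hfp.isSymmSndFDerivAt h2) a b

theorem pd_congr (hU : IsOpen U) (h : ∀ q ∈ U, f q = g q) (e : E3) {p : E3} (hp : p ∈ U) :
    pd e f p = pd e g p := by
  rw [pd, pd, Filter.EventuallyEq.fderiv_eq (Filter.eventually_of_mem (hU.mem_nhds hp) h)]

@[simp] theorem pd_const (c : ℝ) (e p : E3) : pd e (fun _ => c) p = 0 := by simp [pd]

theorem pd_neg (e p : E3) : pd e (fun q => -f q) p = -pd e f p := by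
  simp [pd]

theorem pd_sub (hU : IsOpen U) (hf : ContDiffOn ℝ ∞ f U) (hg : ContDiffOn ℝ ∞ g U) (e : E3)
    {p : E3} (hp : p ∈ U) : pd e (fun q => f q - g q) p = pd e f p - pd e g p := by
  have h : HasFDerivAt (fun q => f q - g q) _ p :=
    (hf.differentiableAt_of_isOpen hU hp).hasFDerivAt.sub
    (hg.differentiableAt_of_isOpen hU hp).hasFDerivAt
  rw [pd, h.fderiv]
  rfl

theorem pd_mul (hU : IsOpen U) (hf : ContDiffOn ℝ ∞ f U) (hg : ContDiffOn ℝ ∞ g U) (e : E3)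
    {p : E3} (hp : p ∈ U) : pd e (fun q => f q * g q) p = f p * pd e g p + g p * pd e f p := by
  have h : HasFDerivAt (fun q => f q * g q) _ p :=
    (hf.differentiableAt_of_isOpen hU hp).hasFDerivAt.mul
    (hg.differentiableAt_of_isOpen hU hp).hasFDerivAt
  rw [pd, h.fderiv]
  rfl

theorem pd_const_mul (hU : IsOpen U) (hf : ContDiffOn ℝ ∞ f U) (c : ℝ) (e : E3)
    {p : E3} (hp : p ∈ U) : pd e (fun q => c * f q) p = c * pd e f p := by
  rw [pd_mul hU contDiffOn_const hf e hp, pd_const, mul_zero, add_zero]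

theorem pd_exp (k : ℝ) (e p : E3) :
    pd e (fun q => Real.exp (k * q.2.2)) p = k * Real.exp (k * p.2.2) * e.2.2 := by
  rw [pd, (E3.hasFDerivAt_exp k p).fderiv]
  rfl

theorem contDiffOn_exp (k : ℝ) (U : Set E3) : ContDiffOn ℝ ∞ (fun q : E3 => Real.exp (k * q.2.2)) U := by
  fun_prop

theorem pd_exp_mul (hU : IsOpen U) (hf : ContDiffOn ℝ ∞ f U) (k : ℝ) (e : E3)
    {p : E3} (hp : p ∈ U) : pd e (fun q => Real.exp (k * q.2.2) * f q) p =
      Real.exp (k * p.2.2) * (k * e.2.2 * f p + pd e f p) := by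
  rw [pd_mul hU (contDiffOn_exp k U) hf e hp, pd_exp]
  ring

end pd

namespace E3

@[simp] theorem ex_x : ex.1 = 1 := rfl
@[simp] theorem ex_z : ex.2.1 = 0 := rfl
@[simp] theorem ex_t : ex.2.2 = 0 := rfl
@[simp] theorem ez_x : ez.1 = 0 := rfl
@[simp] theorem ez_z : ez.2.1 = 1 := rfl
@[simp] theorem ez_t : ez.2.2 = 0 := rfl
@[simp] theorem et_x : et.1 = 0 := rfl
@[simp] theorem et_z : et.2.1 = 0 := rfl
@[simp] theorem et_t : et.2.2 = 1 := rfl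

end E3

open E3 in
/-- The Killing equations of `2 e⁻ᵗ dx dt + e²ᵗ dz² + β dt²` and their consequences, for the vector
field `A ∂/∂x + B ∂/∂z + C ∂/∂t`. -/
theorem killing_equations_solve {U : Set E3} (hU : IsOpen U) {A B C : E3 → ℝ} {β : ℝ}
    (hA : ContDiffOn ℝ ∞ A U) (hB : ContDiffOn ℝ ∞ B U) (hC : ContDiffOn ℝ ∞ C U)
    (h1 : ∀ p ∈ U, pd ex C p = 0)
    (h2 : ∀ p ∈ U, pd ex B p = -(Real.exp (-3 * p.2.2) * pd ez C p))
    (h3 : ∀ p ∈ U, pd ex A p = C p - pd et C p)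
    (h4 : ∀ p ∈ U, pd ez B p = -C p)
    (h5 : ∀ p ∈ U, pd ez A p = -(Real.exp (3 * p.2.2) * pd et B p) -
      β * (Real.exp (1 * p.2.2) * pd ez C p))
    (h6 : ∀ p ∈ U, pd et A p = -(β * (Real.exp (1 * p.2.2) * pd et C p))) :
    ∀ p ∈ U, (pd ez C p = 0 ∧ pd et C p = 0) ∧ (pd ex A p = C p ∧ pd et A p = 0) ∧
      pd ex B p = 0 ∧ pd ez A p = -(Real.exp (3 * p.2.2) * pd et B p) ∧
      pd et (pd et B) p = -3 * pd et B p := by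
  have hBt := contDiffOn_pd hU hB et
  have hCz := contDiffOn_pd hU hC ez
  have hCt := contDiffOn_pd hU hC et
  have hCz' := (contDiffOn_exp (-3) U).mul hCz
  have hCz'' := (contDiffOn_exp 1 U).mul hCz
  have hCt'' := (contDiffOn_exp 1 U).mul hCt
  have hBt' := (contDiffOn_exp 3 U).mul hBt
  have Cxz : ∀ p ∈ U, pd ex (pd ez C) p = 0 := fun p hp => by
    rw [pd_comm hU hC _ _ hp, pd_congr hU h1 _ hp, pd_const]
  have Cxt : ∀ p ∈ U, pd ex (pd et C) p = 0 := fun p hp => by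
    rw [pd_comm hU hC _ _ hp, pd_congr hU h1 _ hp, pd_const]
  -- Mixed derivatives of `A` in `t` and `x`. The term with `β` drops out because `C` does not
  -- depend on `x`.
  have Ctt : ∀ p ∈ U, pd et (pd et C) p = pd et C p := fun p hp => by
    have e := pd_comm hU hA et ex hp
    rw [pd_congr hU h3 _ hp, pd_congr hU h6 _ hp, pd_sub hU hC hCt _ hp, pd_neg,
      pd_const_mul hU hCt'' _ _ hp, pd_exp_mul hU hCt _ _ hp, Cxt p hp] at e
    simp at e
    linarith
  -- Mixed derivatives of `A` in `z` and `x`, where `B_xt` is eliminated through those of `B` in `x`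
  -- and `t`.
  have Czt : ∀ p ∈ U, pd et (pd ez C) p = 2 * pd ez C p := fun p hp => by
    have e := pd_comm hU hA ez ex hp
    have e' := pd_comm hU hB ex et hp
    rw [pd_congr hU h2 _ hp, pd_neg, pd_exp_mul hU hCz _ _ hp] at e'
    rw [pd_congr hU h3 _ hp, pd_congr hU h5 _ hp, pd_sub hU hC hCt _ hp,
      pd_sub hU hBt'.neg (contDiffOn_const.mul hCz'') _ hp, pd_neg, pd_exp_mul hU hBt _ _ hp,
      pd_const_mul hU hCz'' _ _ hp, pd_exp_mul hU hCz _ _ hp, Cxz p hp, e',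
      pd_comm hU hC _ _ hp] at e
    have hexp : Real.exp (3 * p.2.2) * Real.exp (-3 * p.2.2) = 1 := by
      rw [← Real.exp_add]; simp
    simp only [ex_t, et_t, mul_zero, zero_mul, zero_add, sub_zero, mul_one] at e
    linear_combination (-1 / 2) * e - 1 / 2 * (-3 * pd ez C p + pd et (pd ez C) p) * hexp
  -- Differentiating `C_tt = C_t` in `z` and using `C_zt = 2 C_z` twice gives `4 C_z = 2 C_z`.
  have Cz : ∀ p ∈ U, pd ez C p = 0 := fun p hp => by
    have e := pd_congr hU Ctt ez hp
    have e2 : ∀ q ∈ U, pd ez (pd et C) q = 2 * pd ez C q := fun q hq => by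
      rw [pd_comm hU hC _ _ hq, Czt q hq]
    rw [pd_comm hU hCt _ _ hp, pd_congr hU e2 _ hp, pd_const_mul hU hCz _ _ hp, Czt p hp,
      e2 p hp] at e
    linarith
  have h5' : ∀ p ∈ U, pd ez A p = -(Real.exp (3 * p.2.2) * pd et B p) := fun p hp => by
    rw [h5 p hp, Cz p hp]; ring
  have Btt : ∀ p ∈ U, pd et (pd et B) p = -3 * pd et B p := fun p hp => by
    have e := pd_comm hU hA et ez hp
    rw [pd_congr hU h5' _ hp, pd_congr hU h6 _ hp, pd_neg, pd_neg, pd_exp_mul hU hBt _ _ hp,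
      pd_const_mul hU hCt'' _ _ hp, pd_exp_mul hU hCt _ _ hp, pd_comm hU hC _ _ hp,
      pd_congr hU Cz _ hp, pd_const] at e
    simp at e
    linarith
  have Btz : ∀ p ∈ U, pd ez (pd et B) p = -pd et C p := fun p hp => by
    rw [pd_comm hU hB _ _ hp, pd_congr hU h4 _ hp, pd_neg]
  -- Differentiating `B_tt = -3 B_t` in `z`, with `B_tz = -C_t` and `C_tt = C_t`, gives `-C_t = 3
  -- C_t`.
  have Ct : ∀ p ∈ U, pd et C p = 0 := fun p hp => by
    have e := pd_congr hU Btt ez hp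
    rw [pd_comm hU hBt _ _ hp, pd_congr hU Btz _ hp, pd_neg, pd_const_mul hU hBt _ _ hp, Btz p hp,
      Ctt p hp] at e
    linarith
  intro p hp
  refine ⟨⟨Cz p hp, Ct p hp⟩, ⟨?_, ?_⟩, ?_, h5' p hp, Btt p hp⟩
  · rw [h3 p hp, Ct p hp, sub_zero]
  · rw [h6 p hp, Ct p hp]; ring
  · rw [h2 p hp, Cz p hp]; ring

set_option linter.unusedSimpArgs false in
open E3 in
/-- First-order description of the Killing fields of `waveMetric α β` on an open set. -/
theorem IsKillingOn.wave_equations {α β : ℝ} (hα : α ≠ 0) {U : Set SOL} (hU : IsOpen U)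
    {V : SOL → E3} (hV : IsKillingOn (waveMetric α β) U V) :
    let A : E3 → ℝ := fun q => (V q).1
    let B : E3 → ℝ := fun q => (V q).2.1
    let C : E3 → ℝ := fun q => (V q).2.2
    (ContDiffOn ℝ ∞ A U ∧ ContDiffOn ℝ ∞ B U ∧ ContDiffOn ℝ ∞ C U) ∧
    (∀ p ∈ U, ∀ e, fderiv ℝ (E := E3) V p e = (pd e A p, pd e B p, pd e C p)) ∧
    ∀ p ∈ U, (pd ex C p = 0 ∧ pd ez C p = 0 ∧ pd et C p = 0) ∧ (pd ex A p = C p ∧ pd et A p = 0) ∧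
      (pd ex B p = 0 ∧ pd ez B p = -C p) ∧ pd ez A p = -(Real.exp (3 * p.2.2) * pd et B p) ∧
      pd et (pd et B) p = -3 * pd et B p := by
  intro A B C
  have hs : ContDiffOn ℝ ∞ (E := E3) V U := (SOL.contMDiffOn_iff V U).1 hV.smooth
  have hA : ContDiffOn ℝ ∞ A U := contDiff_fst.comp_contDiffOn hs
  have hB : ContDiffOn ℝ ∞ B U := contDiff_fst.comp_contDiffOn (contDiff_snd.comp_contDiffOn hs)
  have hC : ContDiffOn ℝ ∞ C U := contDiff_snd.comp_contDiffOn (contDiff_snd.comp_contDiffOn hs)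
  have hD : ∀ p ∈ U, ∀ e, fderiv ℝ (E := E3) V p e = (pd e A p, pd e B p, pd e C p) := by
    intro p hp e
    have h : HasFDerivAt (E := E3) V _ p :=
      hasFDerivAt_triple (hA.differentiableAt_of_isOpen hU hp).hasFDerivAt
      (hB.differentiableAt_of_isOpen hU hp).hasFDerivAt
      (hC.differentiableAt_of_isOpen hU hp).hasFDerivAt
    rw [h.fderiv]
    rfl
  -- The equation `L_V g = 0` in coordinates. The six pairs of coordinate vectors give the six
  -- scalar equations `h1` to `h6`, where division by `α` leaves only the ratio `β / α`.
  have hK : ∀ p ∈ U, ∀ v w : E3, C p * (-(α * Real.exp (-1 * p.2.2) * (v.1 * w.2.2 + v.2.2 * w.1)) +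
      2 * α * Real.exp (2 * p.2.2) * (v.2.1 * w.2.1)) +
      (α * Real.exp (-1 * p.2.2) * (pd v A p * w.2.2 + pd v C p * w.1) +
      α * Real.exp (2 * p.2.2) * (pd v B p * w.2.1) + β * (pd v C p * w.2.2)) +
      (α * Real.exp (-1 * p.2.2) * (v.1 * pd w C p + v.2.2 * pd w A p) +
      α * Real.exp (2 * p.2.2) * (v.2.1 * pd w B p) + β * (v.2.2 * pd w C p)) = 0 := by
    intro p hp v w
    have h := hV.lie_zero p hp v w
    have h' : ∀ e, coordDeriv V p e = (pd e A p, pd e B p, pd e C p) := fun e => by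
      rw [coordDeriv_eq_fderiv]; exact hD p hp e
    rw [h', h', coordDeriv_waveMetric_apply, waveMetric_apply, waveMetric_apply] at h
    exact h
  have hcancel : ∀ {p : E3} {y : ℝ} (k : ℝ), α * Real.exp (k * p.2.2) * y = 0 → y = 0 :=
    fun k h => (mul_eq_zero.1 h).resolve_left (mul_ne_zero hα (Real.exp_pos _).ne')
  have e2 : ∀ p : E3, Real.exp (2 * p.2.2) * Real.exp (-3 * p.2.2) = Real.exp (-1 * p.2.2) :=
    fun p => by rw [← Real.exp_add]; congr 1; ring
  have e3 : ∀ p : E3, Real.exp (-1 * p.2.2) * Real.exp (3 * p.2.2) = Real.exp (2 * p.2.2) :=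
    fun p => by rw [← Real.exp_add]; congr 1; ring
  have e1 : ∀ p : E3, Real.exp (-1 * p.2.2) * Real.exp (1 * p.2.2) = 1 :=
    fun p => by rw [← Real.exp_add]; simp
  have h1 : ∀ p ∈ U, pd ex C p = 0 := fun p hp => hcancel (p := p) (-1) (by
    have := hK p hp ex ex
    simp only [ex_x, ex_z, ex_t, ez_x, ez_z, ez_t, et_x, et_z, et_t] at this
    linear_combination this / 2)
  have h2 : ∀ p ∈ U, pd ex B p = -(Real.exp (-3 * p.2.2) * pd ez C p) := fun p hp => by
    refine eq_neg_of_add_eq_zero_left (hcancel (p := p) 2 ?_)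
    have := hK p hp ex ez
    simp only [ex_x, ex_z, ex_t, ez_x, ez_z, ez_t, et_x, et_z, et_t] at this
    linear_combination this + α * pd ez C p * e2 p
  have h3 : ∀ p ∈ U, pd ex A p = C p - pd et C p := fun p hp => by
    refine sub_eq_zero.1 (hcancel (p := p) (-1) ?_)
    have := hK p hp ex et
    have h1p := h1 p hp
    simp only [ex_x, ex_z, ex_t, ez_x, ez_z, ez_t, et_x, et_z, et_t] at this
    rw [h1p] at this
    linear_combination this
  have h4 : ∀ p ∈ U, pd ez B p = -C p := fun p hp => by
    refine eq_neg_of_add_eq_zero_left (hcancel (p := p) 2 ?_)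
    have := hK p hp ez ez
    simp only [ex_x, ex_z, ex_t, ez_x, ez_z, ez_t, et_x, et_z, et_t] at this
    linear_combination this / 2
  have h5 : ∀ p ∈ U, pd ez A p = -(Real.exp (3 * p.2.2) * pd et B p) -
      (β / α) * (Real.exp (1 * p.2.2) * pd ez C p) := fun p hp => by
    refine sub_eq_zero.1 (hcancel (p := p) (-1) ?_)
    have := hK p hp ez et
    simp only [ex_x, ex_z, ex_t, ez_x, ez_z, ez_t, et_x, et_z, et_t] at this
    have hβ : α * (β / α) = β := by field_simp
    linear_combination this + α * pd et B p * e3 p + α * (β / α) * pd ez C p * e1 p +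
      pd ez C p * hβ
  have h6 : ∀ p ∈ U, pd et A p = -((β / α) * (Real.exp (1 * p.2.2) * pd et C p)) := fun p hp => by
    refine eq_neg_of_add_eq_zero_left (hcancel (p := p) (-1) ?_)
    have := hK p hp et et
    simp only [ex_x, ex_z, ex_t, ez_x, ez_z, ez_t, et_x, et_z, et_t] at this
    have hβ : α * (β / α) = β := by field_simp
    linear_combination this / 2 + α * (β / α) * pd et C p * e1 p +
      pd et C p * hβ
  refine ⟨⟨hA, hB, hC⟩, hD, fun p hp => ?_⟩
  obtain ⟨⟨a1, a2⟩, a3, a4, a5, a6⟩ := killing_equations_solve hU hA hB hC h1 h2 h3 h4 h5 h6 p hp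
  exact ⟨⟨h1 p hp, a1, a2⟩, a3, ⟨a4, h4 p hp⟩, a5, a6⟩

/-! ### The local isotropy algebra -/

/-- The generator of the local isotropy algebra at a point with last coordinate `s`. -/
noncomputable def isotropyGenerator (s : ℝ) : E3 →L[ℝ] E3 :=
  E3.z.smulRight (-Real.exp (3 * s) • E3.ex) + E3.t.smulRight E3.ez

theorem isotropyGenerator_apply (s : ℝ) (v : E3) :
    isotropyGenerator s v = (-(Real.exp (3 * s) * v.2.1), v.2.2, 0) := by
  change v.2.1 • (-Real.exp (3 * s)) • E3.ex + v.2.2 • E3.ez = _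
  refine Prod.ext ?_ (Prod.ext ?_ ?_) <;> simp [mul_comm]

theorem isotropyGenerator_ne_zero (s : ℝ) : isotropyGenerator s ≠ 0 := fun h => by
  have := congrArg (fun L : E3 →L[ℝ] E3 => (L E3.et).2.1) h
  simp only [isotropyGenerator_apply] at this
  exact one_ne_zero this

/-- The generator maps `T` to `Z`, `Z` into `ℝX` and `X` to `0`, so its cube vanishes. -/
theorem isNilpotent_isotropyGenerator (s : ℝ) : IsNilpotent (isotropyGenerator s) := by
  refine ⟨3, ContinuousLinearMap.ext fun v => ?_⟩
  change isotropyGenerator s (isotropyGenerator s (isotropyGenerator s v)) = 0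
  simp [isotropyGenerator_apply]

/-- The field is `-k` times `z ∂x + (e⁻³ᵗ/3) ∂z`, corrected by translations in `x` and `z` so that
it vanishes at `p₀`. -/
theorem isKillingOn_rotation (p₀ : SOL) (k : ℝ) : IsKillingOn lorentzSOL univ (fun p =>
    ((-k * (p.2.1 - p₀.2.1), -(k / 3) * (Real.exp (-3 * p.2.2) - Real.exp (-3 * p₀.2.2)), 0) : E3)) ∧
    ∀ p : SOL, coordDeriv (fun p : SOL => ((-k * (p.2.1 - p₀.2.1),
      -(k / 3) * (Real.exp (-3 * p.2.2) - Real.exp (-3 * p₀.2.2)), 0) : E3)) p =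
      (k * Real.exp (-3 * p.2.2)) • isotropyGenerator p.2.2 := by
  have hD : ∀ p : SOL, coordDeriv (fun p : SOL => ((-k * (p.2.1 - p₀.2.1),
      -(k / 3) * (Real.exp (-3 * p.2.2) - Real.exp (-3 * p₀.2.2)), 0) : E3)) p =
      (k * Real.exp (-3 * p.2.2)) • isotropyGenerator p.2.2 := fun p => by
    have h := hasFDerivAt_triple (p := p)
      (((E3.hasFDerivAt_z p).sub_const p₀.2.1).const_mul (-k))
      (((E3.hasFDerivAt_exp (-3) p).sub_const (Real.exp (-3 * p₀.2.2))).const_mul (-(k / 3)))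
      (hasFDerivAt_const (0 : ℝ) _)
    refine (coordDeriv_eq_fderiv _ _).trans (h.fderiv.trans (ContinuousLinearMap.ext fun v => ?_))
    have e : Real.exp (-3 * p.2.2) * Real.exp (3 * p.2.2) = 1 := by rw [← Real.exp_add]; simp
    rw [smul_apply, isotropyGenerator_apply]
    refine Prod.ext ?_ (Prod.ext ?_ ?_)
    · change -k * v.2.1 = k * Real.exp (-3 * p.2.2) * -(Real.exp (3 * p.2.2) * v.2.1)
      linear_combination (k * v.2.1) * e
    · change -(k / 3) * (-3 * Real.exp (-3 * p.2.2) * v.2.2) = k * Real.exp (-3 * p.2.2) * v.2.2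
      ring
    · simp
  refine ⟨⟨?_, fun p _ v w => ?_⟩, hD⟩
  · have h : ContDiff ℝ ∞ (fun p : E3 => ((-k * (p.2.1 - p₀.2.1),
      -(k / 3) * (Real.exp (-3 * p.2.2) - Real.exp (-3 * p₀.2.2)), 0) : E3)) := by fun_prop
    exact (SOL.contMDiffOn_iff _ _).2 h.contDiffOn
  · rw [hD, lorentzSOL_eq, coordDeriv_waveMetric_apply, waveMetric_apply, waveMetric_apply]
    simp only [smul_apply, isotropyGenerator_apply]
    have e : Real.exp (2 * p.2.2) = Real.exp (-1 * p.2.2) * Real.exp (3 * p.2.2) := by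
      rw [← Real.exp_add]; congr 1; ring
    rw [e]
    simp only [Prod.smul_fst, Prod.smul_snd, smul_eq_mul]
    ring

theorem localIsotropyAlgebra_lorentzSOL (p : SOL) :
    localIsotropyAlgebra lorentzSOL p = {A | ∃ c : ℝ, A = c • isotropyGenerator p.2.2} := by
  ext L
  constructor
  · rintro ⟨U, V, hU, hpU, hV, hVp, rfl⟩
    rw [lorentzSOL_eq] at hV
    obtain ⟨-, hD, hK⟩ := hV.wave_equations one_ne_zero hU
    obtain ⟨⟨c1, c2, c3⟩, ⟨a1, a2⟩, ⟨b1, b2⟩, a3, -⟩ := hK p hpU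
    have hC : (V p).2.2 = 0 := by rw [hVp]; rfl
    -- Once `C p = 0`, the first-order equations leave `∂B/∂t` as the only free entry of the
    -- differential.
    replace a1 := a1.trans hC
    replace b2 := b2.trans (neg_eq_zero.2 hC)
    refine ⟨pd E3.et (fun q => (V q).2.1) p, ?_⟩
    rw [coordDeriv_eq_fderiv]
    refine E3.clm_ext ?_ ?_ ?_
    · rw [hD p hpU, c1, a1, b1, smul_apply, isotropyGenerator_apply]
      refine Prod.ext ?_ (Prod.ext ?_ ?_) <;> simp
    · rw [hD p hpU, c2, a3, b2, smul_apply, isotropyGenerator_apply]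
      refine Prod.ext ?_ (Prod.ext ?_ ?_) <;> simp [mul_comm]
    · rw [hD p hpU, c3, a2, smul_apply, isotropyGenerator_apply]
      refine Prod.ext ?_ (Prod.ext ?_ ?_) <;> simp
  · rintro ⟨c, rfl⟩
    -- The factor `e³ᵗ` compensates the `e⁻³ᵗ` in the differential of the field at `p`.
    obtain ⟨h, hD⟩ := isKillingOn_rotation p (c * Real.exp (3 * p.2.2))
    refine ⟨univ, _, isOpen_univ, mem_univ _, h, ?_, ?_⟩
    · simp
    · rw [hD, mul_assoc, ← Real.exp_add]
      simp

/-! ### Killing fields from families of isometries -/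

section Family

variable {E : Type*} [NormedAddCommGroup E] [NormedSpace ℝ E]

/-- The initial velocity of a family of maps `F (s, ·)`. -/
noncomputable def initialVelocity (F : ℝ × E → E) (p : E) : E := fderiv ℝ F (0, p) (1, 0)

/-- Smoothness is required only along `s = 0`, because the families used for maximality come from a
chart of a Lie group and are controlled only near the identity. -/
theorem contDiff_initialVelocity {F : ℝ × E → E} (hF : ∀ p, ContDiffAt ℝ ∞ F (0, p)) :
    ContDiff ℝ ∞ (initialVelocity F) := by
  rw [contDiff_iff_contDiffAt]
  intro p
  have h1 : ContDiffAt ℝ ∞ (fderiv ℝ F) (0, p) := (hF p).fderiv_right (by simp)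
  have h2 : ContDiffAt ℝ ∞ (fun q : E => ((0 : ℝ), q)) p := by fun_prop
  exact (ContDiffAt.comp (g := fderiv ℝ F) p h1 h2).clm_apply contDiffAt_const

/-- Differentiate the invariance at `s = 0`. Symmetry of the second derivative of `F` identifies the
`s`-derivative of the differential of `F (s, ·)` with the differential of the velocity field. No
flow or group property of the family is needed. -/
theorem lie_derivative_eq_zero_of_family {g : E → E →L[ℝ] E →L[ℝ] ℝ} {F : ℝ × E → E} {p : E}
    (hg : DifferentiableAt ℝ g p) (hF : ContDiffAt ℝ ∞ F (0, p)) (h0 : ∀ q, F (0, q) = q)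
    (hinv : ∀ s v w, g (F (s, p)) (fderiv ℝ (fun q => F (s, q)) p v)
      (fderiv ℝ (fun q => F (s, q)) p w) = g p v w) (v w : E) :
    fderiv ℝ g p (initialVelocity F p) v w + g p (fderiv ℝ (initialVelocity F) p v) w +
      g p v (fderiv ℝ (initialVelocity F) p w) = 0 := by
  have hF1 : ContDiffAt ℝ ∞ (fderiv ℝ F) (0, p) := hF.fderiv_right (by simp)
  have hdF : HasFDerivAt (fderiv ℝ F) (fderiv ℝ (fderiv ℝ F) (0, p)) (0, p) :=
    (hF1.differentiableAt (by simp)).hasFDerivAt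
  have h2 : minSmoothness ℝ 2 ≤ (∞ : ℕ∞ω) := by
    rw [minSmoothness_of_isRCLikeNormedField]; exact WithTop.coe_le_coe.2 (le_top : (2 : ℕ∞) ≤ ⊤)
  have hsymm := hF.isSymmSndFDerivAt h2
  -- the derivative of the velocity field
  have hV : ∀ u, fderiv ℝ (initialVelocity F) p u = fderiv ℝ (fderiv ℝ F) (0, p) (1, 0) (0, u) := by
    intro u
    have e : HasFDerivAt (fun q : E => ((0 : ℝ), q)) (ContinuousLinearMap.inr ℝ ℝ E) p :=
      (hasFDerivAt_const 0 p).prodMk (hasFDerivAt_id p)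
    have h : HasFDerivAt (initialVelocity F) _ p :=
      (HasFDerivAt.comp (g := fderiv ℝ F) p hdF e).clm_apply (hasFDerivAt_const ((1, 0) : ℝ × E) p)
    rw [h.fderiv, hsymm]
    simp
  -- the derivatives in `s` of the differentials
  have hev : ∀ᶠ s in 𝓝 (0 : ℝ), ∀ u, fderiv ℝ (fun q => F (s, q)) p u = fderiv ℝ F (s, p) (0, u) := by
    have h1 : ∀ᶠ q in 𝓝 ((0 : ℝ), p), DifferentiableAt ℝ F q := by
      have := (hF.of_le (m := 1) (by simp)).eventually (by simp)
      exact this.mono fun q hq => hq.differentiableAt (by simp)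
    have h2 : Filter.Tendsto (fun s : ℝ => (s, p)) (𝓝 0) (𝓝 (0, p)) :=
      (Continuous.prodMk_left p).tendsto 0
    filter_upwards [h2.eventually h1] with s hs u
    have e : HasFDerivAt (fun q : E => (s, q)) (ContinuousLinearMap.inr ℝ ℝ E) p :=
      (hasFDerivAt_const s p).prodMk (hasFDerivAt_id p)
    have h : HasFDerivAt (fun q => F (s, q)) _ p := HasFDerivAt.comp (g := F) p hs.hasFDerivAt e
    rw [h.fderiv]
    rfl
  have hline : HasDerivAt (fun s : ℝ => (s, p)) ((1 : ℝ), (0 : E)) 0 :=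
    (hasDerivAt_id 0).prodMk (hasDerivAt_const 0 p)
  have hψ : ∀ u, HasDerivAt (fun s : ℝ => fderiv ℝ F (s, p) (0, u))
      (fderiv ℝ (fderiv ℝ F) (0, p) (1, 0) (0, u)) 0 := by
    intro u
    have h1 : HasDerivAt (fun s : ℝ => fderiv ℝ F (s, p)) (fderiv ℝ (fderiv ℝ F) (0, p) (1, 0)) 0 :=
      HasFDerivAt.comp_hasDerivAt (f := fun s : ℝ => (s, p)) (0 : ℝ) hdF hline
    have h := h1.clm_apply (hasDerivAt_const (0 : ℝ) ((0 : ℝ), u))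
    rwa [map_zero, add_zero] at h
  have hval : ∀ u, fderiv ℝ F (0, p) (0, u) = u := by
    intro u
    have := hev.self_of_nhds u
    rw [← this]
    have : (fun q => F (0, q)) = id := funext h0
    rw [this, fderiv_id]
    rfl
  have hgF : HasDerivAt (fun s : ℝ => g (F (s, p))) (fderiv ℝ g p (initialVelocity F p)) 0 := by
    have h1 : HasDerivAt (fun s : ℝ => F (s, p)) (initialVelocity F p) 0 :=
      HasFDerivAt.comp_hasDerivAt (0 : ℝ) (hF.differentiableAt (by simp)).hasFDerivAt hline
    have hg' : HasFDerivAt g (fderiv ℝ g p) (F (0, p)) := by rw [h0]; exact hg.hasFDerivAt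
    exact HasFDerivAt.comp_hasDerivAt (E := E →L[ℝ] E →L[ℝ] ℝ) (F := E) (l := g)
      (f := fun s : ℝ => F (s, p)) (0 : ℝ) hg' h1
  have hd := (hgF.clm_apply (hψ v)).clm_apply (hψ w)
  have hc : HasDerivAt (fun s : ℝ => g (F (s, p)) (fderiv ℝ F (s, p) (0, v))
      (fderiv ℝ F (s, p) (0, w))) 0 0 := by
    refine (hasDerivAt_const (0 : ℝ) (g p v w)).congr_of_eventuallyEq ?_
    filter_upwards [hev] with s hs
    rw [← hs, ← hs, hinv]
  have := hd.unique hc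
  simp only [h0, hval, add_apply] at this
  rw [hV, hV]
  linarith

/-- Conjugation by a diffeomorphism pushes the velocity field forward. This is how an isometry is
seen to carry Killing fields to Killing fields. -/
theorem initialVelocity_conj {φ ψ : E → E} {H : ℝ × E → E} (hφ : ContDiff ℝ ∞ φ)
    (hψ : ContDiff ℝ ∞ ψ) (hH : ContDiff ℝ ∞ H) (hH0 : ∀ q, H (0, q) = q) {p w : E}
    (hp : ψ (φ p) = p) (hw : HasDerivAt (fun s : ℝ => H (s, p)) w 0) :
    initialVelocity (fun q : ℝ × E => φ (H (q.1, ψ q.2))) (φ p) = fderiv ℝ φ p w := by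
  have hF : ContDiff ℝ ∞ (fun q : ℝ × E => φ (H (q.1, ψ q.2))) := by fun_prop
  have d1 : HasDerivAt (fun s : ℝ => φ (H (s, ψ (φ p))))
      (initialVelocity (fun q : ℝ × E => φ (H (q.1, ψ q.2))) (φ p)) 0 :=
    HasFDerivAt.comp_hasDerivAt (f := fun s : ℝ => (s, φ p)) (0 : ℝ)
      (hF.differentiable (by simp) _).hasFDerivAt
      ((hasDerivAt_id 0).prodMk (hasDerivAt_const 0 _))
  rw [hp] at d1
  have hφp : HasFDerivAt φ (fderiv ℝ φ p) (H (0, p)) := by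
    rw [hH0]; exact (hφ.differentiable (by simp) p).hasFDerivAt
  exact d1.unique (HasFDerivAt.comp_hasDerivAt (f := fun s : ℝ => H (s, p)) (0 : ℝ) hφp hw)

end Family

theorem isKillingOn_initialVelocity {g : BilinField}
    (hg : ContMDiff 𝓘(ℝ, E3) 𝓘(ℝ, E3 →L[ℝ] E3 →L[ℝ] ℝ) ∞ g) {F : ℝ × E3 → E3}
    (hF : ∀ p, ContDiffAt ℝ ∞ F (0, p)) (h0 : ∀ q, F (0, q) = q)
    (hinv : ∀ s, pullback (fun p : SOL => F (s, p)) g = g) :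
    IsKillingOn g univ (initialVelocity (E := E3) F) where
  smooth := (SOL.contMDiffOn_iff _ _).2 (contDiff_initialVelocity hF).contDiffOn
  lie_zero p _ v w := by
    have hg' := ((SOL.contMDiff_iff g).1 hg).differentiable (by simp)
    have key := lie_derivative_eq_zero_of_family (E := E3) (hg' p) (hF p) h0 (fun s v w =>
      (pullback_apply _ g p v w).symm.trans (congrArg (fun k : BilinField => k p v w) (hinv s))) v w
    have e1 : coordDeriv (initialVelocity (E := E3) F) p = _ := coordDeriv_eq_fderiv _ _
    rw [e1]
    exact (congrArg (fun L : E3 →L[ℝ] E3 →L[ℝ] E3 →L[ℝ] ℝ => L (initialVelocity (E := E3) F p) v w +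
      _ + _) (coordDeriv_eq_fderiv g p)).trans key

/-! ### The explicit isometries -/

/-- The composition of `(x, z, t) ↦ (e^s x, e^{-s} z, t + s)`, of
`(x, z, t) ↦ (x + c z + c² e^{-3t} / 6, z + c e^{-3t} / 3, t)` and of the translation by
`(a, b, 0)`. -/
noncomputable def waveIso (a c b s : ℝ) (p : SOL) : SOL :=
  ((Real.exp s * p.1 + c * Real.exp (-s) * p.2.1 +
      c ^ 2 / 6 * Real.exp (-3 * s) * Real.exp (-3 * p.2.2) + a,
    Real.exp (-s) * p.2.1 + c / 3 * Real.exp (-3 * s) * Real.exp (-3 * p.2.2) + b,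
    p.2.2 + s) : E3)

theorem hasFDerivAt_waveIso (a c b s : ℝ) (p : SOL) :
    HasFDerivAt (E := E3) (F := E3) (waveIso a c b s)
      ((Real.exp s • E3.x + (c * Real.exp (-s)) • E3.z -
          (c ^ 2 / 2 * Real.exp (-3 * s) * Real.exp (-3 * p.2.2)) • E3.t).prod
        ((Real.exp (-s) • E3.z - (c * Real.exp (-3 * s) * Real.exp (-3 * p.2.2)) • E3.t).prod E3.t))
      p := by
  refine (hasFDerivAt_triple (p := p)
    (((((E3.hasFDerivAt_x p).const_mul (Real.exp s)).add
      ((E3.hasFDerivAt_z p).const_mul (c * Real.exp (-s)))).add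
      ((E3.hasFDerivAt_exp (-3) p).const_mul (c ^ 2 / 6 * Real.exp (-3 * s)))).add_const a)
    ((((E3.hasFDerivAt_z p).const_mul (Real.exp (-s))).add
      ((E3.hasFDerivAt_exp (-3) p).const_mul (c / 3 * Real.exp (-3 * s)))).add_const b)
    ((E3.hasFDerivAt_t p).add_const s)).congr_fderiv ?_
  refine ContinuousLinearMap.ext fun v => ?_
  refine Prod.ext ?_ (Prod.ext ?_ rfl)
  · simp; ring
  · simp; ring

theorem fderiv_waveIso_apply (a c b s : ℝ) (p : SOL) (v : E3) :
    fderiv ℝ (E := E3) (F := E3) (waveIso a c b s) p v =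
      (Real.exp s * v.1 + c * Real.exp (-s) * v.2.1 -
          c ^ 2 / 2 * Real.exp (-3 * s) * Real.exp (-3 * p.2.2) * v.2.2,
        Real.exp (-s) * v.2.1 - c * Real.exp (-3 * s) * Real.exp (-3 * p.2.2) * v.2.2, v.2.2) := by
  rw [(hasFDerivAt_waveIso a c b s p).fderiv]
  rfl

theorem pullback_waveIso (a c b s : ℝ) : pullback (waveIso a c b s) lorentzSOL = lorentzSOL :=
  BilinField.ext fun p v w => by
    rw [pullback_apply, fderiv_waveIso_apply, fderiv_waveIso_apply, lorentzSOL_eq, waveMetric_apply,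
      waveMetric_apply]
    have ht : (waveIso a c b s p).2.2 = p.2.2 + s := rfl
    -- With `S = e⁻ˢ` and `T = e⁻ᵗ` all exponentials are powers of two variables, and the claim
    -- becomes a rational identity.
    set S := Real.exp (-s) with hS
    set T := Real.exp (-1 * p.2.2) with hT
    have hS0 : S ≠ 0 := (Real.exp_pos _).ne'
    have hT0 : T ≠ 0 := (Real.exp_pos _).ne'
    have e1 : Real.exp s = S⁻¹ := by rw [hS, Real.exp_neg, inv_inv]
    have e2 : Real.exp (-3 * s) = S ^ 3 := by
      rw [hS, ← Real.exp_nat_mul]; congr 1; push_cast; ring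
    have e3 : Real.exp (-3 * p.2.2) = T ^ 3 := by
      rw [hT, ← Real.exp_nat_mul]; congr 1; push_cast; ring
    have e4 : Real.exp (2 * p.2.2) = (T ^ 2)⁻¹ := by
      rw [hT, ← Real.exp_nat_mul, ← Real.exp_neg]; congr 1; push_cast; ring
    have e5 : Real.exp (-1 * (p.2.2 + s)) = T * S := by
      rw [hT, hS, ← Real.exp_add]; congr 1; ring
    have e6 : Real.exp (2 * (p.2.2 + s)) = (T ^ 2)⁻¹ * (S ^ 2)⁻¹ := by
      have e7 : Real.exp (2 * s) = (S ^ 2)⁻¹ := by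
        rw [hS, ← Real.exp_nat_mul, ← Real.exp_neg]; congr 1; push_cast; ring
      rw [mul_add, Real.exp_add, e4, e7]
    rw [ht, e1, e2, e3, e4, e5, e6]
    simp only []
    field_simp
    ring

/-- The infinitesimal isometries of the Lorentz-SOL metric. -/
noncomputable def waveField (a c b s : ℝ) (p : SOL) : E3 :=
  (s * p.1 + c * p.2.1 + a, -(s * p.2.1) + c / 3 * Real.exp (-3 * p.2.2) + b, s)

theorem contDiff_waveIso_family (a c b r : ℝ) : ContDiff ℝ ∞ (E := ℝ × E3) (F := E3)
    (fun q : ℝ × SOL => waveIso (q.1 * a) (q.1 * c) (q.1 * b) (q.1 * r) q.2) := by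
  change ContDiff ℝ ∞ (fun q : ℝ × E3 =>
    ((Real.exp (q.1 * r) * q.2.1 + q.1 * c * Real.exp (-(q.1 * r)) * q.2.2.1 +
      (q.1 * c) ^ 2 / 6 * Real.exp (-3 * (q.1 * r)) * Real.exp (-3 * q.2.2.2) + q.1 * a,
    Real.exp (-(q.1 * r)) * q.2.2.1 + q.1 * c / 3 * Real.exp (-3 * (q.1 * r)) *
      Real.exp (-3 * q.2.2.2) + q.1 * b, q.2.2.2 + q.1 * r) : E3))
  fun_prop

theorem waveIso_zero (p : SOL) : waveIso 0 0 0 0 p = p := by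
  refine Prod.ext ?_ (Prod.ext ?_ ?_) <;> simp [waveIso]

/-- The curve of parameters is a straight line and in general not a one-parameter group. Only its
velocity at `0` is used. -/
theorem hasDerivAt_waveIso_family (a c b r : ℝ) (p : SOL) : HasDerivAt (F := E3)
    (fun q : ℝ => waveIso (q * a) (q * c) (q * b) (q * r) p) (waveField a c b r p) 0 := by
  have hl : ∀ k : ℝ, HasDerivAt (fun q : ℝ => q * k) k 0 := fun k => by
    simpa using (hasDerivAt_id (0 : ℝ)).mul_const k
  have h1 := ((((hl r).exp.mul_const p.1).add (((hl c).mul (hl r).neg.exp).mul_const p.2.1)).add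
      ((((((hl c).pow 2).div_const 6)).mul ((hl r).const_mul (-3)).exp).mul_const
        (Real.exp (-3 * p.2.2)))).add (hl a)
  have h2 := (((hl r).neg.exp.mul_const p.2.1).add
      ((((hl c).div_const 3).mul ((hl r).const_mul (-3)).exp).mul_const
        (Real.exp (-3 * p.2.2)))).add (hl b)
  have h3 := (hl r).const_add p.2.2
  have h : HasDerivAt (F := E3)
    (fun q : ℝ => waveIso (q * a) (q * c) (q * b) (q * r) p) _ 0 := h1.prodMk (h2.prodMk h3)
  convert h using 1
  refine Prod.ext ?_ (Prod.ext ?_ rfl)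
  · simp [waveField]
  · simp [waveField]

/-! ### Classification of the isometries -/

/-- The last component of the image of an infinitesimal isometry under an isometry is constant. -/
theorem isometry_waveField_const {φ ψ : SOL → SOL} (hφ : ContDiff ℝ ∞ (E := E3) (F := E3) φ)
    (hψ : ContDiff ℝ ∞ (E := E3) (F := E3) ψ) (h1 : ∀ p, φ (ψ p) = p) (h2 : ∀ p, ψ (φ p) = p)
    (hφg : pullback φ lorentzSOL = lorentzSOL) (hψg : pullback ψ lorentzSOL = lorentzSOL)
    (a c b r : ℝ) : ∃ k : ℝ, ∀ p : SOL,
      (fderiv ℝ (E := E3) (F := E3) φ p (waveField a c b r p)).2.2 = k := by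
  let h : ℝ → SOL → SOL := fun s => waveIso (s * a) (s * c) (s * b) (s * r)
  let H : ℝ × E3 → E3 := fun q => h q.1 q.2
  let φ' : E3 → E3 := φ
  let ψ' : E3 → E3 := ψ
  let F : ℝ × E3 → E3 := fun q => φ' (H (q.1, ψ' q.2))
  have hφ0 : ContDiff ℝ ∞ φ' := hφ
  have hψ0 : ContDiff ℝ ∞ ψ' := hψ
  have hH : ContDiff ℝ ∞ H := contDiff_waveIso_family a c b r
  have hF : ContDiff ℝ ∞ F := by fun_prop
  have hH0 : ∀ q, H (0, q) = q := fun q => by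
    change waveIso (0 * a) (0 * c) (0 * b) (0 * r) q = q
    simp only [zero_mul]
    exact waveIso_zero q
  have h0 : ∀ q, F (0, q) = q := fun q => by
    change φ' (H (0, ψ' q)) = q
    rw [hH0]
    exact h1 q
  have hh : ∀ s, ContMDiff 𝓘(ℝ, E3) 𝓘(ℝ, E3) ∞ (h s) := fun s => by
    rw [SOL.contMDiff_self_iff]
    change ContDiff ℝ ∞ (fun q : E3 => H (s, q))
    fun_prop
  have hφ' := (SOL.contMDiff_self_iff φ).2 hφ
  have hψ' := (SOL.contMDiff_self_iff ψ).2 hψ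
  -- The family `F` is the conjugate by `φ` of a family of isometries, hence consists of isometries,
  -- and its velocity is a Killing field.
  have hinv : ∀ s, pullback (fun p : SOL => F (s, p)) lorentzSOL = lorentzSOL := fun s => by
    change pullback (φ ∘ (h s ∘ ψ)) lorentzSOL = lorentzSOL
    rw [pullback_comp _ _ hφ' ((hh s).comp hψ'), hφg, pullback_comp _ _ (hh s) hψ',
      pullback_waveIso, hψg]
  have hK := isKillingOn_initialVelocity isLorentzMetric_lorentzSOL.smooth
    (fun p => hF.contDiffAt) h0 hinv
  rw [lorentzSOL_eq] at hK
  obtain ⟨⟨-, -, hC⟩, -, hK⟩ := hK.wave_equations one_ne_zero isOpen_univ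
  have hconst : ∀ p q : E3, (initialVelocity F p).2.2 = (initialVelocity F q).2.2 := by
    refine is_const_of_fderiv_eq_zero (𝕜 := ℝ) ((contDiffOn_univ.1 hC).differentiable (by simp))
      fun p => ?_
    obtain ⟨⟨c1, c2, c3⟩, -⟩ := hK p (mem_univ _)
    exact E3.clm_ext c1 c2 c3
  refine ⟨(initialVelocity F 0).2.2, fun p => ?_⟩
  have e := initialVelocity_conj hφ0 hψ0 hH hH0 (h2 p) (hasDerivAt_waveIso_family a c b r p)
  exact (congrArg (fun u : E3 => u.2.2) e.symm).trans (hconst _ _)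

theorem eq_of_pd_eq_zero {f : E3 → ℝ} (hf : ContDiff ℝ ∞ f) (hx : ∀ p, pd E3.ex f p = 0)
    (hz : ∀ p, pd E3.ez f p = 0) (ht : ∀ p, pd E3.et f p = 0) (p q : E3) : f p = f q :=
  is_const_of_fderiv_eq_zero (𝕜 := ℝ) (hf.differentiable (by simp))
    (fun p => E3.clm_ext (hx p) (hz p) (ht p)) p q

set_option linter.unusedSimpArgs false in
open E3 in
/-- The isometries of the Lorentz-SOL metric are the maps `waveIso`, up to the reflection
`z ↦ -z`. -/
theorem exists_eq_waveIso {φ ψ : SOL → SOL} (hφ : ContDiff ℝ ∞ (E := E3) (F := E3) φ)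
    (hψ : ContDiff ℝ ∞ (E := E3) (F := E3) ψ) (h1 : ∀ p, φ (ψ p) = p) (h2 : ∀ p, ψ (φ p) = p)
    (hφg : pullback φ lorentzSOL = lorentzSOL) (hψg : pullback ψ lorentzSOL = lorentzSOL) :
    ∃ a c b s ε : ℝ, (ε = 1 ∨ ε = -1) ∧
      ∀ p : SOL, φ p = waveIso a c b s ((p.1, ε * p.2.1, p.2.2) : E3) := by
  let X : E3 → ℝ := fun q => (φ q).1
  let Z : E3 → ℝ := fun q => (φ q).2.1
  let τ : E3 → ℝ := fun q => (φ q).2.2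
  have hX : ContDiff ℝ ∞ X := contDiff_fst.comp hφ
  have hZ : ContDiff ℝ ∞ Z := contDiff_fst.comp (contDiff_snd.comp hφ)
  have hτ : ContDiff ℝ ∞ τ := contDiff_snd.comp (contDiff_snd.comp hφ)
  have hD : ∀ p e, fderiv ℝ (E := E3) (F := E3) φ p e = (pd e X p, pd e Z p, pd e τ p) := by
    intro p e
    have h : HasFDerivAt (E := E3) (F := E3) φ _ p :=
      hasFDerivAt_triple (hX.differentiable (by simp) p).hasFDerivAt
      (hZ.differentiable (by simp) p).hasFDerivAt (hτ.differentiable (by simp) p).hasFDerivAt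
    rw [h.fderiv]
    rfl
  have hX' := hX.contDiffOn (s := univ)
  have hZ' := hZ.contDiffOn (s := univ)
  have hτ' := hτ.contDiffOn (s := univ)
  -- the last component depends affinely on `t` only
  have hW : ∀ a c b r : ℝ, ∃ k : ℝ, ∀ p : E3, (r * p.1 + c * p.2.1 + a) * pd ex τ p +
      (-(r * p.2.1) + c / 3 * Real.exp (-3 * p.2.2) + b) * pd ez τ p + r * pd et τ p = k := by
    intro a c b r
    obtain ⟨k, hk⟩ := isometry_waveField_const hφ hψ h1 h2 hφg hψg a c b r
    refine ⟨k, fun p => ?_⟩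
    rw [← hk p, hD]
    change _ = fderiv ℝ τ p (waveField a c b r p)
    rw [E3.map_eq_comb]
    rfl
  -- The four fields are `∂x`, `∂z`, `z ∂x + (e⁻³ᵗ/3) ∂z` and `x ∂x - z ∂z + ∂t`.
  obtain ⟨k₁, hk₁⟩ := hW 1 0 0 0
  obtain ⟨k₂, hk₂⟩ := hW 0 0 1 0
  obtain ⟨k₃, hk₃⟩ := hW 0 1 0 0
  obtain ⟨k, hk⟩ := hW 0 0 0 1
  have τx' : ∀ p, pd ex τ p = k₁ := fun p => by rw [← hk₁ p]; ring
  have τz' : ∀ p, pd ez τ p = k₂ := fun p => by rw [← hk₂ p]; ring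
  simp only [τx', τz'] at hk₃
  -- The function `k₁ z + k₂ e⁻³ᵗ/3` is constant. Its values at the origin, `ez` and `et` force both
  -- coefficients to vanish.
  have hk10 : k₁ = 0 := by
    have e1 := hk₃ 0
    have e2 := hk₃ ez
    simp at e1 e2
    linarith
  have hk20 : k₂ = 0 := by
    have e1 := hk₃ 0
    have e2 := hk₃ et
    simp [hk10] at e1 e2
    rw [← e1] at e2
    have hne : Real.exp (-3) ≠ 1 := by
      rw [Ne, Real.exp_eq_one_iff]; norm_num
    have : (Real.exp (-3) - 1) * k₂ = 0 := by linarith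
    exact (mul_eq_zero.1 this).resolve_left (sub_ne_zero.2 hne)
  have τx : ∀ p, pd ex τ p = 0 := fun p => by rw [τx', hk10]
  have τz : ∀ p, pd ez τ p = 0 := fun p => by rw [τz', hk20]
  have τt : ∀ p, pd et τ p = k := fun p => by rw [← hk p, τx, τz]; ring
  set s := τ 0 with hs
  have hτeq : ∀ p, τ p = k * p.2.2 + s := by
    intro p
    have hf : ContDiff ℝ ∞ (fun p : E3 => τ p - k * p.2.2) := by fun_prop
    have hpd : ∀ e q, pd e (fun p : E3 => τ p - k * p.2.2) q = pd e τ q - k * e.2.2 := by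
      intro e q
      have h : HasFDerivAt (fun p : E3 => τ p - k * p.2.2) _ q :=
        (hτ.differentiable (by simp) q).hasFDerivAt.sub ((E3.hasFDerivAt_t q).const_mul k)
      rw [pd, h.fderiv]
      rfl
    have h := eq_of_pd_eq_zero hf (fun q => by rw [hpd, τx]; simp) (fun q => by rw [hpd, τz]; simp)
      (fun q => by rw [hpd, τt]; simp) p 0
    simp at h
    linarith
  -- the components of the isometry equation
  have hI0 : ∀ (p : SOL) (v w : E3), waveMetric 1 0 (φ p) (fderiv ℝ (E := E3) (F := E3) φ p v)
      (fderiv ℝ (E := E3) (F := E3) φ p w) = waveMetric 1 0 p v w := fun p v w => by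
    rw [← pullback_apply, ← lorentzSOL_eq, hφg]
  have hI : ∀ (p v w : E3), Real.exp (-1 * (k * p.2.2 + s)) *
      (pd v X p * pd w τ p + pd v τ p * pd w X p) +
      Real.exp (2 * (k * p.2.2 + s)) * (pd v Z p * pd w Z p) =
      Real.exp (-1 * p.2.2) * (v.1 * w.2.2 + v.2.2 * w.1) +
      Real.exp (2 * p.2.2) * (v.2.1 * w.2.1) := by
    intro p v w
    have h := (congrArg₂ (fun a b => waveMetric 1 0 (φ p) a b) (hD p v) (hD p w)).symm.trans
      (hI0 p v w)
    change 1 * Real.exp (-1 * τ p) * (pd v X p * pd w τ p + pd v τ p * pd w X p) +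
      1 * Real.exp (2 * τ p) * (pd v Z p * pd w Z p) + 0 * (pd v τ p * pd w τ p) =
      1 * Real.exp (-1 * p.2.2) * (v.1 * w.2.2 + v.2.2 * w.1) +
      1 * Real.exp (2 * p.2.2) * (v.2.1 * w.2.1) + 0 * (v.2.2 * w.2.2) at h
    rw [hτeq] at h
    linarith
  have Zx : ∀ p, pd ex Z p = 0 := by
    intro p
    have h := hI p ex ex
    simp only [τx, τz, τt, ex_x, ex_z, ex_t, ez_x, ez_z, ez_t, et_x, et_z, et_t] at h
    have : Real.exp (2 * (k * p.2.2 + s)) * (pd ex Z p * pd ex Z p) = 0 := by linarith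
    exact mul_self_eq_zero.1 ((mul_eq_zero.1 this).resolve_left (Real.exp_pos _).ne')
  have hXx : ∀ p, Real.exp (-1 * (k * p.2.2 + s)) * (k * pd ex X p) = Real.exp (-1 * p.2.2) := by
    intro p
    have h := hI p ex et
    simp only [τx, τz, τt, Zx, ex_x, ex_z, ex_t, ez_x, ez_z, ez_t, et_x, et_z, et_t] at h
    linarith
  have hk0 : k ≠ 0 := by
    rintro rfl
    have := hXx 0
    simp at this
  have hXt : ∀ p, Real.exp (-1 * (k * p.2.2 + s)) * (2 * k * pd et X p) =
      -(Real.exp (2 * (k * p.2.2 + s)) * (pd et Z p * pd et Z p)) := by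
    intro p
    have h := hI p et et
    simp only [τx, τz, τt, Zx, ex_x, ex_z, ex_t, ez_x, ez_z, ez_t, et_x, et_z, et_t] at h
    linarith
  have hZz : ∀ p, Real.exp (2 * (k * p.2.2 + s)) * (pd ez Z p * pd ez Z p) =
      Real.exp (2 * p.2.2) := by
    intro p
    have h := hI p ez ez
    simp only [τx, τz, τt, Zx, ex_x, ex_z, ex_t, ez_x, ez_z, ez_t, et_x, et_z, et_t] at h
    linarith
  have hXz : ∀ p, Real.exp (-1 * (k * p.2.2 + s)) * (k * pd ez X p) =
      -(Real.exp (2 * (k * p.2.2 + s)) * (pd ez Z p * pd et Z p)) := by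
    intro p
    have h := hI p ez et
    simp only [τx, τz, τt, Zx, ex_x, ex_z, ex_t, ez_x, ez_z, ez_t, et_x, et_z, et_t] at h
    linarith
  have hU := isOpen_univ (X := E3)
  have hZt' := contDiffOn_pd hU hZ' et
  have hZz' := contDiffOn_pd hU hZ' ez
  have Ztx : ∀ p, pd ex (pd et Z) p = 0 := fun p => by
    rw [pd_comm hU hZ' _ _ (mem_univ p), pd_congr hU (fun q _ => Zx q) _ (mem_univ p), pd_const]
  -- the factor of `t` is one
  have hexp : ∀ (p : E3), Real.exp (k * p.2.2 + s) * Real.exp (-1 * (k * p.2.2 + s)) = 1 :=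
    fun p => by rw [← Real.exp_add]; simp
  have hk1 : k = 1 := by
    have e1 : ∀ p ∈ univ, pd ex X p = (Real.exp s / k) * Real.exp ((k - 1) * p.2.2) := fun p _ => by
      have h := hXx p
      have h3 : Real.exp s * Real.exp ((k - 1) * p.2.2) =
          Real.exp (k * p.2.2 + s) * Real.exp (-1 * p.2.2) := by
        rw [← Real.exp_add, ← Real.exp_add]; congr 1; ring
      rw [div_mul_eq_mul_div, h3, ← h, eq_div_iff hk0]
      linear_combination (-k * pd ex X p) * hexp p
    have e2 : ∀ p ∈ univ, pd et X p = -(Real.exp (3 * s) / (2 * k)) *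
        (Real.exp (3 * k * p.2.2) * (pd et Z p * pd et Z p)) := fun p _ => by
      have h := hXt p
      have h3 : Real.exp (3 * s) * Real.exp (3 * k * p.2.2) =
          Real.exp (k * p.2.2 + s) * Real.exp (2 * (k * p.2.2 + s)) := by
        rw [← Real.exp_add, ← Real.exp_add]; congr 1; ring
      have h4 : pd et X p * (2 * k) = -(Real.exp (3 * s) * Real.exp (3 * k * p.2.2)) *
          (pd et Z p * pd et Z p) := by
        rw [h3]
        linear_combination Real.exp (k * p.2.2 + s) * h - (pd et X p * (2 * k)) * hexp p
      rw [eq_comm, neg_div', div_mul_eq_mul_div, div_eq_iff (mul_ne_zero two_ne_zero hk0), h4]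
      ring
    -- `X_x` is a nonzero constant times `e^((k-1)t)`, while `X_t` is independent of `x` because
    -- `Z_t` is. Equality of the mixed derivatives forces `k = 1`.
    have e := pd_comm hU hX' et ex (mem_univ 0)
    rw [pd_congr hU e1 _ (mem_univ _), pd_congr hU e2 _ (mem_univ _),
      pd_const_mul hU (contDiffOn_exp _ _) _ _ (mem_univ _), pd_exp,
      pd_const_mul hU ((contDiffOn_exp _ _).mul (hZt'.mul hZt')) _ _ (mem_univ _),
      pd_exp_mul hU (hZt'.mul hZt') _ _ (mem_univ _), pd_mul hU hZt' hZt' _ (mem_univ _), Ztx] at e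
    simp at e
    rcases e with h | h
    · exact absurd h hk0
    · linarith
  simp only [hk1, one_mul] at hXx hXt hZz hXz hexp hτeq
  -- the derivative of the second component in the direction of `z` is constant
  have hsq : ∀ p ∈ univ, pd ez Z p * pd ez Z p = Real.exp (-2 * s) := fun p _ => by
    have h := hZz p
    rw [mul_add, Real.exp_add, mul_assoc] at h
    have h := mul_left_cancel₀ (Real.exp_pos _).ne' (h.trans (mul_one _).symm)
    have e : Real.exp (2 * s) * Real.exp (-2 * s) = 1 := by rw [← Real.exp_add]; simp
    linear_combination Real.exp (-2 * s) * h - (pd ez Z p * pd ez Z p) * e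
  have Zz0 : ∀ p, pd ez Z p ≠ 0 := fun p h => by
    have := hsq p (mem_univ p)
    rw [h, mul_zero] at this
    exact (Real.exp_pos _).ne this
  -- The square of `Z_z` is a nonzero constant, so differentiating it shows that `Z_z` itself is
  -- constant, with a fixed sign.
  have Zze : ∀ e p, pd e (pd ez Z) p = 0 := fun e p => by
    have h := pd_congr hU hsq e (mem_univ p)
    rw [pd_const, pd_mul hU hZz' hZz' _ (mem_univ _)] at h
    have : pd ez Z p * pd e (pd ez Z) p = 0 := by linarith
    exact (mul_eq_zero.1 this).resolve_left (Zz0 p)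
  set ζ := pd ez Z 0 with hζ
  have hZz1 : ∀ p, pd ez Z p = ζ := fun p =>
    eq_of_pd_eq_zero (contDiffOn_univ.1 hZz') (Zze ex) (Zze ez) (Zze et) p 0
  have hζ0 : ζ ≠ 0 := Zz0 0
  have Ztz : ∀ p, pd ez (pd et Z) p = 0 := fun p => by
    rw [pd_comm hU hZ' _ _ (mem_univ p), Zze]
  -- `e^{3t} ∂Z/∂t` is constant
  have h3 : ∀ p : E3, Real.exp (3 * s) * Real.exp (3 * p.2.2) =
      Real.exp (p.2.2 + s) * Real.exp (2 * (p.2.2 + s)) := fun p => by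
    rw [← Real.exp_add, ← Real.exp_add]; congr 1; ring
  have Xz : ∀ p ∈ univ, pd ez X p = -(Real.exp (3 * s) * ζ) * (Real.exp (3 * p.2.2) * pd et Z p) :=
    fun p _ => by
      have h := hXz p
      rw [hZz1] at h
      linear_combination Real.exp (p.2.2 + s) * h - pd ez X p * hexp p + ζ * pd et Z p * h3 p
  have Xt : ∀ p ∈ univ, pd et X p = -(Real.exp (3 * s) / 2) *
      (Real.exp (3 * p.2.2) * (pd et Z p * pd et Z p)) := fun p _ => by
    have h := hXt p
    linear_combination Real.exp (p.2.2 + s) * h / 2 - pd et X p * hexp p +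
      pd et Z p * pd et Z p * h3 p / 2
  have Ztt : ∀ p, pd et (pd et Z) p = -3 * pd et Z p := fun p => by
    -- `X_t` does not depend on `z`, since `Z_t` does not. Hence `X_z`, a nonzero multiple of `e³ᵗ
    -- Z_t`, does not depend on `t`.
    have e := pd_comm hU hX' et ez (mem_univ p)
    rw [pd_congr hU Xz _ (mem_univ _), pd_congr hU Xt _ (mem_univ _),
      pd_const_mul hU ((contDiffOn_exp _ _).mul hZt') _ _ (mem_univ _),
      pd_exp_mul hU hZt' _ _ (mem_univ _),
      pd_const_mul hU ((contDiffOn_exp _ _).mul (hZt'.mul hZt')) _ _ (mem_univ _),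
      pd_exp_mul hU (hZt'.mul hZt') _ _ (mem_univ _), pd_mul hU hZt' hZt' _ (mem_univ _), Ztz] at e
    simp [hζ0] at e
    linarith
  set μ := pd et Z 0 with hμ
  have hZt : ∀ p, pd et Z p = μ * Real.exp (-3 * p.2.2) := fun p => by
    have hM := (contDiffOn_exp 3 univ).mul hZt'
    have e : ∀ e p, pd e (fun q => Real.exp (3 * q.2.2) * pd et Z q) p = _ :=
      fun e p => pd_exp_mul hU hZt' 3 e (mem_univ p)
    have h := eq_of_pd_eq_zero (contDiffOn_univ.1 hM) (fun p => by rw [e, Ztx]; simp)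
      (fun p => by rw [e, Ztz]; simp) (fun p => by rw [e, Ztt]; simp) p 0
    simp at h
    have hE : Real.exp (-3 * p.2.2) * Real.exp (3 * p.2.2) = 1 := by rw [← Real.exp_add]; simp
    linear_combination Real.exp (-3 * p.2.2) * h - pd et Z p * hE
  have hlin : ∀ (l m n : ℝ) (e p : E3), pd e (fun q => l * q.1 + m * q.2.1 +
      n * Real.exp (-3 * q.2.2)) p = l * e.1 + m * e.2.1 - 3 * n * Real.exp (-3 * p.2.2) * e.2.2 := by
    intro l m n e p
    have h : HasFDerivAt (fun q : E3 => l * q.1 + m * q.2.1 + n * Real.exp (-3 * q.2.2)) _ p :=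
      (((E3.hasFDerivAt_x p).const_mul l).add ((E3.hasFDerivAt_z p).const_mul m)).add
        ((E3.hasFDerivAt_exp (-3) p).const_mul n)
    rw [pd, h.fderiv]
    change l * e.1 + m * e.2.1 + n * (-3 * Real.exp (-3 * p.2.2) * e.2.2) = _
    ring
  have hlin' : ∀ (l m n : ℝ), ContDiff ℝ ∞ (fun q : E3 => l * q.1 + m * q.2.1 +
      n * Real.exp (-3 * q.2.2)) := fun l m n => by fun_prop
  have hint : ∀ {f : E3 → ℝ} (l m n : ℝ), ContDiff ℝ ∞ f → (∀ p, pd ex f p = l) →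
      (∀ p, pd ez f p = m) → (∀ p, pd et f p = -3 * n * Real.exp (-3 * p.2.2)) →
      ∃ d, ∀ p, f p = l * p.1 + m * p.2.1 + n * Real.exp (-3 * p.2.2) + d := by
    intro f l m n hf hx hz ht
    have e : ∀ e p, pd e (fun q => f q - (l * q.1 + m * q.2.1 + n * Real.exp (-3 * q.2.2))) p =
        pd e f p - (l * e.1 + m * e.2.1 - 3 * n * Real.exp (-3 * p.2.2) * e.2.2) := fun e p => by
      rw [pd_sub hU hf.contDiffOn (hlin' l m n).contDiffOn _ (mem_univ p), hlin]
    refine ⟨_, fun p => sub_eq_iff_eq_add'.1 (eq_of_pd_eq_zero (hf.sub (hlin' l m n))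
      (fun p => ?_) (fun p => ?_) (fun p => ?_) p 0)⟩
    · exact (e _ _).trans (by rw [hx]; simp)
    · exact (e _ _).trans (by rw [hz]; simp)
    · exact (e _ _).trans (by rw [ht]; simp)
  obtain ⟨b, hZeq⟩ := hint 0 ζ (-μ / 3) hZ Zx hZz1 (fun p => by rw [hZt]; ring)
  have Xx : ∀ p, pd ex X p = Real.exp s := fun p => by
    have h := hXx p
    have e : Real.exp (p.2.2 + s) * Real.exp (-1 * p.2.2) = Real.exp s := by
      rw [← Real.exp_add]; congr 1; ring
    linear_combination Real.exp (p.2.2 + s) * h - pd ex X p * hexp p + e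
  have hE : ∀ p : E3, Real.exp (3 * p.2.2) * Real.exp (-3 * p.2.2) = 1 := fun p => by
    rw [← Real.exp_add]; simp
  obtain ⟨a, hXeq⟩ := hint (Real.exp s) (-(Real.exp (3 * s) * ζ * μ))
    (Real.exp (3 * s) * μ ^ 2 / 6) hX Xx
    (fun p => by
      rw [Xz p (mem_univ p), hZt]
      linear_combination (-(Real.exp (3 * s) * ζ * μ)) * hE p)
    (fun p => by
      rw [Xt p (mem_univ p), hZt]
      linear_combination (-(Real.exp (3 * s) / 2) * μ ^ 2 * Real.exp (-3 * p.2.2)) * hE p)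
  have es1 : Real.exp s * Real.exp (-s) = 1 := by rw [← Real.exp_add]; simp
  have es3 : Real.exp (3 * s) * Real.exp (-3 * s) = 1 := by rw [← Real.exp_add]; simp
  have es2 : Real.exp (-2 * s) * (Real.exp s * Real.exp s) = 1 := by
    rw [← Real.exp_add, ← Real.exp_add]; ring_nf; simp
  -- Comparing the `e⁻³ᵗ` terms of the second component gives `c e⁻³ˢ = -μ`, and comparing the `z`
  -- terms gives `ε e⁻ˢ = ζ`. Then `ε² = 1` because `ζ² = e⁻²ˢ`.
  refine ⟨a, -(μ * Real.exp (3 * s)), b, s, Real.exp s * ζ, ?_, fun p => ?_⟩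
  · have h := hsq 0 (mem_univ 0)
    rw [hZz1] at h
    apply mul_self_eq_one_iff.1
    linear_combination (Real.exp s * Real.exp s) * h + es2
  · refine Prod.ext ?_ (Prod.ext ?_ ?_)
    · refine (hXeq p).trans ?_
      simp only [waveIso]
      linear_combination (Real.exp (3 * s) * μ * ζ * p.2.1) * es1 -
        (μ ^ 2 * Real.exp (3 * s) / 6 * Real.exp (-3 * p.2.2)) * es3
    · refine (hZeq p).trans ?_
      simp only [waveIso]
      linear_combination (-ζ * p.2.1) * es1 + (μ / 3 * Real.exp (-3 * p.2.2)) * es3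
    · exact hτeq p

/-! ### The topological group of isometries -/

/-- The parameters `(a, c, b, s)` of the isometries `waveIso`. -/
abbrev R4 : Type := ℝ × ℝ × ℝ × ℝ

/-- The isometry `waveIso` as a function of the vector of parameters. -/
noncomputable def waveMap (u : R4) (p : SOL) : SOL := waveIso u.1 u.2.1 u.2.2.1 u.2.2.2 p

/-- The composition law of the isometries `waveMap`. -/
noncomputable def R4.comp (u v : R4) : R4 :=
  (u.1 + Real.exp u.2.2.2 * v.1 + u.2.1 * Real.exp (-u.2.2.2) * v.2.2.1,
    u.2.1 + Real.exp (2 * u.2.2.2) * v.2.1, u.2.2.1 + Real.exp (-u.2.2.2) * v.2.2.1,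
    u.2.2.2 + v.2.2.2)

/-- The inversion law of the isometries `waveMap`. -/
noncomputable def R4.inverse (u : R4) : R4 :=
  (Real.exp (-u.2.2.2) * (-u.1 + u.2.1 * u.2.2.1), -(Real.exp (-(2 * u.2.2.2)) * u.2.1),
    -(Real.exp u.2.2.2 * u.2.2.1), -u.2.2.2)

theorem R4.comp_inverse (u : R4) : u.comp u.inverse = 0 := by
  have e1 : Real.exp u.2.2.2 * Real.exp (-u.2.2.2) = 1 := by rw [← Real.exp_add]; simp
  have e2 : Real.exp (2 * u.2.2.2) * Real.exp (-(2 * u.2.2.2)) = 1 := by rw [← Real.exp_add]; simp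
  refine Prod.ext ?_ (Prod.ext ?_ (Prod.ext ?_ ?_))
  · simp only [R4.comp, R4.inverse]
    simp only [Prod.fst_zero]
    linear_combination (-u.1) * e1
  · simp only [R4.comp, R4.inverse]
    simp only [Prod.fst_zero, Prod.snd_zero]
    linear_combination (-u.2.1) * e2
  · simp only [R4.comp, R4.inverse]
    simp only [Prod.fst_zero, Prod.snd_zero]
    linear_combination (-u.2.2.1) * e1
  · simp only [R4.comp, R4.inverse]
    simp

theorem R4.inverse_comp (u : R4) : u.inverse.comp u = 0 := by
  have e1 : Real.exp u.2.2.2 * Real.exp (-u.2.2.2) = 1 := by rw [← Real.exp_add]; simp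
  have e2 : Real.exp (-(2 * u.2.2.2)) = Real.exp (-u.2.2.2) * Real.exp (-u.2.2.2) := by
    rw [← Real.exp_add]; congr 1; ring
  have e3 : Real.exp (2 * -u.2.2.2) = Real.exp (-u.2.2.2) * Real.exp (-u.2.2.2) := by
    rw [← Real.exp_add]; congr 1; ring
  refine Prod.ext ?_ (Prod.ext ?_ (Prod.ext ?_ ?_))
  · simp only [R4.comp, R4.inverse, e2, e3, neg_neg]
    simp only [Prod.fst_zero]
    linear_combination (-Real.exp (-u.2.2.2) * u.2.1 * u.2.2.1) * e1
  · simp only [R4.comp, R4.inverse, e2, e3]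
    simp
  · simp only [R4.comp, R4.inverse]
    simp
  · simp only [R4.comp, R4.inverse]
    simp

theorem waveMap_comp (u v : R4) (p : SOL) : waveMap u (waveMap v p) = waveMap (u.comp v) p := by
  obtain ⟨a, c, b, s⟩ := u
  obtain ⟨a', c', b', s'⟩ := v
  have e1 : Real.exp (s + s') = Real.exp s * Real.exp s' := Real.exp_add _ _
  have e2 : Real.exp (-(s + s')) = Real.exp (-s) * Real.exp (-s') := by rw [neg_add, Real.exp_add]
  have e3 : Real.exp (-3 * (s + s')) = Real.exp (-3 * s) * Real.exp (-3 * s') := by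
    rw [mul_add, Real.exp_add]
  have e4 : Real.exp (-3 * (p.2.2 + s')) = Real.exp (-3 * p.2.2) * Real.exp (-3 * s') := by
    rw [mul_add, Real.exp_add]
  have e5 : Real.exp (2 * s) * Real.exp (-3 * s) = Real.exp (-s) := by
    rw [← Real.exp_add]; congr 1; ring
  have e6 : Real.exp (2 * s) * Real.exp (-s) = Real.exp s := by
    rw [← Real.exp_add]; congr 1; ring
  refine Prod.ext ?_ (Prod.ext ?_ ?_)
  · simp only [waveMap, waveIso, R4.comp, e1, e2, e3, e4]
    rw [← e6, ← e5]
    ring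
  · simp only [waveMap, waveIso, R4.comp, e1, e2, e3, e4]
    rw [← e5]
    ring
  · simp only [waveMap, waveIso, R4.comp]
    ring

theorem waveMap_zero (p : SOL) : waveMap 0 p = p := waveIso_zero p

theorem contDiff_waveMap_uncurry : ContDiff ℝ ∞ (E := R4 × E3) (F := E3)
    (fun q : R4 × SOL => waveMap q.1 q.2) := by
  change ContDiff ℝ ∞ (fun q : R4 × E3 =>
    ((Real.exp q.1.2.2.2 * q.2.1 + q.1.2.1 * Real.exp (-q.1.2.2.2) * q.2.2.1 +
      q.1.2.1 ^ 2 / 6 * Real.exp (-3 * q.1.2.2.2) * Real.exp (-3 * q.2.2.2) + q.1.1,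
    Real.exp (-q.1.2.2.2) * q.2.2.1 + q.1.2.1 / 3 * Real.exp (-3 * q.1.2.2.2) *
      Real.exp (-3 * q.2.2.2) + q.1.2.2.1, q.2.2.2 + q.1.2.2.2) : E3))
  fun_prop

theorem contMDiff_waveMap (u : R4) : ContMDiff 𝓘(ℝ, E3) 𝓘(ℝ, E3) ∞ (waveMap u) := by
  rw [SOL.contMDiff_self_iff]
  exact ContDiff.comp (E := E3) (F := R4 × E3) (G := E3) contDiff_waveMap_uncurry
    (contDiff_const.prodMk contDiff_id)

/-- The isometry of the Lorentz-SOL metric with given parameters. -/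
noncomputable def waveIsom (u : R4) : Isom lorentzSOL :=
  ⟨⟨waveMap u, waveMap u.inverse,
      fun p => by rw [waveMap_comp, R4.inverse_comp, waveMap_zero],
      fun p => by rw [waveMap_comp, R4.comp_inverse, waveMap_zero]⟩,
    contMDiff_waveMap u, contMDiff_waveMap u.inverse, pullback_waveIso _ _ _ _⟩

@[simp] theorem waveIsom_smul (u : R4) (p : SOL) : waveIsom u • p = waveMap u p := rfl

theorem Isom.ext {g : BilinField} {φ ψ : Isom g} (h : ∀ p : SOL, φ • p = ψ • p) : φ = ψ :=
  Subtype.ext (Equiv.ext h)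

theorem waveIsom_mul (u v : R4) : waveIsom u * waveIsom v = waveIsom (u.comp v) :=
  Isom.ext fun p => by rw [mul_smul, waveIsom_smul, waveIsom_smul, waveMap_comp, waveIsom_smul]

theorem waveIsom_zero : waveIsom 0 = 1 :=
  Isom.ext fun p => by rw [waveIsom_smul, waveMap_zero, one_smul]

theorem waveIsom_inv (u : R4) : (waveIsom u)⁻¹ = waveIsom u.inverse :=
  inv_eq_of_mul_eq_one_right (by rw [waveIsom_mul, R4.comp_inverse, waveIsom_zero])

theorem continuous_waveIsom : Continuous waveIsom := by
  have key : Continuous (fun u : R4 => Isom.toContinuousMap lorentzSOL (waveIsom u)) :=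
    ContinuousMap.continuous_of_continuous_uncurry _ contDiff_waveMap_uncurry.continuous
  have hinv : Continuous R4.inverse := by unfold R4.inverse; fun_prop
  refine continuous_induced_rng.2 (key.prodMk ?_)
  simp only [waveIsom_inv]
  exact key.comp hinv

theorem Isom.continuous_smul_const (g : BilinField) (p : SOL) :
    Continuous (fun φ : Isom g => φ • p) := by
  have hind : IsInducing (fun φ : Isom g =>
      (Isom.toContinuousMap g φ, Isom.toContinuousMap g φ⁻¹)) := ⟨rfl⟩
  have h1 : Continuous (fun φ : Isom g => Isom.toContinuousMap g φ) :=
    continuous_fst.comp hind.continuous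
  exact (continuous_eval_const (F := C(SOL, SOL)) p).comp h1

/-- The point `(0, 1, 0)` of `SOL`. -/
def SOL.zUnit : SOL := ((0, 1, 0) : E3)

/-- The point `(0, 0, 0)` of `SOL`. -/
def SOL.origin : SOL := ((0, 0, 0) : E3)

/-- The parameters of an isometry, recovered from the images of two points. -/
noncomputable def readParam (p q : E3) : R4 :=
  (p.1 - ((q.1 - p.1) * Real.exp p.2.2) ^ 2 / 6 * Real.exp (-3 * p.2.2),
    (q.1 - p.1) * Real.exp p.2.2,
    p.2.1 - (q.1 - p.1) * Real.exp p.2.2 / 3 * Real.exp (-3 * p.2.2), p.2.2)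

/-- The images of the origin and of `(0, 1, 0)` have last coordinate `s`, and their first
coordinates differ by `c e⁻ˢ`. Then `a` and `b` follow from the image of the origin. Evaluation at a
point is continuous in the compact-open topology, so the parameters are continuous functions of the
isometry. -/
theorem readParam_waveMap (u : R4) :
    readParam (waveMap u SOL.origin) (waveMap u SOL.zUnit) = u := by
  obtain ⟨a, c, b, s⟩ := u
  have e : Real.exp (-s) * Real.exp s = 1 := by rw [← Real.exp_add]; simp
  have hc : (c * Real.exp (-s)) * Real.exp s = c := by rw [mul_assoc, e, mul_one]
  have h1 : waveMap (a, c, b, s) SOL.origin =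
      ((c ^ 2 / 6 * Real.exp (-3 * s) + a, c / 3 * Real.exp (-3 * s) + b, s) : E3) := by
    refine Prod.ext ?_ (Prod.ext ?_ ?_) <;> simp [waveMap, waveIso, SOL.origin]
  have h2 : waveMap (a, c, b, s) SOL.zUnit = ((c * Real.exp (-s) + c ^ 2 / 6 * Real.exp (-3 * s) + a,
      Real.exp (-s) + c / 3 * Real.exp (-3 * s) + b, s) : E3) := by
    refine Prod.ext ?_ (Prod.ext ?_ ?_) <;> simp [waveMap, waveIso, SOL.zUnit]
  rw [h1, h2]
  have hd : c * Real.exp (-s) + c ^ 2 / 6 * Real.exp (-3 * s) + a -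
      (c ^ 2 / 6 * Real.exp (-3 * s) + a) = c * Real.exp (-s) := by ring
  simp only [readParam, hd, hc]
  simp

theorem waveMap_zUnit_sub (u : R4) :
    (waveMap u SOL.zUnit).2.1 - (waveMap u SOL.origin).2.1 = Real.exp (-u.2.2.2) := by
  simp [waveMap, waveIso, SOL.zUnit, SOL.origin]

/-- The action of an isometry on the orientation of the `z`-direction. -/
noncomputable def zOrientation (φ : Isom lorentzSOL) : ℝ :=
  (φ • SOL.zUnit).2.1 - (φ • SOL.origin).2.1

theorem zOrientation_waveIsom_pos (u : R4) : 0 < zOrientation (waveIsom u) :=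
  (Real.exp_pos _).trans_eq (waveMap_zUnit_sub u).symm

theorem continuous_coords {X : Type*} [TopologicalSpace X] {f : X → SOL} (hf : Continuous f) :
    Continuous (fun x => (f x).1) ∧ Continuous (fun x => (f x).2.1) ∧
      Continuous (fun x => (f x).2.2) := by
  have hf' : Continuous (Y := E3) f := hf
  exact ⟨continuous_fst.comp hf', continuous_fst.comp (continuous_snd.comp hf'),
    continuous_snd.comp (continuous_snd.comp hf')⟩

theorem continuous_zOrientation : Continuous zOrientation :=
  (continuous_coords (Isom.continuous_smul_const _ _)).2.1.sub
    (continuous_coords (Isom.continuous_smul_const _ _)).2.1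

/-- The value is `ε e⁻ˢ` in the classification of isometries, so it never vanishes and its sign is
`ε`. -/
theorem zOrientation_cases (φ : Isom lorentzSOL) :
    (0 < zOrientation φ ∧ φ ∈ range waveIsom) ∨ zOrientation φ < 0 := by
  obtain ⟨a, c, b, s, ε, hε, h⟩ := exists_eq_waveIso (φ := φ.1) (ψ := φ.1.symm)
    ((SOL.contMDiff_self_iff _).1 φ.2.1) ((SOL.contMDiff_self_iff _).1 φ.2.2.1)
    (fun p => φ.1.apply_symm_apply p) (fun p => φ.1.symm_apply_apply p) φ.2.2.2 (φ⁻¹).2.2.2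
  have h' : ∀ p : SOL, φ • p = waveMap (a, c, b, s) ((p.1, ε * p.2.1, p.2.2) : E3) := h
  rcases hε with rfl | rfl
  · left
    have : waveIsom (a, c, b, s) = φ := Isom.ext fun p => by
      rw [h', waveIsom_smul, one_mul]
      rfl
    refine ⟨?_, _, this⟩
    rw [← this]
    exact zOrientation_waveIsom_pos _
  · right
    rw [zOrientation, h', h']
    simp [waveMap, waveIso, SOL.zUnit, SOL.origin, Real.exp_pos]

/-- Isometries with positive `zOrientation` form a clopen set, since the value zero is excluded.
They are exactly the maps `waveIsom`, which form a connected set as a continuous image of `ℝ⁴`. -/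
theorem coe_connectedComponentOfOne :
    (Subgroup.connectedComponentOfOne (Isom lorentzSOL) : Set (Isom lorentzSOL)) =
      range waveIsom := by
  change connectedComponent (1 : Isom lorentzSOL) = _
  apply subset_antisymm
  · have hclopen : IsClopen {φ : Isom lorentzSOL | 0 < zOrientation φ} := by
      refine ⟨?_, isOpen_lt continuous_const continuous_zOrientation⟩
      have : {φ : Isom lorentzSOL | 0 < zOrientation φ} = {φ | 0 ≤ zOrientation φ} := by
        ext φ
        refine ⟨fun (h : 0 < zOrientation φ) => (h.le : 0 ≤ zOrientation φ), fun h => ?_⟩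
        exact ((zOrientation_cases φ).resolve_right (not_lt.2 h)).1
      rw [this]
      exact isClosed_le continuous_const continuous_zOrientation
    have h1 : (1 : Isom lorentzSOL) ∈ {φ : Isom lorentzSOL | 0 < zOrientation φ} := by
      rw [← waveIsom_zero]
      exact zOrientation_waveIsom_pos 0
    intro φ hφ
    have := hclopen.connectedComponent_subset h1 hφ
    exact ((zOrientation_cases φ).resolve_right (not_lt.2 (le_of_lt this))).2
  · exact (isPreconnected_range continuous_waveIsom).subset_connectedComponent ⟨0, waveIsom_zero⟩

theorem waveIsom_mem (u : R4) : waveIsom u ∈ Subgroup.connectedComponentOfOne (Isom lorentzSOL) := by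
  rw [← SetLike.mem_coe, coe_connectedComponentOfOne]
  exact mem_range_self u

/-- The identity component of the isometry group is parametrized by `ℝ⁴`. -/
noncomputable def isomZeroHomeo : IsomZero lorentzSOL ≃ₜ R4 where
  toFun h := readParam (h • SOL.origin) (h • SOL.zUnit)
  invFun u := ⟨waveIsom u, waveIsom_mem u⟩
  left_inv := by
    rintro ⟨φ, hφ⟩
    rw [← SetLike.mem_coe, coe_connectedComponentOfOne] at hφ
    obtain ⟨u, rfl⟩ := hφ
    refine Subtype.ext (congrArg waveIsom ?_)
    exact readParam_waveMap u
  right_inv u := readParam_waveMap u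
  continuous_toFun := by
    have h1 := continuous_coords ((Isom.continuous_smul_const lorentzSOL SOL.origin).comp
      (continuous_subtype_val (p := (· ∈ Subgroup.connectedComponentOfOne (Isom lorentzSOL)))))
    have h2 := continuous_coords ((Isom.continuous_smul_const lorentzSOL SOL.zUnit).comp
      (continuous_subtype_val (p := (· ∈ Subgroup.connectedComponentOfOne (Isom lorentzSOL)))))
    have hr : Continuous (fun q : E3 × E3 => readParam q.1 q.2) := by unfold readParam; fun_prop
    exact hr.comp ((h1.1.prodMk (h1.2.1.prodMk h1.2.2)).prodMk (h2.1.prodMk (h2.2.1.prodMk h2.2.2)))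
  continuous_invFun := continuous_waveIsom.subtype_mk waveIsom_mem

theorem isomZeroHomeo_symm_smul (u : R4) (p : SOL) : isomZeroHomeo.symm u • p = waveMap u p := rfl

theorem isomZero_smul (h : IsomZero lorentzSOL) (p : SOL) : h • p = waveMap (isomZeroHomeo h) p := by
  rw [← isomZeroHomeo_symm_smul, Homeomorph.symm_apply_apply]

theorem isomZeroHomeo_symm_mul (u v : R4) :
    isomZeroHomeo.symm u * isomZeroHomeo.symm v = isomZeroHomeo.symm (u.comp v) :=
  Subtype.ext (waveIsom_mul u v)

theorem isomZeroHomeo_symm_zero : isomZeroHomeo.symm 0 = 1 := Subtype.ext waveIsom_zero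

theorem isomZeroHomeo_one : isomZeroHomeo 1 = 0 := by
  rw [← isomZeroHomeo_symm_zero, Homeomorph.apply_symm_apply]

theorem isomZeroHomeo_mul (h k : IsomZero lorentzSOL) :
    isomZeroHomeo (h * k) = (isomZeroHomeo h).comp (isomZeroHomeo k) := by
  apply isomZeroHomeo.symm.injective
  rw [← isomZeroHomeo_symm_mul]
  simp only [Homeomorph.symm_apply_apply]

theorem isomZeroHomeo_inv (h : IsomZero lorentzSOL) :
    isomZeroHomeo h⁻¹ = (isomZeroHomeo h).inverse := by
  apply isomZeroHomeo.symm.injective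
  rw [Homeomorph.symm_apply_apply, inv_eq_iff_mul_eq_one]
  conv_lhs => rw [← isomZeroHomeo.symm_apply_apply h]
  rw [isomZeroHomeo_symm_mul, Homeomorph.apply_symm_apply, R4.comp_inverse, isomZeroHomeo_symm_zero]

/-! ### The Lie group structure -/

theorem contDiff_comp_uncurry : ContDiff ℝ ∞ (fun q : R4 × R4 => q.1.comp q.2) := by
  unfold R4.comp; fun_prop

theorem contDiff_inverse : ContDiff ℝ ∞ R4.inverse := by
  unfold R4.inverse; fun_prop

section SingleChart

variable {E X : Type*} [NormedAddCommGroup E] [NormedSpace ℝ E] [TopologicalSpace X]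

theorem contMDiff_singleton_chart [Nonempty X] (e : X ≃ₜ E) :
    letI := e.isOpenEmbedding.singletonChartedSpace
    ContMDiff 𝓘(ℝ, E) 𝓘(ℝ, E) ∞ e ∧ ContMDiff 𝓘(ℝ, E) 𝓘(ℝ, E) ∞ e.symm := by
  let _ := e.isOpenEmbedding.singletonChartedSpace
  refine ⟨contMDiff_isOpenEmbedding _, ?_⟩
  have h := contMDiffOn_isOpenEmbedding_symm (I := 𝓘(ℝ, E)) (n := ∞) e.isOpenEmbedding
  rw [e.surjective.range_eq, contMDiffOn_univ] at h
  convert h using 1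
  funext u
  apply e.injective
  rw [e.apply_symm_apply]
  exact (IsOpenEmbedding.toOpenPartialHomeomorph_right_inv e e.isOpenEmbedding
    (e.surjective.range_eq ▸ mem_univ u)).symm

theorem contMDiff_of_contDiff_prod {F G : Type*} [NormedAddCommGroup F] [NormedSpace ℝ F]
    [NormedAddCommGroup G] [NormedSpace ℝ G] {f : E × F → G} (hf : ContDiff ℝ ∞ f) :
    ContMDiff (𝓘(ℝ, E).prod 𝓘(ℝ, F)) 𝓘(ℝ, G) ∞ f := by
  have h := hf.contMDiff
  rw [modelWithCornersSelf_prod, ← chartedSpaceSelf_prod] at h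
  exact h

theorem contMDiff_comp_fst {H H' K : Type*} {E' E'' : Type*}
    [NormedAddCommGroup E'] [NormedSpace ℝ E'] [NormedAddCommGroup E''] [NormedSpace ℝ E'']
    [TopologicalSpace H] [TopologicalSpace H'] [TopologicalSpace K] {I : ModelWithCorners ℝ E H}
    {J : ModelWithCorners ℝ E' H'} {I' : ModelWithCorners ℝ E'' K} {M N P Q : Type*}
    [TopologicalSpace M] [ChartedSpace H M] [TopologicalSpace N] [ChartedSpace H' N]
    [TopologicalSpace P] [ChartedSpace K P] [TopologicalSpace Q] [ChartedSpace H Q]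
    {f : Q × N → P} {e : M → Q} (hf : ContMDiff (I.prod J) I' ∞ f) (he : ContMDiff I I ∞ e) :
    ContMDiff (I.prod J) I' ∞ (fun q : M × N => f (e q.1, q.2)) :=
  hf.comp ((he.comp contMDiff_fst).prodMk contMDiff_snd)

end SingleChart

theorem contDiff_waveMap_linear {F : Type*} [NormedAddCommGroup F] [NormedSpace ℝ F]
    (L : R4 ≃L[ℝ] F) :
    ContDiff ℝ ∞ (E := F × E3) (F := E3) (fun q : F × SOL => waveMap (L.symm q.1) q.2) := by
  have h : ContDiff ℝ ∞ (fun q : F × E3 => (L.symm q.1, q.2)) := by fun_prop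
  exact ContDiff.comp (E := F × E3) (F := R4 × E3) (G := E3) contDiff_waveMap_uncurry h

/-- The homeomorphism with `ℝ⁴` serves as the only chart, and in it multiplication, inversion and
the action are explicit smooth formulas. The map `L` merely replaces the product `R4` by the
Euclidean model space. -/
theorem isLieTransformationGroupOfDim_isomZero :
    IsLieTransformationGroupOfDim (IsomZero lorentzSOL) 4 := by
  let L : R4 ≃L[ℝ] EuclideanSpace ℝ (Fin 4) := ContinuousLinearEquiv.ofFinrankEq (by simp)
  let e : IsomZero lorentzSOL ≃ₜ EuclideanSpace ℝ (Fin 4) :=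
    isomZeroHomeo.trans L.toHomeomorph
  let cs : ChartedSpace (EuclideanSpace ℝ (Fin 4)) (IsomZero lorentzSOL) :=
    e.isOpenEmbedding.singletonChartedSpace
  have hm : IsManifold (𝓡 4) ∞ (IsomZero lorentzSOL) :=
    e.isOpenEmbedding.isManifold_singleton
  obtain ⟨he, he'⟩ : ContMDiff (𝓡 4) (𝓡 4) ∞ e ∧ ContMDiff (𝓡 4) (𝓡 4) ∞ e.symm :=
    contMDiff_singleton_chart e
  have hLs : ∀ h, L.symm (e h) = isomZeroHomeo h := fun h => L.symm_apply_apply _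
  refine ⟨cs, { __ := hm, contMDiff_mul := ?_, contMDiff_inv := ?_ }, ?_⟩
  · let m : EuclideanSpace ℝ (Fin 4) × EuclideanSpace ℝ (Fin 4) → EuclideanSpace ℝ (Fin 4) :=
      fun q => L ((L.symm q.1).comp (L.symm q.2))
    have hmd : ContDiff ℝ ∞ m := L.contDiff.comp (contDiff_comp_uncurry.comp
      ((L.symm.contDiff.comp contDiff_fst).prodMk (L.symm.contDiff.comp contDiff_snd)))
    have h : ContMDiff ((𝓡 4).prod (𝓡 4)) (𝓡 4) ∞
        (fun q : IsomZero lorentzSOL × IsomZero lorentzSOL => e.symm (m (e q.1, e q.2))) :=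
      he'.comp ((contMDiff_of_contDiff_prod hmd).comp
        ((he.comp contMDiff_fst).prodMk (he.comp contMDiff_snd)))
    convert h using 1
    funext q
    apply e.injective
    rw [e.apply_symm_apply]
    change L (isomZeroHomeo (q.1 * q.2)) = L ((L.symm (e q.1)).comp (L.symm (e q.2)))
    rw [hLs, hLs, isomZeroHomeo_mul]
  · let m : EuclideanSpace ℝ (Fin 4) → EuclideanSpace ℝ (Fin 4) := fun q => L (L.symm q).inverse
    have hmd : ContDiff ℝ ∞ m := L.contDiff.comp (contDiff_inverse.comp L.symm.contDiff)
    have h : ContMDiff (𝓡 4) (𝓡 4) ∞ (fun q : IsomZero lorentzSOL => e.symm (m (e q))) :=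
      he'.comp (hmd.contMDiff.comp he)
    convert h using 1
    funext q
    apply e.injective
    rw [e.apply_symm_apply]
    change L (isomZeroHomeo q⁻¹) = L (L.symm (e q)).inverse
    rw [hLs, isomZeroHomeo_inv]
  · let m : EuclideanSpace ℝ (Fin 4) × E3 → E3 := fun q => waveMap (L.symm q.1) q.2
    have hmd : ContDiff ℝ ∞ m := contDiff_waveMap_linear L
    have hm' : ContMDiff ((𝓡 4).prod 𝓘(ℝ, E3)) 𝓘(ℝ, E3) ∞
        (fun q : EuclideanSpace ℝ (Fin 4) × SOL => waveMap (L.symm q.1) q.2) :=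
      contMDiff_of_contDiff_prod hmd
    have h : ContMDiff ((𝓡 4).prod 𝓘(ℝ, E3)) 𝓘(ℝ, E3) ∞
        (fun q : IsomZero lorentzSOL × SOL => waveMap (L.symm (e q.1)) q.2) :=
      contMDiff_comp_fst hm' he
    convert h using 1
    funext q
    rw [hLs, isomZero_smul]

/-! ### The extension by the Heisenberg group -/

/-- The parameters of the image of an element of the Heisenberg group. -/
def heisParam (h : Heis) : R4 := (h.1, h.2.1, h.2.2, 0)

/-- At `s = 0` the exponentials in the composition law equal `1`, and what remains is the Heisenberg
product in `(a, c, b)`. -/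
theorem heisParam_mul (h k : Heis) : heisParam (h * k) = (heisParam h).comp (heisParam k) := by
  change ((h.1 + k.1 + h.2.1 * k.2.2, h.2.1 + k.2.1, h.2.2 + k.2.2, 0) : R4) = _
  simp only [heisParam, R4.comp]
  refine Prod.ext ?_ (Prod.ext ?_ (Prod.ext ?_ ?_)) <;> simp

theorem isClosedEmbedding_heisParam : IsClosedEmbedding heisParam := by
  have hc : Continuous (X := ℝ × ℝ × ℝ) heisParam := by
    change Continuous (fun h : ℝ × ℝ × ℝ => ((h.1, h.2.1, h.2.2, 0) : R4)); fun_prop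
  have hr : Continuous (Y := ℝ × ℝ × ℝ) (fun u : R4 => (u.1, u.2.1, u.2.2.1)) := by fun_prop
  have hl : Function.LeftInverse (fun u : R4 => ((u.1, u.2.1, u.2.2.1) : ℝ × ℝ × ℝ)) heisParam :=
    fun h => rfl
  exact Function.LeftInverse.isClosedEmbedding (X := R4) (Y := ℝ × ℝ × ℝ) hl hr hc

/-- The inclusion of the Heisenberg group in the isometry group. -/
noncomputable def heisToIsomZero : Heis →ₜ* IsomZero lorentzSOL where
  toFun h := isomZeroHomeo.symm (heisParam h)
  map_one' := isomZeroHomeo_symm_zero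
  map_mul' h k := by rw [heisParam_mul, isomZeroHomeo_symm_mul]
  continuous_toFun := isomZeroHomeo.symm.continuous.comp isClosedEmbedding_heisParam.continuous

/-- The action of the isometry group on the leaves `t = const`. -/
noncomputable def isomZeroToReal : IsomZero lorentzSOL →ₜ* Multiplicative ℝ where
  toFun h := Multiplicative.ofAdd (isomZeroHomeo h).2.2.2
  map_one' := by rw [isomZeroHomeo_one]; rfl
  map_mul' h k := by rw [isomZeroHomeo_mul]; rfl
  continuous_toFun := continuous_ofAdd.comp (continuous_snd.comp (continuous_snd.comp
    (continuous_snd.comp isomZeroHomeo.continuous)))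

theorem isClosedEmbedding_heisToIsomZero : IsClosedEmbedding heisToIsomZero :=
  isomZeroHomeo.symm.isClosedEmbedding.comp isClosedEmbedding_heisParam

/-- The one-parameter group with `a = c = b = 0` is a continuous section. -/
theorem isQuotientMap_isomZeroToReal : IsQuotientMap isomZeroToReal := by
  let σ : Multiplicative ℝ → IsomZero lorentzSOL :=
    fun s => isomZeroHomeo.symm (0, 0, 0, s.toAdd)
  have hσ : Continuous σ := isomZeroHomeo.symm.continuous.comp (by fun_prop)
  refine IsQuotientMap.of_inverse hσ isomZeroToReal.continuous_toFun fun s => ?_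
  change Multiplicative.ofAdd (isomZeroHomeo (isomZeroHomeo.symm (0, 0, 0, s.toAdd))).2.2.2 = s
  rw [Homeomorph.apply_symm_apply]
  rfl

theorem heisToIsomZero_range :
    heisToIsomZero.toMonoidHom.range = isomZeroToReal.toMonoidHom.ker := by
  ext h
  constructor
  · rintro ⟨k, rfl⟩
    change Multiplicative.ofAdd (isomZeroHomeo (isomZeroHomeo.symm (heisParam k))).2.2.2 = 1
    rw [Homeomorph.apply_symm_apply]
    rfl
  · intro hh
    have h0 : (isomZeroHomeo h).2.2.2 = 0 := hh
    let u := isomZeroHomeo h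
    refine ⟨((u.1, u.2.1, u.2.2.1) : ℝ × ℝ × ℝ), ?_⟩
    change isomZeroHomeo.symm (heisParam _) = h
    rw [Homeomorph.symm_apply_eq]
    exact Prod.ext rfl (Prod.ext rfl (Prod.ext rfl h0.symm))

/-- `Heis × ℝ` is two-step nilpotent, whereas conjugation by the isometry with `s = 1` multiplies
translations in `x` by `e`. The commutator of the two is the translation by `e - 1`, which does not
commute with that isometry. -/
theorem isEmpty_isomZero_mulEquiv : IsEmpty (IsomZero lorentzSOL ≃* Heis × Multiplicative ℝ) := by
  refine ⟨fun f => ?_⟩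
  let x := isomZeroHomeo.symm (0, 0, 0, 1)
  let y := isomZeroHomeo.symm (1, 0, 0, 0)
  -- the commutator of `x` and `y` commutes with `x` in a two-step nilpotent group
  have key : ∀ a b : Heis × Multiplicative ℝ,
      (a * b * a⁻¹ * b⁻¹) * a = a * (a * b * a⁻¹ * b⁻¹) := by
    intro a b
    refine Prod.ext ?_ (mul_comm _ _)
    obtain ⟨⟨a1, a2, a3⟩, a4⟩ := a
    obtain ⟨⟨b1, b2, b3⟩, b4⟩ := b
    refine Prod.ext ?_ (Prod.ext ?_ ?_)
    · change a1 + b1 + a2 * b3 + (-a1 + a2 * a3) + (a2 + b2) * -a3 + (-b1 + b2 * b3) +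
        (a2 + b2 + -a2) * -b3 + a1 + (a2 + b2 + -a2 + -b2) * a3 =
        a1 + (a1 + b1 + a2 * b3 + (-a1 + a2 * a3) + (a2 + b2) * -a3 + (-b1 + b2 * b3) +
        (a2 + b2 + -a2) * -b3) + a2 * (a3 + b3 + -a3 + -b3)
      ring
    · change a2 + b2 + -a2 + -b2 + a2 = a2 + (a2 + b2 + -a2 + -b2)
      ring
    · change a3 + b3 + -a3 + -b3 + a3 = a3 + (a3 + b3 + -a3 + -b3)
      ring
  have h : (x * y * x⁻¹ * y⁻¹) * x = x * (x * y * x⁻¹ * y⁻¹) := f.injective (by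
    simpa only [map_mul, map_inv] using key (f x) (f y))
  have h := congrArg (fun k => (isomZeroHomeo k).1) h
  simp only [isomZeroHomeo_mul, isomZeroHomeo_inv, x, y, Homeomorph.apply_symm_apply, R4.comp,
    R4.inverse] at h
  simp at h
  have e1 : 1 < Real.exp 1 := by simp
  nlinarith

theorem not_heis_transitive : ¬ ∀ p q : SOL, ∃ h : Heis, heisToIsomZero h • p = q := by
  intro H
  obtain ⟨h, hh⟩ := H SOL.origin ((0, 0, 1) : E3)
  have h1 := congrArg (fun p : SOL => p.2.2) hh
  have h2 : heisToIsomZero h • SOL.origin = waveMap (heisParam h) SOL.origin := rfl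
  rw [h2] at h1
  simp [waveMap, waveIso, heisParam, SOL.origin] at h1

/-! ### The isotropy groups -/

/-- The parameters of the elements of the stabilizer of a point. -/
noncomputable def isotropyParam (p : SOL) (c : ℝ) : R4 :=
  (-(c * p.2.1 + c ^ 2 / 6 * Real.exp (-3 * p.2.2)), c, -(c / 3 * Real.exp (-3 * p.2.2)), 0)

/-- Fixing the last coordinate forces `s = 0`. The translation part must then undo the displacement
of `p` by the shear, so `c` is the only free parameter. -/
theorem waveMap_eq_self_iff (u : R4) (p : SOL) :
    waveMap u p = p ↔ u = isotropyParam p u.2.1 := by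
  obtain ⟨a, c, b, s⟩ := u
  constructor
  · intro h
    have h3 : p.2.2 + s = p.2.2 := congrArg (fun p : SOL => p.2.2) h
    obtain rfl : s = 0 := by linarith
    have h1 := congrArg (fun p : SOL => p.1) h
    have h2 := congrArg (fun p : SOL => p.2.1) h
    simp only [waveMap, waveIso, neg_zero, mul_zero, Real.exp_zero] at h1 h2
    refine Prod.ext ?_ (Prod.ext rfl (Prod.ext ?_ rfl))
    · simp only [isotropyParam]; linarith
    · simp only [isotropyParam]; linarith
  · intro h
    rw [h]
    refine Prod.ext ?_ (Prod.ext ?_ ?_)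
    · simp only [waveMap, waveIso, isotropyParam, neg_zero, mul_zero, Real.exp_zero]; ring
    · simp only [waveMap, waveIso, isotropyParam, neg_zero, mul_zero, Real.exp_zero]; ring
    · simp [waveMap, waveIso, isotropyParam]

theorem isotropyParam_add (p : SOL) (c d : ℝ) :
    isotropyParam p (c + d) = (isotropyParam p c).comp (isotropyParam p d) := by
  simp only [isotropyParam, R4.comp, neg_zero, mul_zero, Real.exp_zero]
  refine Prod.ext ?_ (Prod.ext ?_ (Prod.ext ?_ ?_))
  · simp only []; ring
  · simp only []; ring
  · simp only []; ring
  · simp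

theorem continuous_isotropyParam (p : SOL) : Continuous (isotropyParam p) := by
  unfold isotropyParam; fun_prop

/-- The stabilizers are one-parameter groups. -/
noncomputable def stabilizerEquiv (p : SOL) :
    MulAction.stabilizer (IsomZero lorentzSOL) p ≃ₜ* Multiplicative ℝ where
  toFun h := Multiplicative.ofAdd (isomZeroHomeo h.1).2.1
  invFun c := ⟨isomZeroHomeo.symm (isotropyParam p c.toAdd), by
    rw [MulAction.mem_stabilizer_iff, isomZeroHomeo_symm_smul, waveMap_eq_self_iff]
    rfl⟩
  left_inv := by
    rintro ⟨h, hh⟩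
    rw [MulAction.mem_stabilizer_iff, isomZero_smul, waveMap_eq_self_iff] at hh
    refine Subtype.ext ?_
    change isomZeroHomeo.symm (isotropyParam p (isomZeroHomeo h).2.1) = h
    rw [← hh, Homeomorph.symm_apply_apply]
  right_inv c := by
    change Multiplicative.ofAdd
      (isomZeroHomeo (isomZeroHomeo.symm (isotropyParam p c.toAdd))).2.1 = c
    rw [Homeomorph.apply_symm_apply]
    rfl
  map_mul' := by
    rintro ⟨h, hh⟩ ⟨k, hk⟩
    rw [MulAction.mem_stabilizer_iff, isomZero_smul, waveMap_eq_self_iff] at hh hk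
    change Multiplicative.ofAdd (isomZeroHomeo (h * k)).2.1 =
      Multiplicative.ofAdd ((isomZeroHomeo h).2.1 + (isomZeroHomeo k).2.1)
    rw [isomZeroHomeo_mul, hh, hk, ← isotropyParam_add]
    rfl
  continuous_toFun := continuous_ofAdd.comp (continuous_fst.comp (continuous_snd.comp
    (isomZeroHomeo.continuous.comp continuous_subtype_val)))
  continuous_invFun := (isomZeroHomeo.symm.continuous.comp
    ((continuous_isotropyParam p).comp continuous_toAdd)).subtype_mk _

theorem fderiv_waveMap_isotropyParam (p : SOL) (c : ℝ) (v : E3) :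
    fderiv ℝ (E := E3) (F := E3) (waveMap (isotropyParam p c)) p v =
      (v.1 + c * v.2.1 - c ^ 2 / 2 * Real.exp (-3 * p.2.2) * v.2.2,
        v.2.1 - c * Real.exp (-3 * p.2.2) * v.2.2, v.2.2) := by
  refine (fderiv_waveIso_apply _ _ _ _ _ _).trans ?_
  simp [isotropyParam]

theorem isNilpotent_tangentMapAt_sub_one (p : SOL) (h : IsomZero lorentzSOL)
    (hh : h ∈ MulAction.stabilizer (IsomZero lorentzSOL) p) :
    IsNilpotent (tangentMapAt (fun q => h • q) p - 1) := by
  rw [MulAction.mem_stabilizer_iff, isomZero_smul, waveMap_eq_self_iff] at hh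
  have hf : (fun q : SOL => h • q) = waveMap (isotropyParam p (isomZeroHomeo h).2.1) := by
    funext q; rw [isomZero_smul, ← hh]
  set c := (isomZeroHomeo h).2.1
  have hN : ∀ v : E3, (tangentMapAt (fun q => h • q) p - 1) v =
      (c * v.2.1 - c ^ 2 / 2 * Real.exp (-3 * p.2.2) * v.2.2,
        -(c * Real.exp (-3 * p.2.2) * v.2.2), 0) := by
    intro v
    rw [hf, tangentMapAt_eq_fderiv]
    refine (congrArg (· - v) (fderiv_waveMap_isotropyParam p c v)).trans ?_
    refine Prod.ext ?_ (Prod.ext ?_ ?_) <;> (simp; try ring)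
  -- The map is strictly triangular for the flag `ℝX ⊂ ℝX ⊕ ℝZ`, whence the exponent `3`.
  refine ⟨3, ContinuousLinearMap.ext fun v => ?_⟩
  set N := tangentMapAt (fun q => h • q) p - 1
  change N (N (N v)) = 0
  simp [hN]

/-! ### The geometry of the isometry group -/

theorem pullback_isomZero (h : IsomZero lorentzSOL) :
    pullback (fun p => h • p) lorentzSOL = lorentzSOL := h.1.2.2.2

theorem isPretransitive_isomZero : MulAction.IsPretransitive (IsomZero lorentzSOL) SOL := by
  have h0 : ∀ p : SOL, isomZeroHomeo.symm (p.1, 0, p.2.1, p.2.2) • SOL.origin = p := fun p => by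
    rw [isomZeroHomeo_symm_smul]
    refine Prod.ext ?_ (Prod.ext ?_ ?_) <;> simp [waveMap, waveIso, SOL.origin]
  exact (MulAction.isPretransitive_iff_base SOL.origin).2 fun p => ⟨_, h0 p⟩

theorem isLorentzGeometry_isomZero : IsLorentzGeometry (IsomZero lorentzSOL) where
  transitive := isPretransitive_isomZero
  simplyConnected := inferInstanceAs (SimplyConnectedSpace E3)
  lorentz := ⟨lorentzSOL, isLorentzMetric_lorentzSOL, pullback_isomZero⟩

/-- The isotropy relations satisfied by an invariant field of bilinear forms. -/
theorem IsInvariantUnder.apply_isotropy {g : BilinField}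
    (hg : IsInvariantUnder (IsomZero lorentzSOL) g) (c : ℝ) (p : SOL) (v w : E3) :
    g p (v.1 + c * v.2.1 - c ^ 2 / 2 * Real.exp (-3 * p.2.2) * v.2.2,
        v.2.1 - c * Real.exp (-3 * p.2.2) * v.2.2, v.2.2)
      (w.1 + c * w.2.1 - c ^ 2 / 2 * Real.exp (-3 * p.2.2) * w.2.2,
        w.2.1 - c * Real.exp (-3 * p.2.2) * w.2.2, w.2.2) = g p v w := by
  have h := congrArg (fun k : BilinField => k p v w)
    (hg (isomZeroHomeo.symm (isotropyParam p c)))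
  have hf : (fun q : SOL => isomZeroHomeo.symm (isotropyParam p c) • q) =
      waveMap (isotropyParam p c) := rfl
  have hp : waveMap (isotropyParam p c) p = p := by rw [waveMap_eq_self_iff]; rfl
  rw [hf] at h
  simp only [pullback_apply, fderiv_waveMap_isotropyParam, hp] at h
  exact h

/-- The isotropy at the identity moves `Z` to `Z + c X` for every `c`. An invariant metric would
give these vectors the same length, but the square of the length is quadratic in `c` with leading
coefficient `r(X, X) > 0`. The values `c = ±1` suffice for a contradiction. -/
theorem isNonRiemannian_isomZero : IsNonRiemannian (IsomZero lorentzSOL) := by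
  rintro ⟨r, hr, hinv⟩
  have key : ∀ c : ℝ, r 1 (c, 1, 0) (c, 1, 0) = r 1 E3.ez E3.ez := fun c => by
    have := hinv.apply_isotropy c 1 E3.ez E3.ez
    simpa using this
  have hx : 0 < r 1 E3.ex E3.ex := hr.pos 1 _ fun h => one_ne_zero (congrArg (fun u : E3 => u.1) h)
  have e : ∀ c : ℝ, r 1 (c, 1, 0) (c, 1, 0) =
      c ^ 2 * r 1 E3.ex E3.ex + 2 * c * r 1 E3.ex E3.ez + r 1 E3.ez E3.ez := fun c => by
    rw [E3.map_eq_comb (r 1 (c, 1, 0)), E3.map_eq_comb (r 1)]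
    simp only [add_apply, smul_apply, smul_eq_mul, hr.symm 1 E3.ez E3.ex]
    ring
  have k1 := (e 1).symm.trans (key 1)
  have k2 := (e (-1)).symm.trans (key (-1))
  linarith

/-! ### Smooth actions of Lie groups on vector spaces -/

section LieAction

variable {E H G F : Type*} [NormedAddCommGroup E] [NormedSpace ℝ E] [TopologicalSpace H]
  {I : ModelWithCorners ℝ E H} [TopologicalSpace G] [ChartedSpace H G] [Group G] [MulAction G F]

variable (I) in
/-- A smooth action, written in the chart at the identity. -/
noncomputable def chartAction (G : Type*) [TopologicalSpace G] [ChartedSpace H G] [Group G]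
    [MulAction G F] (q : E × F) : F := (extChartAt I (1 : G)).symm q.1 • q.2

variable (I G) in
theorem chartAction_one (p : F) : chartAction I G (extChartAt I (1 : G) 1, p) = p := by
  rw [chartAction, extChartAt_to_inv, one_smul]

variable [NormedAddCommGroup F] [NormedSpace ℝ F]

theorem contMDiff_orbitMap
    (hs : ContMDiff (I.prod 𝓘(ℝ, F)) 𝓘(ℝ, F) ∞ (fun q : G × F => q.1 • q.2)) (p : F) :
    ContMDiff I 𝓘(ℝ, F) ∞ (fun h : G => h • p) :=
  hs.comp (contMDiff_id.prodMk contMDiff_const)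

theorem contMDiff_smul_left
    (hs : ContMDiff (I.prod 𝓘(ℝ, F)) 𝓘(ℝ, F) ∞ (fun q : G × F => q.1 • q.2)) (h : G) :
    ContMDiff 𝓘(ℝ, F) 𝓘(ℝ, F) ∞ (fun p : F => h • p) :=
  hs.comp (contMDiff_const.prodMk contMDiff_id)

variable [LieGroup I ∞ G]

/-- If a tangent vector at the identity acts trivially, then so do its left translates. -/
theorem mfderiv_orbitMap_mulInvariantVectorField
    (hs : ContMDiff (I.prod 𝓘(ℝ, F)) 𝓘(ℝ, F) ∞ (fun q : G × F => q.1 • q.2))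
    {v : GroupLieAlgebra I G} {p : F}
    (hv : mfderiv I 𝓘(ℝ, F) (fun h : G => h • p) 1 v = 0) (h : G) :
    mfderiv I 𝓘(ℝ, F) (fun h : G => h • p) h (mulInvariantVectorField v h) = 0 := by
  have hdm : MDifferentiableAt I I (fun k : G => h * k) 1 :=
    (contMDiff_mul_left (I := I) (n := ∞)).mdifferentiableAt (by simp)
  have hdo : ∀ k, MDifferentiableAt I 𝓘(ℝ, F) (fun h : G => h • p) k := fun k =>
    (contMDiff_orbitMap hs p).mdifferentiableAt (by simp)
  have hda : MDifferentiableAt 𝓘(ℝ, F) 𝓘(ℝ, F) (fun q : F => h • q) ((1 : G) • p) :=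
    (contMDiff_smul_left hs h).mdifferentiableAt (by simp)
  -- The orbit map of `p` intertwines left translation by `h` with the action of `h`. Differentiate
  -- both sides at `1`.
  have e : (fun h : G => h • p) ∘ (fun k => h * k) = (fun q : F => h • q) ∘ (fun k : G => k • p) :=
    funext fun k => mul_smul h k p
  have c1 := mfderiv_comp (1 : G) (hdo (h * 1)) hdm
  have c2 := mfderiv_comp (1 : G) hda (hdo 1)
  rw [e, c2] at c1
  have c3 := congrArg (fun L : E →L[ℝ] F => L v) c1
  have c4 : mfderiv I 𝓘(ℝ, F) (fun h : G => h • p) (h * 1) (mulInvariantVectorField v h) = 0 := by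
    refine Eq.trans c3.symm ?_
    refine (congrArg (mfderiv 𝓘(ℝ, F) 𝓘(ℝ, F) (fun q : F => h • q) ((1 : G) • p)) hv).trans ?_
    exact map_zero _
  -- The chain rule yields the derivative at `h * 1`, which is equal to `h` only propositionally.
  have h1 : ∀ k, k = h → ∀ w : E, (mfderiv I 𝓘(ℝ, F) (fun h : G => h • p) k : E →L[ℝ] F) w = 0 →
      (mfderiv I 𝓘(ℝ, F) (fun h : G => h • p) h : E →L[ℝ] F) w = 0 := by
    rintro k rfl w hw; exact hw
  exact h1 _ (mul_one h) _ c4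

variable [I.Boundaryless]

/-- A tangent vector at the identity which acts trivially vanishes if the action is faithful. -/
theorem eq_zero_of_mfderiv_orbitMap_eq_zero [CompleteSpace E] [FaithfulSMul G F]
    (hs : ContMDiff (I.prod 𝓘(ℝ, F)) 𝓘(ℝ, F) ∞ (fun q : G × F => q.1 • q.2))
    {v : GroupLieAlgebra I G} (hv : ∀ p : F, mfderiv I 𝓘(ℝ, F) (fun h : G => h • p) 1 v = 0) :
    v = 0 := by
  have h3 : minSmoothness ℝ 3 ≤ (∞ : ℕ∞ω) := by
    rw [minSmoothness_of_isRCLikeNormedField]; exact WithTop.coe_le_coe.2 (le_top : (3 : ℕ∞) ≤ ⊤)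
  have h2 : (1 : ℕ∞ω) ≤ minSmoothness ℝ 2 := by
    rw [minSmoothness_of_isRCLikeNormedField]; exact one_le_two
  have : LieGroup I (minSmoothness ℝ 3) G := LieGroup.of_le h3
  have : IsManifold I ∞ G := inferInstance
  have : IsManifold I 1 G := IsManifold.of_le (n := ∞) (by simp)
  -- Along an integral curve `γ` of the left-invariant field of `v` through `1`, every orbit map has
  -- zero derivative. So each `γ s` near `0` acts trivially, faithfulness makes `γ` locally
  -- constant, and its velocity `v` at `0` vanishes.
  obtain ⟨γ, hγ0, hγ⟩ := exists_isMIntegralCurveAt_of_contMDiffAt_boundaryless (I := I) 0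
    (((contMDiff_mulInvariantVectorField v).of_le h2).contMDiffAt (x := (1 : G)))
  obtain ⟨ε, hε, hball⟩ := Metric.eventually_nhds_iff_ball.1 hγ
  have hconst : ∀ s ∈ Metric.ball (0 : ℝ) ε, γ s = 1 := by
    intro s hs'
    apply FaithfulSMul.eq_of_smul_eq_smul (α := F)
    intro p
    have hd : ∀ r ∈ Metric.ball (0 : ℝ) ε, HasFDerivAt (fun r => γ r • p) (0 : ℝ →L[ℝ] F) r := by
      intro r hr
      have h1 := ((contMDiff_orbitMap hs p).mdifferentiableAt (by simp) (x := γ r)).hasMFDerivAt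
      have h2 : HasMFDerivAt 𝓘(ℝ, ℝ) 𝓘(ℝ, F) (fun r => γ r • p) r _ := h1.comp r (hball r hr)
      refine h2.hasFDerivAt.congr_fderiv ?_
      refine ContinuousLinearMap.ext fun (a : ℝ) => Eq.symm ?_
      have h4 := mfderiv_orbitMap_mulInvariantVectorField hs (hv p) (γ r)
      have h5 : ∀ (L : E →L[ℝ] F) (w : E), L w = 0 → (0 : F) = L (a • w) := fun L w hw => by
        rw [map_smul, hw, smul_zero]
      exact h5 _ _ h4
    have := (convex_ball (0 : ℝ) ε).is_const_of_fderivWithin_eq_zero (𝕜 := ℝ)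
      (f := fun r => γ r • p) (fun r hr => (hd r hr).differentiableAt.differentiableWithinAt)
      (fun r hr => by
        rw [fderivWithin_of_isOpen Metric.isOpen_ball hr, (hd r hr).fderiv]) hs'
      (Metric.mem_ball_self hε)
    rw [this, hγ0]
  have hev : γ =ᶠ[𝓝 0] fun _ => 1 :=
    Filter.eventually_of_mem (Metric.ball_mem_nhds 0 hε) hconst
  have d1 := hball 0 (Metric.mem_ball_self hε)
  have d2 : HasMFDerivAt 𝓘(ℝ, ℝ) I γ 0 _ :=
    (hasMFDerivAt_const (1 : G) (0 : ℝ)).congr_of_eventuallyEq hev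
  have d3 := hasMFDerivAt_unique d1 d2
  have d4 := congrArg (fun L : ℝ →L[ℝ] E => L 1) d3
  have d5 : mulInvariantVectorField v (γ 0) = 0 := by
    refine Eq.trans ?_ d4
    exact (one_smul ℝ _).symm
  have h6 : (fun k : G => 1 * k) = id := funext one_mul
  have h7 : ∀ w : E, (mfderiv I I (fun k : G => 1 * k) (1 : G) : E →L[ℝ] E) w = w := by
    intro w; rw [h6, mfderiv_id]; rfl
  have h8 : ∀ k : G, k = 1 → (mulInvariantVectorField v k : E) = 0 → (v : E) = 0 := by
    rintro k rfl hk
    exact (h7 v).symm.trans hk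
  exact h8 _ hγ0 d5

/-- The statement is local in the group variable because the inverse chart is meaningful only on its
target, a neighbourhood of the image of `1`. -/
theorem contDiffAt_chartAction
    (hs : ContMDiff (I.prod 𝓘(ℝ, F)) 𝓘(ℝ, F) ∞ (fun q : G × F => q.1 • q.2)) (p : F) :
    ContDiffAt ℝ ∞ (chartAction I G) (extChartAt I (1 : G) 1, p) := by
  have : IsManifold I ∞ G := inferInstance
  have h1 : ContMDiffAt 𝓘(ℝ, E) I ∞ (extChartAt I (1 : G)).symm (extChartAt I (1 : G) 1) :=
    (contMDiffOn_extChartAt_symm (1 : G)).contMDiffAt (extChartAt_target_mem_nhds (1 : G))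
  have h2 : ContMDiffAt 𝓘(ℝ, E × F) 𝓘(ℝ, E) ∞ (Prod.fst : E × F → E)
      (extChartAt I (1 : G) 1, p) := contDiffAt_fst.contMDiffAt
  have h3 : ContMDiffAt 𝓘(ℝ, E × F) 𝓘(ℝ, F) ∞ (Prod.snd : E × F → F)
      (extChartAt I (1 : G) 1, p) := contDiffAt_snd.contMDiffAt
  have h4 : ContMDiffAt 𝓘(ℝ, E × F) 𝓘(ℝ, F) ∞ (chartAction I G (F := F))
      (extChartAt I (1 : G) 1, p) :=
    hs.contMDiffAt.comp (extChartAt I (1 : G) 1, p)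
      ((ContMDiffAt.comp (g := (extChartAt I (1 : G)).symm) (f := Prod.fst)
        (extChartAt I (1 : G) 1, p) h1 h2).prodMk h3)
  exact h4.contDiffAt

/-- The infinitesimal action of a tangent vector at the identity. -/
theorem mfderiv_orbitMap_one
    (hs : ContMDiff (I.prod 𝓘(ℝ, F)) 𝓘(ℝ, F) ∞ (fun q : G × F => q.1 • q.2)) (p : F) (v : E) :
    (mfderiv I 𝓘(ℝ, F) (fun h : G => h • p) 1 : E →L[ℝ] F) v =
      fderiv ℝ (chartAction I G) (extChartAt I (1 : G) 1, p) (v, 0) := by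
  have h1 := ((contDiffAt_chartAction hs p).differentiableAt (by simp)).hasFDerivAt
  have e : HasFDerivAt (fun y : E => (y, p)) (ContinuousLinearMap.inl ℝ E F)
      (extChartAt I (1 : G) 1) := (hasFDerivAt_id _).prodMk (hasFDerivAt_const p _)
  have h2 : HasFDerivAt (fun y : E => chartAction I G (y, p)) _ (extChartAt I (1 : G) 1) :=
    HasFDerivAt.comp (g := chartAction I G) (extChartAt I (1 : G) 1) h1 e
  have h3 : MDifferentiableAt I 𝓘(ℝ, F) (fun h : G => h • p) 1 :=
    (contMDiff_orbitMap hs p).mdifferentiableAt (by simp)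
  have h4 : mfderiv I 𝓘(ℝ, F) (fun h : G => h • p) 1 =
      fderivWithin ℝ (fun y : E => chartAction I G (y, p)) (range I) (extChartAt I (1 : G) 1) := by
    rw [h3.mfderiv]; rfl
  rw [h4, I.range_eq_univ, fderivWithin_univ, h2.fderiv]
  rfl

theorem initialVelocity_chartAction
    (hs : ContMDiff (I.prod 𝓘(ℝ, F)) 𝓘(ℝ, F) ∞ (fun q : G × F => q.1 • q.2)) (p : F) (v : E) :
    initialVelocity (fun q : ℝ × F => chartAction I G (extChartAt I (1 : G) 1 + q.1 • v, q.2)) p =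
      fderiv ℝ (chartAction I G) (extChartAt I (1 : G) 1, p) (v, 0) := by
  have h1 : HasFDerivAt (chartAction I G) (fderiv ℝ (chartAction I G) (extChartAt I (1 : G) 1, p))
      (extChartAt I (1 : G) 1 + (0 : ℝ) • v, p) := by
    rw [zero_smul, add_zero]
    exact ((contDiffAt_chartAction hs p).differentiableAt (by simp)).hasFDerivAt
  have e : HasFDerivAt (fun q : ℝ × F => (extChartAt I (1 : G) 1 + q.1 • v, q.2))
      (((ContinuousLinearMap.fst ℝ ℝ F).smulRight v).prod (ContinuousLinearMap.snd ℝ ℝ F))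
      ((0 : ℝ), p) :=
    ((hasFDerivAt_fst.smul_const v).const_add _).prodMk hasFDerivAt_snd
  have h2 : HasFDerivAt
      (fun q : ℝ × F => chartAction I G (extChartAt I (1 : G) 1 + q.1 • v, q.2)) _ ((0 : ℝ), p) :=
    HasFDerivAt.comp (g := chartAction I G)
      (f := fun q : ℝ × F => (extChartAt I (1 : G) 1 + q.1 • v, q.2)) ((0 : ℝ), p) h1 e
  rw [initialVelocity, h2.fderiv]
  simp

theorem contDiffAt_chartAction_line
    (hs : ContMDiff (I.prod 𝓘(ℝ, F)) 𝓘(ℝ, F) ∞ (fun q : G × F => q.1 • q.2)) (p : F) (v : E) :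
    ContDiffAt ℝ ∞ (fun q : ℝ × F => chartAction I G (extChartAt I (1 : G) 1 + q.1 • v, q.2))
      (0, p) := by
  have h1 : ContDiffAt ℝ ∞ (chartAction I G) (extChartAt I (1 : G) 1 + (0 : ℝ) • v, p) := by
    rw [zero_smul, add_zero]
    exact contDiffAt_chartAction hs p
  have e : ContDiffAt ℝ ∞ (fun q : ℝ × F => (extChartAt I (1 : G) 1 + q.1 • v, q.2)) (0, p) := by
    fun_prop
  exact ContDiffAt.comp (g := chartAction I G)
    (f := fun q : ℝ × F => (extChartAt I (1 : G) 1 + q.1 • v, q.2)) ((0 : ℝ), p) h1 e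

variable (I) in
/-- The infinitesimal action at `p`. -/
noncomputable def infinitesimalAction (G : Type*) [TopologicalSpace G] [ChartedSpace H G] [Group G]
    [MulAction G F] (p : F) : E →L[ℝ] F :=
  (fderiv ℝ (chartAction I G) (extChartAt I (1 : G) 1, p)).comp (ContinuousLinearMap.inl ℝ E F)

theorem differentiable_infinitesimalAction
    (hs : ContMDiff (I.prod 𝓘(ℝ, F)) 𝓘(ℝ, F) ∞ (fun q : G × F => q.1 • q.2)) :
    Differentiable ℝ (infinitesimalAction I G (F := F)) := by
  intro p
  have h1 : ContDiffAt ℝ ∞ (fderiv ℝ (chartAction I G (F := F))) (extChartAt I (1 : G) 1, p) :=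
    (contDiffAt_chartAction hs p).fderiv_right (by simp)
  have e : DifferentiableAt ℝ (fun q : F => (extChartAt I (1 : G) 1, q)) p := by fun_prop
  have h2 : DifferentiableAt ℝ
      (fun q : F => fderiv ℝ (chartAction I G) (extChartAt I (1 : G) 1, q)) p :=
    DifferentiableAt.comp (g := fderiv ℝ (chartAction I G)) p (h1.differentiableAt (by simp)) e
  exact h2.clm_comp (differentiableAt_const _)

/-- If the group is large, then there is a nontrivial one-parameter family of group elements whose
initial velocity vanishes at a given point, together with one entry of its derivative. -/
theorem exists_family_of_finrank_lt [FiniteDimensional ℝ E] [FiniteDimensional ℝ F]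
    [FaithfulSMul G F]
    (hs : ContMDiff (I.prod 𝓘(ℝ, F)) 𝓘(ℝ, F) ∞ (fun q : G × F => q.1 • q.2))
    (hd : Module.finrank ℝ F + 1 < Module.finrank ℝ E) (o e : F) (l : F →L[ℝ] ℝ) :
    ∃ Φ : ℝ × F → F, (∀ p, ContDiffAt ℝ ∞ Φ (0, p)) ∧ (∀ p, Φ (0, p) = p) ∧
      (∀ s, ∃ h : G, ∀ p, Φ (s, p) = h • p) ∧ initialVelocity Φ o = 0 ∧
      l (fderiv ℝ (initialVelocity Φ) o e) = 0 ∧ ∃ p, initialVelocity Φ p ≠ 0 := by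
  have : CompleteSpace E := FiniteDimensional.complete ℝ E
  have hW := differentiable_infinitesimalAction hs
  set W : F → E →L[ℝ] F := infinitesimalAction I G
  -- The conditions on the velocity field are linear in the tangent vector at the identity. There
  -- are `dim F + 1` of them, so a larger group has a nonzero tangent vector satisfying all.
  let Ψ : E →ₗ[ℝ] F × ℝ := ((W o).prod (l.comp (fderiv ℝ W o e))).toLinearMap
  have hker : LinearMap.ker Ψ ≠ ⊥ := by
    apply LinearMap.ker_ne_bot_of_finrank_lt
    simpa using hd
  obtain ⟨v, hv, hv0⟩ := (Submodule.ne_bot_iff _).1 hker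
  have hv1 : W o v = 0 := congrArg Prod.fst (LinearMap.mem_ker.1 hv)
  have hv2 : l (fderiv ℝ W o e v) = 0 := congrArg Prod.snd (LinearMap.mem_ker.1 hv)
  have hV := fun p => initialVelocity_chartAction hs p v
  refine ⟨fun q => chartAction I G (extChartAt I (1 : G) 1 + q.1 • v, q.2),
    fun p => contDiffAt_chartAction_line hs p v, fun p => ?_,
    fun s => ⟨(extChartAt I (1 : G)).symm (extChartAt I (1 : G) 1 + s • v), fun p => rfl⟩,
    (hV o).trans hv1, ?_, ?_⟩
  · simp only [zero_smul, add_zero, chartAction_one]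
  · have h : HasFDerivAt (fun p => W p v) _ o :=
      (hW o).hasFDerivAt.clm_apply (hasFDerivAt_const v o)
    have hV' : initialVelocity (fun q : ℝ × F =>
      chartAction I G (extChartAt I (1 : G) 1 + q.1 • v, q.2)) = fun p => W p v := funext hV
    rw [hV', h.fderiv]
    simpa using hv2
  · by_contra! h
    exact hv0 (eq_zero_of_mfderiv_orbitMap_eq_zero hs fun p =>
      (mfderiv_orbitMap_one hs p v).trans ((hV p).symm.trans (h p)))

end LieAction

/-! ### Maximality -/

/-- The left translations of `SOL` belong to the identity component of the isometry group. -/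
theorem isomZeroHomeo_symm_smul_eq_mul (a p : SOL) :
    isomZeroHomeo.symm (a.1, 0, a.2.1, a.2.2) • p = a * p := by
  rw [isomZeroHomeo_symm_smul]
  refine Prod.ext ?_ (Prod.ext ?_ ?_)
  · change Real.exp a.2.2 * p.1 + 0 * Real.exp (-a.2.2) * p.2.1 +
      0 ^ 2 / 6 * Real.exp (-3 * a.2.2) * Real.exp (-3 * p.2.2) + a.1 = a.1 + Real.exp a.2.2 * p.1
    ring
  · change Real.exp (-a.2.2) * p.2.1 + 0 / 3 * Real.exp (-3 * a.2.2) * Real.exp (-3 * p.2.2) +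
      a.2.1 = a.2.1 + Real.exp (-a.2.2) * p.2.1
    ring
  · exact add_comm _ _

theorem IsInvariantUnder.isLeftInvariant {g : BilinField}
    (hg : IsInvariantUnder (IsomZero lorentzSOL) g) : IsLeftInvariant g := fun a => by
  have h := hg (isomZeroHomeo.symm (a.1, 0, a.2.1, a.2.2))
  have e : (fun p : SOL => isomZeroHomeo.symm (a.1, 0, a.2.1, a.2.2) • p) = fun p => a * p :=
    funext (isomZeroHomeo_symm_smul_eq_mul a)
  rwa [e] at h

theorem isLeftInvariant_waveMetric (α β : ℝ) : IsLeftInvariant (waveMetric α β) := by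
  have h : waveMetric α β = leftInvariantExtension (waveMetric α β 1) :=
    BilinField.ext fun p v w => by
      rw [leftInvariantExtension_apply, waveMetric_apply, waveMetric_apply, exp_two_mul']
      simp only [leftDiff_apply, neg_neg, neg_one_mul, SOL.one_def]
      simp
      ring
  rw [h]
  exact isLeftInvariant_leftInvariantExtension _

/-- The Lorentz metrics invariant under the isometries of the Lorentz-SOL metric. -/
theorem IsInvariantUnder.exists_eq_waveMetric {g : BilinField} (hL : IsLorentzMetric g)
    (hg : IsInvariantUnder (IsomZero lorentzSOL) g) :
    ∃ α β : ℝ, α ≠ 0 ∧ g = waveMetric α β := by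
  have hB := hL.form 1
  have key : ∀ (c : ℝ) (v w : E3), g 1 (v.1 + c * v.2.1 - c ^ 2 / 2 * v.2.2,
      v.2.1 - c * v.2.2, v.2.2) (w.1 + c * w.2.1 - c ^ 2 / 2 * w.2.2,
        w.2.1 - c * w.2.2, w.2.2) = g 1 v w := fun c v w => by
    have h := hg.apply_isotropy c 1 v w
    simpa [SOL.one_def] using h
  have s1 := hB.symm E3.ez E3.ex
  have s2 := hB.symm E3.et E3.ex
  have s3 := hB.symm E3.et E3.ez
  have expand : ∀ v w : E3, g 1 v w = v.1 * w.1 * g 1 E3.ex E3.ex +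
      (v.1 * w.2.1 + v.2.1 * w.1) * g 1 E3.ex E3.ez + (v.1 * w.2.2 + v.2.2 * w.1) * g 1 E3.ex E3.et +
      v.2.1 * w.2.1 * g 1 E3.ez E3.ez + (v.2.1 * w.2.2 + v.2.2 * w.2.1) * g 1 E3.ez E3.et +
      v.2.2 * w.2.2 * g 1 E3.et E3.et := fun v w => by
    rw [E3.map_eq_comb (g 1 v), E3.map_eq_comb (g 1)]
    simp only [add_apply, smul_apply, smul_eq_mul, s1, s2, s3]
    ring
  -- Invariance under the unipotent isotropy `X ↦ X`, `Z ↦ Z + c X`, `T ↦ T - c Z - (c²/2) X`. The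
  -- pair `(Z, Z)` gives `g(X,X) = g(X,Z) = 0`, then `(Z, T)` gives `g(X,T) = g(Z,Z)`, and finally
  -- `(T, T)` gives `g(Z,T) = 0`.
  have zz : ∀ c, _ := fun c => (expand _ _).symm.trans (key c E3.ez E3.ez)
  have zt : ∀ c, _ := fun c => (expand _ _).symm.trans (key c E3.ez E3.et)
  have tt : ∀ c, _ := fun c => (expand _ _).symm.trans (key c E3.et E3.et)
  simp at zz zt tt
  have a1 := zz 1
  have a2 := zz (-1)
  have hxx : g 1 E3.ex E3.ex = 0 := by linarith
  have hxz : g 1 E3.ex E3.ez = 0 := by linarith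
  have b1 := zt 1
  rw [hxx, hxz] at b1
  have hxt : g 1 E3.ex E3.et = g 1 E3.ez E3.ez := by linarith
  have c1 := tt 1
  rw [hxx, hxz, hxt] at c1
  have hzt : g 1 E3.ez E3.et = 0 := by linarith
  refine ⟨g 1 E3.ez E3.ez, g 1 E3.et E3.et, fun h0 => ?_,
    hg.isLeftInvariant.eq_of_apply_one (isLeftInvariant_waveMetric _ _) fun v w => ?_⟩
  · have : E3.ex = 0 := hB.eq_zero fun w => by
      rw [expand, hxx, hxz, hxt, h0]
      simp
    exact one_ne_zero (congrArg (fun u : E3 => u.1) this)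
  · rw [expand, waveMetric_apply, hxx, hxz, hxt, hzt]
    have e1 : (1 : SOL).2.2 = 0 := rfl
    rw [e1]
    simp
    ring

/-- A Killing field is determined by four of the entries of its first jet at the origin. -/
theorem IsKillingOn.eq_zero {α β : ℝ} (hα : α ≠ 0) {V : SOL → E3}
    (hV : IsKillingOn (waveMetric α β) univ V) (h0 : V SOL.origin = 0)
    (h1 : (fderiv ℝ (E := E3) V SOL.origin E3.et).2.1 = 0) (p : SOL) : V p = 0 := by
  obtain ⟨⟨hA, hB, hC⟩, hD, hK⟩ := hV.wave_equations hα isOpen_univ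
  set A : E3 → ℝ := fun q => (V q).1
  set B : E3 → ℝ := fun q => (V q).2.1
  set C : E3 → ℝ := fun q => (V q).2.2
  have hBt := contDiffOn_pd isOpen_univ hB E3.et
  have hC0 : ∀ q, C q = 0 := fun q =>
    (eq_of_pd_eq_zero (contDiffOn_univ.1 hC) (fun q => (hK q (mem_univ q)).1.1)
      (fun q => (hK q (mem_univ q)).1.2.1) (fun q => (hK q (mem_univ q)).1.2.2) q SOL.origin).trans
      (congrArg (fun u : E3 => u.2.2) h0)
  have hBx : ∀ q, pd E3.ex B q = 0 := fun q => (hK q (mem_univ q)).2.2.1.1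
  have hBz : ∀ q, pd E3.ez B q = 0 := fun q => by
    rw [(hK q (mem_univ q)).2.2.1.2, hC0, neg_zero]
  -- The equation `B_tt = -3 B_t` makes `e³ᵗ B_t` constant, and the last hypothesis says that it
  -- vanishes at the origin.
  have hf0 : ∀ q, Real.exp (3 * q.2.2) * pd E3.et B q = 0 := fun q => by
    have hmixed : ∀ e : E3, (∀ q, pd e B q = 0) → ∀ q, pd e (pd E3.et B) q = 0 := fun e he q => by
      rw [pd_comm isOpen_univ hB _ _ (mem_univ q),
        pd_congr isOpen_univ (fun q _ => he q) _ (mem_univ q), pd_const]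
    refine (eq_of_pd_eq_zero (contDiffOn_univ.1 ((contDiffOn_exp 3 univ).mul hBt))
      (fun q => ?_) (fun q => ?_) (fun q => ?_) q SOL.origin).trans ?_
    · refine (pd_exp_mul isOpen_univ hBt 3 E3.ex (mem_univ q)).trans ?_
      rw [hmixed _ hBx]; simp
    · refine (pd_exp_mul isOpen_univ hBt 3 E3.ez (mem_univ q)).trans ?_
      rw [hmixed _ hBz]; simp
    · refine (pd_exp_mul isOpen_univ hBt 3 E3.et (mem_univ q)).trans ?_
      rw [(hK q (mem_univ q)).2.2.2.2]; simp
    · have e : pd E3.et B SOL.origin = 0 := by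
        rw [hD _ (mem_univ _)] at h1
        exact h1
      refine (congrArg (Real.exp _ * ·) e).trans (mul_zero _)
  have hBt0 : ∀ q, pd E3.et B q = 0 := fun q =>
    (mul_eq_zero.1 (hf0 q)).resolve_left (Real.exp_pos _).ne'
  have hB0 : ∀ q, B q = 0 := fun q =>
    (eq_of_pd_eq_zero (contDiffOn_univ.1 hB) hBx hBz hBt0 q SOL.origin).trans
      (congrArg (fun u : E3 => u.2.1) h0)
  have hA0 : ∀ q, A q = 0 := fun q =>
    (eq_of_pd_eq_zero (contDiffOn_univ.1 hA)
      (fun q => (hK q (mem_univ q)).2.1.1.trans (hC0 q))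
      (fun q => by rw [(hK q (mem_univ q)).2.2.2.1, hf0, neg_zero])
      (fun q => (hK q (mem_univ q)).2.1.2) q SOL.origin).trans
      (congrArg (fun u : E3 => u.1) h0)
  exact Prod.ext (hA0 p) (Prod.ext (hB0 p) (hC0 p))

/-- If the dimension exceeded `4 = 3 + 1`, some nonzero tangent vector at the identity would induce
a Killing field vanishing at the origin together with the `z`-entry of its `t`-derivative. By
`IsKillingOn.eq_zero` that field is zero, against faithfulness. The Killing equations are available
because the metric preserved by the larger group is also invariant under `IsomZero lorentzSOL`,
hence is a `waveMetric`. -/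
theorem isMaximalGeometry_isomZero : IsMaximalGeometry (IsomZero lorentzSOL) 4 := by
  intro n G _ _ _ _ _ _ hs hg hι
  obtain ⟨g, hL, hinv⟩ := hg
  obtain ⟨ι, hι⟩ := hι
  by_contra hn
  rw [not_le] at hn
  have hinv0 : IsInvariantUnder (IsomZero lorentzSOL) g := fun h => by
    have := hinv (ι h)
    have e : (fun p : SOL => ι h • p) = fun p => h • p := funext (hι h)
    rwa [e] at this
  obtain ⟨α, β, hα, rfl⟩ := hinv0.exists_eq_waveMetric hL
  let _ : MulAction G E3 := inferInstanceAs (MulAction G SOL)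
  have : FaithfulSMul G E3 := inferInstanceAs (FaithfulSMul G SOL)
  have hs' : ContMDiff ((𝓡 n).prod 𝓘(ℝ, E3)) 𝓘(ℝ, E3) ∞ (fun q : G × E3 => q.1 • q.2) := hs
  obtain ⟨Φ, hΦ, hΦ0, hΦG, h0, h1, p, hp⟩ := exists_family_of_finrank_lt hs'
    (by simpa using hn) (0 : E3) E3.et E3.z
  have hK := isKillingOn_initialVelocity hL.smooth hΦ hΦ0 fun s => by
    obtain ⟨h, hh⟩ := hΦG s
    have e : (fun p : SOL => Φ (s, p)) = fun p => h • p := funext hh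
    rw [e]
    exact hinv h
  exact hp (hK.eq_zero hα h0 h1 p)

theorem mainTheorem6 :
    -- the metric is a left-invariant Lorentz metric with the two properties ...
    (IsLorentzMetric lorentzSOL ∧ IsLeftInvariant lorentzSOL ∧
      DerivedDegenerate lorentzSOL ∧ EigendirectionIsotropic lorentzSOL) ∧
    -- ... and, up to automorphism, the only one
    (∀ g : BilinField, IsLorentzMetric g → IsLeftInvariant g →
      DerivedDegenerate g → EigendirectionIsotropic g →
      ∃ φ : SOL ≃* SOL, ContMDiff 𝓘(ℝ, E3) 𝓘(ℝ, E3) ∞ φ ∧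
        ContMDiff 𝓘(ℝ, E3) 𝓘(ℝ, E3) ∞ φ.symm ∧ pullback φ lorentzSOL = g) ∧
    -- the identity component of the isometry group has dimension 4
    IsLieTransformationGroupOfDim (IsomZero lorentzSOL) 4 ∧
    -- it is a nontrivial extension of Heis, and Heis does not act transitively
    (∃ (ι : Heis →ₜ* IsomZero lorentzSOL) (π : IsomZero lorentzSOL →ₜ* Multiplicative ℝ),
      IsClosedEmbedding ι ∧ IsQuotientMap π ∧ ι.toMonoidHom.range = π.toMonoidHom.ker ∧
      IsEmpty (IsomZero lorentzSOL ≃* Heis × Multiplicative ℝ) ∧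
      ¬ ∀ p q : SOL, ∃ h : Heis, ι h • p = q) ∧
    -- its isotropy groups are non-compact unipotent one-parameter groups
    (∀ p : SOL,
      Nonempty (MulAction.stabilizer (IsomZero lorentzSOL) p ≃ₜ* Multiplicative ℝ) ∧
      ∀ h ∈ MulAction.stabilizer (IsomZero lorentzSOL) p,
        IsNilpotent (tangentMapAt (fun q => h • q) p - 1)) ∧
    -- the local isotropy algebra is a line spanned by a nilpotent endomorphism
    (∀ p : SOL, ∃ N : E3 →L[ℝ] E3, N ≠ 0 ∧ IsNilpotent N ∧
      localIsotropyAlgebra lorentzSOL p = {A | ∃ c : ℝ, A = c • N}) ∧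
    -- the metric is not flat
    ¬ IsFlat lorentzSOL ∧
    -- it defines a maximal non-Riemannian Lorentz geometry
    IsLorentzGeometry (IsomZero lorentzSOL) ∧
    IsNonRiemannian (IsomZero lorentzSOL) ∧
    IsMaximalGeometry (IsomZero lorentzSOL) 4 := by
  exact ⟨⟨isLorentzMetric_lorentzSOL, isLeftInvariant_lorentzSOL, derivedDegenerate_lorentzSOL,
      eigendirectionIsotropic_lorentzSOL⟩,
    fun _ hL hg hd hi => exists_aut_pullback_eq hL hg hd hi,
    isLieTransformationGroupOfDim_isomZero,
    ⟨heisToIsomZero, isomZeroToReal, isClosedEmbedding_heisToIsomZero,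
      isQuotientMap_isomZeroToReal, heisToIsomZero_range, isEmpty_isomZero_mulEquiv,
      not_heis_transitive⟩,
    fun p => ⟨⟨stabilizerEquiv p⟩, isNilpotent_tangentMapAt_sub_one p⟩,
    fun p => ⟨isotropyGenerator p.2.2, isotropyGenerator_ne_zero _,
      isNilpotent_isotropyGenerator _, localIsotropyAlgebra_lorentzSOL p⟩,
    not_isFlat_lorentzSOL, isLorentzGeometry_isomZero, isNonRiemannian_isomZero,
    isMaximalGeometry_isomZero⟩
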